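/- **Conventions.** Everything is over $\mathbb Q$ and $\mathbb Z$-graded, with Koszul signs. A *complete differential graded Lie algebra* (complete DGL) $(L,d)$ is a graded Lie algebra with a decreasing filtration $L=F^1\supseteq F^2\supseteq\cdots$ by graded subspaces with $[F^p,F^q]\subseteq F^{p+q}$ and $L\cong\varprojlim L/F^n$ (degreewise), and a derivation $d$ of degree $-1$ with $d^2=0$, $dF^n\subseteq F^n$; morphisms preserve degrees, brackets, filtrations and differentials. $\widehat{\mathbb L}(V)=\varprojlim_n\mathbb L(V)/\mathbb L^{>n}(V)$ is the free complete graded Lie algebra on the graded vector space $V$, filtered by bracket length, and $\widehat\amalg$ denotes the coproduct in complete graded Lie algebras (resp. complete DGLs). **cDGL** is the category of the complete DGLs with $H_k(L,d)=0$ for $k<0$. A *Maurer–Cartan (MC) element* is $a\in L_{-1}$ with $da=-\frac12[a,a]$; then $d_a:=d+\mathrm{ad}_a$. A *path* from $a$ to $b$ ($a,b$ MC) is $x\in L_0$ with $dx=\mathrm{ad}_x b+\sum_{n\ge0}\frac{B_n}{n!}\mathrm{ad}_x^n(b-a)$; equivalently, a morphism to $L$ from the Lawrence–Sullivan interval $\mathcal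 L_{[0,1]}$, which is $\widehat{\mathbb L}(a,b,x)$ with $a,b$ MC and this $dx$. MC elements joined by a path are *equivalent*. In **cDGL**, a morphism $f\colon L'\to L$ is a *weak equivalence* if it is bijective on equivalence classes of MC elements and $f\colon (L',d_a)\to(L,d_{f(a)})$ is a quasi-isomorphism for every MC element $a\in L'$; a *fibration* if it is surjective; a *cofibration* if it has the left lifting property with respect to all trivial fibrations (surjective weak equivalences) of **cDGL**. A *free map* is a morphism $f\colon(L',d)\to(L,d)$ which, on the underlying complete graded Lie algebras, is the inclusion $L'\to L'\,\widehat\amalg\,\widehat{\mathbb L}(U\oplus sU\oplus V)$, where $d(su)=u$, $du=0$ for $u\in U$; $V=V_{\ge-1}$; and $V$ has a homogeneous basis such that, with $L(n):=L'\,\widehat\amalg\,\widehat{\mathbb L}(U\oplus sU\oplus V_{<n})$: basis elements of degree $-1$ are MC; for a basis element $x$ of degree $0$ either $dx=0$, or there are MC elements $a,b\in L(0)$ such that $x$ is a path from $a$ to $b$ and $a,b,x$ freely generate a complete Lie subalgebra (so that $\widehat{\mathbb L}(a,b,x)$ is a Lawrence–Sullivan interval in $L$); for a basis element $x$ of degree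 $n\ge1$ there is an MC element $a\in L(n)$ with $d_ax\in L(n)$. $(L,d)$ is *inductive* if $0\to(L,d)$ is a free map. **Cylinder construction.** Let $(L,d)$ be a complete DGL with $L\cong\widehat{\mathbb L}(V)$. Let $V'$ be a copy of $V$ and extend $d$ to $\widehat{\mathbb L}(V\oplus V'\oplus sV')$ by $dv'=0$, $d(sv')=v'$. Let $i$ be the derivation of degree $+1$ with $i(v)=sv'$, $i(v')=i(sv')=0$; put $\theta=id+di$ and $e^\theta=\sum_n\theta^n/n!$. With $\widehat V\cong V$ and $\overline V\cong sV$, let $\psi\colon\widehat{\mathbb L}(V\oplus\widehat V\oplus\overline V)\to\widehat{\mathbb L}(V\oplus V'\oplus sV')$ be the morphism of complete graded Lie algebras with $\psi(v)=v$, $\psi(\hat v)=e^\theta(v)$, $\psi(\overline v)=sv'$. When $\psi$ is an isomorphism, put $\mathrm{Cyl}(L,d)=(\widehat{\mathbb L}(V\oplus\widehat V\oplus\overline V),D)$ with $D=\psi^{-1}d\,\psi$. **Theorem.** Let $(L,d)$ be an inductive algebra in **cDGL** with $L\cong\widehat{\mathbb L}(V)$. Then $\psi$ is an isomorphism of complete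 graded Lie algebras, and the assignments $\iota_0(v)=v$, $\iota_1(v)=\hat v$, respectively $p(v)=p(\hat v)=v$, $p(\overline v)=0$, define morphisms of complete DGLs $\iota_0,\iota_1\colon(L,d)\to\mathrm{Cyl}(L,d)$ and $p\colon\mathrm{Cyl}(L,d)\to(L,d)$. Moreover: 1. $\iota_0$ and $\iota_1$ are free maps and cofibrations; 2. $\mathrm{Cyl}(L,d)$, with $\iota_0,\iota_1,p$, is a cylinder object for $(L,d)$ in **cDGL**: it belongs to **cDGL**, $p\iota_0=p\iota_1=\mathrm{id}_L$, the map $\iota_0+\iota_1\colon L\,\widehat\amalg\,L\to\mathrm{Cyl}(L,d)$ is a cofibration, and $p$ is a weak equivalence. -/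

import Mathlib

universe u

noncomputable section

/-- A complete graded Lie algebra over `ℚ`: a `ℤ`-graded Lie algebra `L = (L_k)` (with Koszul
signs) together with a decreasing filtration `L = F¹ ⊇ F² ⊇ ⋯` by graded subspaces such that
`[Fᵖ, F^q] ⊆ F^{p+q}` and such that every `L_k → lim L_k / (Fⁿ ∩ L_k)` is bijective.
The bracket `L_i × L_j → L_k` is indexed by a proof of `i + j = k`. -/
structure CGL where
  /-- the component of degree `k` -/
  obj : ℤ → Type u
  [acg : ∀ k, AddCommGroup (obj k)]
  [mod : ∀ k, Module ℚ (obj k)]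
  /-- the bracket -/
  bracket : ∀ {i j k : ℤ}, i + j = k → obj i →ₗ[ℚ] obj j →ₗ[ℚ] obj k
  skew : ∀ {i j k : ℤ} (h : i + j = k) (h' : j + i = k) (x : obj i) (y : obj j),
    bracket h x y = -((-1 : ℚ) ^ (i * j)) • bracket h' y x
  jacobi : ∀ {i j k ij jk ik n : ℤ} (hij : i + j = ij) (hjk : j + k = jk) (hik : i + k = ik)
    (h₁ : i + jk = n) (h₂ : ij + k = n) (h₃ : j + ik = n) (x : obj i) (y : obj j) (z : obj k),
    bracket h₁ x (bracket hjk y z) =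
      bracket h₂ (bracket hij x y) z + ((-1 : ℚ) ^ (i * j)) • bracket h₃ y (bracket hik x z)
  /-- the filtration -/
  fil : ℕ → ∀ k, Submodule ℚ (obj k)
  fil_one : ∀ k, fil 1 k = ⊤
  fil_anti : ∀ {m n : ℕ}, m ≤ n → ∀ k, fil n k ≤ fil m k
  fil_bracket : ∀ {p q : ℕ} {i j k : ℤ} (h : i + j = k) (x : obj i) (y : obj j),
    x ∈ fil p i → y ∈ fil q j → bracket h x y ∈ fil (p + q) k
  separated : ∀ {k : ℤ} (x : obj k), (∀ n, x ∈ fil n k) → x = 0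
  complete : ∀ {k : ℤ} (x : ℕ → obj k), (∀ n, x (n + 1) - x n ∈ fil n k) →
    ∃ y, ∀ n, y - x n ∈ fil n k

attribute [instance] CGL.acg CGL.mod

namespace CGL

instance : CoeFun CGL.{u} (fun _ => ℤ → Type u) := ⟨CGL.obj⟩

/-- Morphisms of complete graded Lie algebras: linear maps of degree `0` that preserve the brackets
and the filtrations. -/
@[ext] structure Hom (L M : CGL.{u}) where
  /-- the components -/
  app : ∀ k, L k →ₗ[ℚ] M k
  map_bracket : ∀ {i j k : ℤ} (h : i + j = k) (x : L i) (y : L j),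
    app k (L.bracket h x y) = M.bracket h (app i x) (app j y)
  map_fil : ∀ (n : ℕ) {k : ℤ} (x : L k), x ∈ L.fil n k → app k x ∈ M.fil n k

/-- The identity. -/
def Hom.id (L : CGL.{u}) : Hom L L where
  app _ := LinearMap.id
  map_bracket _ _ _ := rfl
  map_fil _ _ _ h := h

/-- Composition, `g` after `f`. -/
def Hom.comp {L M N : CGL.{u}} (g : Hom M N) (f : Hom L M) : Hom L N where
  app k := (g.app k).comp (f.app k)
  map_bracket h x y := by simp [f.map_bracket, g.map_bracket]
  map_fil n _ x hx := g.map_fil n _ (f.map_fil n x hx)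

/-- Isomorphisms of complete graded Lie algebras. -/
structure Iso (L M : CGL.{u}) where
  /-- the morphism -/
  hom : Hom L M
  /-- its inverse -/
  inv : Hom M L
  hom_inv : ∀ k x, hom.app k (inv.app k x) = x
  inv_hom : ∀ k x, inv.app k (hom.app k x) = x

/-- The inverse isomorphism. -/
def Iso.symm {L M : CGL.{u}} (e : Iso L M) : Iso M L := ⟨e.inv, e.hom, e.inv_hom, e.hom_inv⟩

/-- Derivations of degree `r` that preserve the filtration. -/
structure Der (L : CGL.{u}) (r : ℤ) where
  /-- the components -/
  app : ∀ {i j : ℤ}, i + r = j → L i →ₗ[ℚ] L j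
  leibniz : ∀ {i j k i' j' k' : ℤ} (h : i + j = k) (hi : i + r = i') (hj : j + r = j')
    (hk : k + r = k') (h₁ : i' + j = k') (h₂ : i + j' = k') (x : L i) (y : L j),
    app hk (L.bracket h x y) =
      L.bracket h₁ (app hi x) y + ((-1 : ℚ) ^ (r * i)) • L.bracket h₂ x (app hj y)
  map_fil : ∀ (n : ℕ) {i j : ℤ} (h : i + r = j) (x : L i), x ∈ L.fil n i → app h x ∈ L.fil n j

/-- Differentials: derivations of degree `-1` and square zero. -/
structure Differential (L : CGL.{u}) extends Der L (-1) where
  sq_zero : ∀ {i j k : ℤ} (h : i + -1 = j) (h' : j + -1 = k) (x : L i), app h' (app h x) = 0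

/-- Transport of a differential along an isomorphism `e : L ≅ M`: `e⁻¹ ∘ d ∘ e`. -/
def Iso.pull {L M : CGL.{u}} (e : Iso L M) (δ : Differential M) : Differential L where
  app {i j} h := (e.inv.app j).comp ((δ.app h).comp (e.hom.app i))
  leibniz h hi hj hk h₁ h₂ x y := by
    simp [e.hom.map_bracket, δ.leibniz h hi hj hk h₁ h₂, e.inv.map_bracket, e.inv_hom]
  map_fil n _ _ h x hx := e.inv.map_fil n _ (δ.map_fil n h _ (e.hom.map_fil n x hx))
  sq_zero h h' x := by simp [e.hom_inv, δ.sq_zero]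

/-- `s = ∑ₙ xₙ`, a convergent series in the topology of the filtration. -/
def IsSum (L : CGL.{u}) {k : ℤ} (x : ℕ → L k) (s : L k) : Prop :=
  ∀ N, ∃ n₀, ∀ n ≥ n₀, s - ∑ m ∈ Finset.range n, x m ∈ L.fil N k

open Classical in
/-- The sum of a convergent series (and `0` if the series diverges). -/
def sum (L : CGL.{u}) {k : ℤ} (x : ℕ → L k) : L k :=
  if h : ∃ s, L.IsSum x s then h.choose else 0

/-- `ad x` for `x` of degree `0`. -/
def ad (L : CGL.{u}) (x : L 0) (k : ℤ) : Module.End ℚ (L k) := L.bracket (zero_add k) x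

/-! ### Dual numbers -/

lemma fil_zero (L : CGL.{u}) (k : ℤ) : L.fil 0 k = ⊤ :=
  top_le_iff.1 (L.fil_one k ▸ L.fil_anti (Nat.zero_le 1) k)

lemma sgn_sq (n : ℤ) : ((-1 : ℚ) ^ n) * ((-1 : ℚ) ^ n) = 1 := by
  rw [← zpow_add₀ (by norm_num), ← two_mul, zpow_mul]; norm_num

lemma sgn_add (m n : ℤ) : ((-1 : ℚ) ^ (m + n)) = ((-1 : ℚ) ^ m) * ((-1 : ℚ) ^ n) :=
  zpow_add₀ (by norm_num) m n

/-- `L ⊕ ε L` with `ε² = 0` and `ε` of degree `-r`: morphisms `x ↦ x + ε D x` into it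
encode derivations `D` of degree `r`. -/
def dual (L : CGL.{u}) (r : ℤ) : CGL.{u} where
  obj k := L k × L (k + r)
  bracket {i j k} h := LinearMap.mk₂ ℚ
    (fun x y => (L.bracket h x.1 y.1,
      L.bracket (show i + r + j = k + r by omega) x.2 y.1 +
        ((-1 : ℚ) ^ (r * i)) • L.bracket (show i + (j + r) = k + r by omega) x.1 y.2))
    (by intros; ext <;> simp; module) (by intros; ext <;> simp; module)
    (by intros; ext <;> simp; module) (by intros; ext <;> simp; module)
  skew {i j k} h h' x y := by
    ext
    · exact L.skew h h' _ _
    · simp only [LinearMap.mk₂_apply, Prod.smul_snd]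
      rw [L.skew (show i + r + j = k + r by omega) (show j + (i + r) = k + r by omega) x.2 y.1,
        L.skew (show i + (j + r) = k + r by omega) (show j + r + i = k + r by omega) x.1 y.2]
      have e1 : ((-1 : ℚ) ^ ((i + r) * j)) = ((-1 : ℚ) ^ (i * j)) * ((-1 : ℚ) ^ (r * j)) := by
        rw [← sgn_add]; ring_nf
      have e2 : ((-1 : ℚ) ^ (i * (j + r))) = ((-1 : ℚ) ^ (i * j)) * ((-1 : ℚ) ^ (r * i)) := by
        rw [← sgn_add]; ring_nf
      rw [e1, e2]
      have := sgn_sq (r * i)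
      simp only [smul_add, smul_smul, neg_smul, smul_neg, neg_mul]
      rw [show ((-1 : ℚ) ^ (r * i)) * (((-1 : ℚ) ^ (i * j)) * ((-1 : ℚ) ^ (r * i))) =
        ((-1 : ℚ) ^ (i * j)) by linear_combination ((-1 : ℚ) ^ (i * j)) * this]
      abel
  jacobi {i j k ij jk ik n} hij hjk hik h₁ h₂ h₃ x y z := by
    ext
    · exact L.jacobi hij hjk hik h₁ h₂ h₃ _ _ _
    · simp only [LinearMap.mk₂_apply, Prod.smul_snd, Prod.snd_add]
      have a1 := L.jacobi (show i + r + j = ij + r by omega) hjk (show i + r + k = ik + r by omega)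
        (show i + r + jk = n + r by omega) (show ij + r + k = n + r by omega)
        (show j + (ik + r) = n + r by omega) x.2 y.1 z.1
      have a2 := L.jacobi (show i + (j + r) = ij + r by omega) (show j + r + k = jk + r by omega) hik
        (show i + (jk + r) = n + r by omega) (show ij + r + k = n + r by omega)
        (show j + r + ik = n + r by omega) x.1 y.2 z.1
      have a3 := L.jacobi hij (show j + (k + r) = jk + r by omega) (show i + (k + r) = ik + r by omega)
        (show i + (jk + r) = n + r by omega) (show ij + (k + r) = n + r by omega)
        (show j + (ik + r) = n + r by omega) x.1 y.1 z.2
      subst hij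
      have e1 : ((-1 : ℚ) ^ ((i + r) * j)) = ((-1 : ℚ) ^ (i * j)) * ((-1 : ℚ) ^ (r * j)) := by
        rw [← sgn_add]; ring_nf
      have e2 : ((-1 : ℚ) ^ (i * (j + r))) = ((-1 : ℚ) ^ (i * j)) * ((-1 : ℚ) ^ (r * i)) := by
        rw [← sgn_add]; ring_nf
      have e3 : ((-1 : ℚ) ^ (r * (i + j))) = ((-1 : ℚ) ^ (r * i)) * ((-1 : ℚ) ^ (r * j)) := by
        rw [← sgn_add]; ring_nf
      have q := sgn_sq (r * i)
      rw [e1] at a1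
      rw [e2] at a2
      rw [e3, a1]
      simp only [map_add, map_smul, LinearMap.add_apply, LinearMap.smul_apply, smul_add, smul_smul]
      rw [a2, a3]
      simp only [smul_add, smul_smul]
      rw [show ((-1 : ℚ) ^ (r * i)) * (((-1 : ℚ) ^ (i * j)) * ((-1 : ℚ) ^ (r * i))) =
        ((-1 : ℚ) ^ (i * j)) by linear_combination ((-1 : ℚ) ^ (i * j)) * q]
      module
  fil n k := (L.fil n k).prod (L.fil n (k + r))
  fil_one k := by rw [L.fil_one, L.fil_one, Submodule.prod_top]
  fil_anti h k := Submodule.prod_mono (L.fil_anti h k) (L.fil_anti h _)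
  fil_bracket h x y hx hy := ⟨L.fil_bracket h _ _ hx.1 hy.1,
    add_mem (L.fil_bracket _ _ _ hx.2 hy.1)
      (Submodule.smul_mem _ _ (L.fil_bracket _ _ _ hx.1 hy.2))⟩
  separated x h := Prod.ext (L.separated _ fun n => (h n).1) (L.separated _ fun n => (h n).2)
  complete x h := by
    obtain ⟨y, hy⟩ := L.complete (fun n => (x n).1) fun n => (h n).1
    obtain ⟨z, hz⟩ := L.complete (fun n => (x n).2) fun n => (h n).2
    exact ⟨(y, z), fun n => ⟨hy n, hz n⟩⟩


/-! ### The free graded Lie algebra on a graded set -/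

/-- The degree of a bracketing (a planar binary tree with leaves in `X`). -/
def treeDeg {X : Type u} (deg : X → ℤ) : FreeMagma X → ℤ
  | .of x => deg x
  | .mul s t => treeDeg deg s + treeDeg deg t

/-- The bilinear product on the vector space spanned by the bracketings. -/
def treeMul (X : Type u) : (FreeMagma X →₀ ℚ) →ₗ[ℚ] (FreeMagma X →₀ ℚ) →ₗ[ℚ] (FreeMagma X →₀ ℚ) :=
  Finsupp.lift _ ℚ _ fun s => Finsupp.lmapDomain ℚ ℚ (s * ·)

/-- A bracketing as a vector. -/
abbrev tree {X : Type u} (t : FreeMagma X) : FreeMagma X →₀ ℚ := Finsupp.single t 1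

lemma treeMul_tree {X : Type u} (s t : FreeMagma X) :
    treeMul X (tree s) (tree t) = tree (s * t) := by
  simp [treeMul, Finsupp.lmapDomain, Finsupp.mapDomain_single]

/-- The relations of graded Lie algebras: graded antisymmetry, the graded Jacobi identity and
all their consequences by bracketing. -/
inductive LieRel {X : Type u} (deg : X → ℤ) : (FreeMagma X →₀ ℚ) → Prop
  | skew (s t : FreeMagma X) :
      LieRel deg (tree (s * t) + ((-1 : ℚ) ^ (treeDeg deg s * treeDeg deg t)) • tree (t * s))
  | jacobi (s t r : FreeMagma X) :
      LieRel deg (tree (s * (t * r)) - tree (s * t * r) -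
        ((-1 : ℚ) ^ (treeDeg deg s * treeDeg deg t)) • tree (t * (s * r)))
  | left (s : FreeMagma X) (a : FreeMagma X →₀ ℚ) : LieRel deg a → LieRel deg (treeMul X (tree s) a)
  | right (s : FreeMagma X) (a : FreeMagma X →₀ ℚ) : LieRel deg a → LieRel deg (treeMul X a (tree s))

/-- The ideal of relations. -/
def lieIdeal {X : Type u} (deg : X → ℤ) : Submodule ℚ (FreeMagma X →₀ ℚ) :=
  Submodule.span ℚ {a | LieRel deg a}

lemma treeMul_mem_right {X : Type u} (deg : X → ℤ) (a b : FreeMagma X →₀ ℚ)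
    (hb : b ∈ lieIdeal deg) : treeMul X a b ∈ lieIdeal deg := by
  induction a using Finsupp.induction_linear with
  | zero => simp
  | add f g hf hg => rw [map_add]; exact add_mem hf hg
  | single s c =>
    have hs : Finsupp.single s c = c • tree s := by simp
    rw [hs, map_smul, LinearMap.smul_apply]
    refine Submodule.smul_mem _ _ ?_
    induction hb using Submodule.span_induction with
    | mem b hb => exact Submodule.subset_span (.left s b hb)
    | zero => simp
    | add x y _ _ hx hy => rw [map_add]; exact add_mem hx hy
    | smul r x _ hx => rw [map_smul]; exact Submodule.smul_mem _ _ hx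

lemma treeMul_mem_left {X : Type u} (deg : X → ℤ) (b a : FreeMagma X →₀ ℚ)
    (hb : b ∈ lieIdeal deg) : treeMul X b a ∈ lieIdeal deg := by
  induction a using Finsupp.induction_linear with
  | zero => simp
  | add f g hf hg => rw [map_add]; exact add_mem hf hg
  | single s c =>
    have hs : Finsupp.single s c = c • tree s := by simp
    rw [hs, map_smul]
    refine Submodule.smul_mem _ _ ?_
    induction hb using Submodule.span_induction with
    | mem b hb => exact Submodule.subset_span (.right s b hb)
    | zero => simp
    | add x y _ _ hx hy => rw [map_add, LinearMap.add_apply]; exact add_mem hx hy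
    | smul r x _ hx =>
      rw [map_smul, LinearMap.smul_apply]; exact Submodule.smul_mem _ _ hx

/-- The free graded Lie algebra `𝕃(X)` on the graded set `X` (all degrees together). -/
abbrev FL {X : Type u} (deg : X → ℤ) : Type u := (FreeMagma X →₀ ℚ) ⧸ lieIdeal deg

namespace FL

variable {X : Type u} (deg : X → ℤ)

/-- The class of a bracketing. -/
def mk (t : FreeMagma X) : FL deg := (lieIdeal deg).mkQ (tree t)

/-- The bracket of `𝕃(X)`. -/
def br : FL deg →ₗ[ℚ] FL deg →ₗ[ℚ] FL deg :=
  (lieIdeal deg).liftQ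
    (((lieIdeal deg).liftQ ((treeMul X).compr₂ (lieIdeal deg).mkQ).flip (by
      intro b hb
      refine LinearMap.ext fun a => ?_
      simpa using treeMul_mem_right deg a b hb)).flip) (by
      intro b hb
      refine LinearMap.ext fun a => ?_
      obtain ⟨a, rfl⟩ := (lieIdeal deg).mkQ_surjective a
      exact (Submodule.Quotient.mk_eq_zero _).2 (treeMul_mem_left deg b a hb))

lemma br_mk (s t : FreeMagma X) : br deg (mk deg s) (mk deg t) = mk deg (s * t) := by
  rw [mk, mk, mk, ← treeMul_tree]; rfl

/-- `𝕃ⁿ(X)_k`: combinations of brackets of length `n` and degree `k`. -/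
def homog (n : ℕ) (k : ℤ) : Submodule ℚ (FL deg) :=
  Submodule.span ℚ {a | ∃ t : FreeMagma X, t.length = n ∧ treeDeg deg t = k ∧ mk deg t = a}

variable {deg}

lemma homog_zero {k : ℤ} {a : FL deg} (ha : a ∈ homog deg 0 k) : a = 0 := by
  have : homog deg 0 k = ⊥ := by
    rw [homog, Submodule.span_eq_bot]
    rintro _ ⟨t, ht, -⟩
    exact absurd ht t.length_pos.ne'
  simpa [this] using ha

lemma br_mem {p q : ℕ} {i j : ℤ} {a b : FL deg} (ha : a ∈ homog deg p i) (hb : b ∈ homog deg q j) :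
    br deg a b ∈ homog deg (p + q) (i + j) := by
  induction ha, hb using Submodule.span_induction₂ with
  | mem_mem a b ha hb =>
    obtain ⟨s, rfl, rfl, rfl⟩ := ha
    obtain ⟨t, rfl, rfl, rfl⟩ := hb
    rw [br_mk]
    exact Submodule.subset_span ⟨s * t, rfl, rfl, rfl⟩
  | zero_left => simp
  | zero_right => simp
  | add_left x y z _ _ _ h1 h2 => rw [map_add, LinearMap.add_apply]; exact add_mem h1 h2
  | add_right x y z _ _ _ h1 h2 => rw [map_add]; exact add_mem h1 h2
  | smul_left r x y _ _ h =>
    rw [map_smul, LinearMap.smul_apply]; exact Submodule.smul_mem _ _ h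
  | smul_right r x y _ _ h => rw [map_smul]; exact Submodule.smul_mem _ _ h

lemma br_skew {p q : ℕ} {i j : ℤ} {a b : FL deg} (ha : a ∈ homog deg p i)
    (hb : b ∈ homog deg q j) : br deg a b = -((-1 : ℚ) ^ (i * j)) • br deg b a := by
  induction ha, hb using Submodule.span_induction₂ with
  | mem_mem a b ha hb =>
    obtain ⟨s, rfl, rfl, rfl⟩ := ha
    obtain ⟨t, rfl, rfl, rfl⟩ := hb
    rw [br_mk, br_mk, neg_smul, eq_neg_iff_add_eq_zero]
    exact (Submodule.Quotient.mk_eq_zero _).2 (Submodule.subset_span (LieRel.skew s t))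
  | zero_left => simp
  | zero_right => simp
  | add_left x y z _ _ _ h1 h2 => rw [map_add, LinearMap.add_apply, h1, h2, map_add, smul_add]
  | add_right x y z _ _ _ h1 h2 => rw [map_add, h1, h2, map_add, LinearMap.add_apply, smul_add]
  | smul_left r x y _ _ h => rw [map_smul, LinearMap.smul_apply, h, map_smul, smul_comm]
  | smul_right r x y _ _ h => rw [map_smul, h, map_smul, LinearMap.smul_apply, smul_comm]

lemma br_jacobi {p q r : ℕ} {i j k : ℤ} {a b c : FL deg} (ha : a ∈ homog deg p i)
    (hb : b ∈ homog deg q j) (hc : c ∈ homog deg r k) :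
    br deg a (br deg b c) =
      br deg (br deg a b) c + ((-1 : ℚ) ^ (i * j)) • br deg b (br deg a c) := by
  induction hc using Submodule.span_induction with
  | zero => simp
  | add x y _ _ h1 h2 => simp only [map_add, h1, h2, smul_add]; abel
  | smul s x _ h => simp only [map_smul, h, smul_add]; rw [smul_comm]
  | mem c hc =>
    obtain ⟨w, rfl, rfl, rfl⟩ := hc
    induction ha, hb using Submodule.span_induction₂ with
    | mem_mem a b ha hb =>
      obtain ⟨s, rfl, rfl, rfl⟩ := ha
      obtain ⟨t, rfl, rfl, rfl⟩ := hb
      simp only [br_mk]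
      rw [← sub_eq_zero, ← sub_sub]
      exact (Submodule.Quotient.mk_eq_zero _).2 (Submodule.subset_span (LieRel.jacobi s t w))
    | zero_left => simp
    | zero_right => simp
    | add_left x y z _ _ _ h1 h2 =>
      simp only [map_add, LinearMap.add_apply, h1, h2, smul_add]; abel
    | add_right x y z _ _ _ h1 h2 =>
      simp only [map_add, LinearMap.add_apply, h1, h2, smul_add]; abel
    | smul_left s x y _ _ h =>
      simp only [map_smul, LinearMap.smul_apply, h, smul_add]; rw [smul_comm]
    | smul_right s x y _ _ h =>
      simp only [map_smul, LinearMap.smul_apply, h, smul_add]; rw [smul_comm]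

/-! Cauchy products of sequences -/

lemma sum_anti {M : Type*} [AddCommMonoid M] {n N : ℕ} (h : n < N) (F : ℕ → ℕ → M) :
    ∑ p ∈ Finset.HasAntidiagonal.antidiagonal n, F p.1 p.2 =
      ∑ p ∈ Finset.range N, ∑ q ∈ Finset.range N, if p + q = n then F p q else 0 := by
  rw [← Finset.sum_product', ← Finset.sum_filter]
  refine Finset.sum_congr ?_ fun _ _ => rfl
  ext ⟨p, q⟩
  simp only [Finset.HasAntidiagonal.mem_antidiagonal, Finset.mem_filter, Finset.mem_product, Finset.mem_range]
  omega

lemma sum_anti₂ {M : Type*} [AddCommMonoid M] {n N : ℕ} (h : n < N) (F : ℕ → ℕ → ℕ → M) :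
    ∑ p ∈ Finset.HasAntidiagonal.antidiagonal n, ∑ q ∈ Finset.HasAntidiagonal.antidiagonal p.2, F p.1 q.1 q.2 =
      ∑ p ∈ Finset.range N, ∑ q ∈ Finset.range N, ∑ r ∈ Finset.range N,
        if p + q + r = n then F p q r else 0 := by
  rw [sum_anti h (fun p m => ∑ q ∈ Finset.HasAntidiagonal.antidiagonal m, F p q.1 q.2)]
  refine Finset.sum_congr rfl fun p _ => ?_
  have : ∀ m ∈ Finset.range N, (if p + m = n then ∑ q ∈ Finset.HasAntidiagonal.antidiagonal m, F p q.1 q.2 else 0) =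
      ∑ q ∈ Finset.range N, ∑ r ∈ Finset.range N, if q + r = m then
        (if p + m = n then F p q r else 0) else 0 := by
    intro m hm
    split_ifs with hp
    · rw [sum_anti (Finset.mem_range.1 hm) (fun q r => F p q r)]
    · simp
  rw [Finset.sum_congr rfl this, Finset.sum_comm]
  refine Finset.sum_congr rfl fun q _ => ?_
  rw [Finset.sum_comm]
  refine Finset.sum_congr rfl fun r _ => ?_
  rw [Finset.sum_ite_eq]
  simp only [Finset.mem_range]
  split_ifs <;> first | rfl | omega

end FL

/-- The free complete graded Lie algebra `𝕃̂(V) = lim 𝕃(V)/𝕃^{>n}(V)` on the graded vector space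
`V` with homogeneous basis `X`: its component of degree `k` is `∏ₙ 𝕃ⁿ(V)_k`, with the filtration
by bracket length. -/
def free {X : Type u} (deg : X → ℤ) : CGL.{u} where
  obj k := ↥(Submodule.pi Set.univ fun n : ℕ => FL.homog deg n k)
  bracket {i j k} h := LinearMap.mk₂ ℚ
    (fun f g => ⟨fun n => ∑ p ∈ Finset.HasAntidiagonal.antidiagonal n, FL.br deg (f.1 p.1) (g.1 p.2), by
      intro n _
      refine Submodule.sum_mem _ fun p hp => ?_
      have := FL.br_mem (f.2 p.1 trivial) (g.2 p.2 trivial)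
      rwa [Finset.HasAntidiagonal.mem_antidiagonal.1 hp, h] at this⟩)
    (by intros; ext n; simp [Finset.sum_add_distrib])
    (by intros; ext n; simp [Finset.smul_sum])
    (by intros; ext n; simp [Finset.sum_add_distrib])
    (by intros; ext n; simp [Finset.smul_sum])
  skew {i j k} h h' f g := by
    ext n
    simp only [LinearMap.mk₂_apply, Submodule.coe_smul, Pi.smul_apply, Finset.smul_sum]
    rw [← Finset.Nat.sum_antidiagonal_swap]
    exact Finset.sum_congr rfl fun p _ => FL.br_skew (f.2 _ trivial) (g.2 _ trivial)
  jacobi {i j k ij jk ik n} hij hjk hik h₁ h₂ h₃ f g w := by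
    ext n
    simp only [LinearMap.mk₂_apply, Submodule.coe_smul, Pi.smul_apply, Finset.smul_sum,
      Submodule.coe_add, Pi.add_apply, map_sum, LinearMap.sum_apply]
    rw [FL.sum_anti₂ n.lt_succ_self fun p q r => FL.br deg (f.1 p) (FL.br deg (g.1 q) (w.1 r)),
      FL.sum_anti₂ n.lt_succ_self fun q p r =>
        ((-1 : ℚ) ^ (i * j)) • FL.br deg (g.1 q) (FL.br deg (f.1 p) (w.1 r)),
      ← Finset.Nat.sum_antidiagonal_swap]
    simp only [Prod.fst_swap, Prod.snd_swap]
    rw [FL.sum_anti₂ n.lt_succ_self fun r p q => FL.br deg (FL.br deg (f.1 p) (g.1 q)) (w.1 r)]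
    have e1 : ∀ (F : ℕ → ℕ → ℕ → FL deg), (∑ r ∈ Finset.range n.succ, ∑ p ∈ Finset.range n.succ,
        ∑ q ∈ Finset.range n.succ, F r p q) = ∑ p ∈ Finset.range n.succ, ∑ q ∈ Finset.range n.succ,
        ∑ r ∈ Finset.range n.succ, F r p q := by
      intro F
      rw [Finset.sum_comm]
      exact Finset.sum_congr rfl fun p _ => Finset.sum_comm
    have e2 : ∀ (F : ℕ → ℕ → ℕ → FL deg), (∑ q ∈ Finset.range n.succ, ∑ p ∈ Finset.range n.succ,
        ∑ r ∈ Finset.range n.succ, F q p r) = ∑ p ∈ Finset.range n.succ, ∑ q ∈ Finset.range n.succ,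
        ∑ r ∈ Finset.range n.succ, F q p r := fun F => Finset.sum_comm
    rw [e1 (fun r p q => if r + p + q = n then FL.br deg (FL.br deg (f.1 p) (g.1 q)) (w.1 r) else 0),
      e2 (fun q p r => if q + p + r = n then ((-1 : ℚ) ^ (i * j)) •
        FL.br deg (g.1 q) (FL.br deg (f.1 p) (w.1 r)) else 0),
      ← Finset.sum_add_distrib]
    refine Finset.sum_congr rfl fun p _ => ?_
    rw [← Finset.sum_add_distrib]
    refine Finset.sum_congr rfl fun q _ => ?_
    rw [← Finset.sum_add_distrib]
    refine Finset.sum_congr rfl fun r _ => ?_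
    rw [show r + p + q = p + q + r by omega, show q + p + r = p + q + r by omega]
    split_ifs
    · exact FL.br_jacobi (f.2 _ trivial) (g.2 _ trivial) (w.2 _ trivial)
    · simp
  fil n k :=
    { carrier := {f | ∀ m < n, f.1 m = 0}
      add_mem' := fun ha hb m hm => by simp [ha m hm, hb m hm]
      zero_mem' := fun _ _ => rfl
      smul_mem' := fun c x hx m hm => by simp [hx m hm] }
  fil_one k := by
    refine eq_top_iff.2 fun f _ m hm => ?_
    obtain rfl : m = 0 := by omega
    exact FL.homog_zero (f.2 0 trivial)
  fil_anti h k f hf m hm := hf m (hm.trans_le h)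
  fil_bracket {p q i j k} h f g hf hg m hm := by
    simp only [LinearMap.mk₂_apply]
    refine Finset.sum_eq_zero fun s hs => ?_
    have := Finset.HasAntidiagonal.mem_antidiagonal.1 hs
    rcases lt_or_ge s.1 p with h1 | h1
    · rw [hf _ h1]; simp
    · rw [hg _ (by omega)]; simp
  separated f h := by ext m; exact h (m + 1) m m.lt_succ_self
  complete {k} x h := by
    refine ⟨⟨fun m => (x (m + 1)).1 m, fun m _ => (x (m + 1)).2 m trivial⟩, fun n m hm => ?_⟩
    have key : ∀ n, m < n → (x n).1 m = (x (m + 1)).1 m := by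
      intro n hn
      induction n, hn using Nat.le_induction with
      | base => rfl
      | succ n hn ih => rw [← ih]; exact sub_eq_zero.1 (h n m hn)
    exact sub_eq_zero.2 (key n hm).symm

namespace free

variable {X : Type u} {deg : X → ℤ}

/-- The components of an element of `𝕃̂(V)`, indexed by bracket length. -/
def coeff {k : ℤ} : free deg k →ₗ[ℚ] (ℕ → FL deg) :=
  (Submodule.pi Set.univ fun n : ℕ => FL.homog deg n k).subtype

lemma coeff_mem {k : ℤ} (f : free deg k) (n : ℕ) : coeff f n ∈ FL.homog deg n k := f.2 n trivial

lemma ext_coeff {k : ℤ} {f g : free deg k} (h : ∀ n, coeff f n = coeff g n) : f = g :=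
  Subtype.ext (funext h)

lemma coeff_bracket {i j k : ℤ} (h : i + j = k) (f : free deg i) (g : free deg j) (n : ℕ) :
    coeff ((free deg).bracket h f g) n =
      ∑ p ∈ Finset.HasAntidiagonal.antidiagonal n, FL.br deg (coeff f p.1) (coeff g p.2) := rfl

lemma mem_fil {k : ℤ} (f : free deg k) (n : ℕ) :
    f ∈ (free deg).fil n k ↔ ∀ m < n, coeff f m = 0 := Iff.rfl

/-- The element of `𝕃̂(V)` with the single component `a ∈ 𝕃ⁿ(V)_k`. -/
def single {n : ℕ} {k : ℤ} (a : FL deg) (ha : a ∈ FL.homog deg n k) : free deg k :=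
  ⟨Pi.single n a, fun m _ => by
    by_cases h : m = n
    · subst h; simpa using ha
    · simp [h]⟩

lemma coeff_single {n : ℕ} {k : ℤ} (a : FL deg) (ha : a ∈ FL.homog deg n k) :
    coeff (single a ha) = Pi.single n a := rfl

lemma mk_mem (t : FreeMagma X) : FL.mk deg t ∈ FL.homog deg t.length (treeDeg deg t) :=
  Submodule.subset_span ⟨t, rfl, rfl, rfl⟩

/-- The generator `x`, of degree `deg x = k`. -/
def gen (x : X) {k : ℤ} (h : deg x = k) : free deg k :=
  single (n := 1) (FL.mk deg (.of x)) (h ▸ mk_mem (.of x))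

lemma mk_mul_mem (s t : FreeMagma X) : FL.mk deg (s * t) ∈
    FL.homog deg (s.length + t.length) (treeDeg deg s + treeDeg deg t) := mk_mem (s * t)

lemma single_mul (s t : FreeMagma X) :
    (free deg).bracket rfl (single _ (mk_mem (deg := deg) s)) (single _ (mk_mem (deg := deg) t)) =
      single _ (mk_mul_mem s t) := by
  refine ext_coeff fun n => ?_
  rw [coeff_bracket]
  simp only [coeff_single]
  by_cases hn : n = s.length + t.length
  · subst hn
    rw [Finset.sum_eq_single (s.length, t.length)]
    · simp [FL.br_mk]
    · rintro ⟨p, q⟩ hpq hne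
      by_cases hp : p = s.length
      · have hq : q ≠ t.length := fun hq => hne (by rw [hp, hq])
        simp [hq]
      · simp [hp]
    · intro h
      exact absurd (Finset.HasAntidiagonal.mem_antidiagonal.2 (by rfl)) h
  · rw [Pi.single_eq_of_ne hn]
    refine Finset.sum_eq_zero fun p hp => ?_
    have := Finset.HasAntidiagonal.mem_antidiagonal.1 hp
    by_cases h1 : p.1 = s.length
    · have h2 : p.2 ≠ t.length := fun h2 => hn (by rw [← this, h1, h2])
      simp [h2]
    · simp [h1]

/-- A closed graded Lie subalgebra of `𝕃̂(V)` that contains the generators is everything. -/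
lemma closed_induction (P : ∀ k, Submodule ℚ (free deg k)) (hgen : ∀ x, gen x rfl ∈ P (deg x))
    (hbr : ∀ {i j k : ℤ} (h : i + j = k) (x : free deg i) (y : free deg j), x ∈ P i → y ∈ P j →
      (free deg).bracket h x y ∈ P k)
    (hcl : ∀ {k : ℤ} (x : free deg k), (∀ n, ∃ y ∈ P k, x - y ∈ (free deg).fil n k) → x ∈ P k)
    {k : ℤ} (x : free deg k) : x ∈ P k := by
  have htree : ∀ t : FreeMagma X, single _ (mk_mem (deg := deg) t) ∈ P (treeDeg deg t) := by
    intro t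
    induction t with
    | ih1 x => exact hgen x
    | ih2 s t hs ht =>
      have h := hbr rfl _ _ hs ht
      rw [single_mul] at h
      exact h
  have hsingle : ∀ (n : ℕ) (a : FL deg) (ha : a ∈ FL.homog deg n k), single a ha ∈ P k := by
    intro n a ha
    induction ha using Submodule.span_induction with
    | mem a h =>
      obtain ⟨t, rfl, rfl, rfl⟩ := h
      exact htree t
    | zero =>
      convert (P k).zero_mem
      refine ext_coeff fun m => ?_
      change (Pi.single n 0 : ℕ → FL deg) m = 0
      simp
    | add a b ha hb h1 h2 =>
      convert add_mem h1 h2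
      refine ext_coeff fun m => ?_
      change (Pi.single n (a + b) : ℕ → FL deg) m =
        (Pi.single n a : ℕ → FL deg) m + (Pi.single n b : ℕ → FL deg) m
      rw [Pi.single_add, Pi.add_apply]
    | smul r a ha h =>
      convert Submodule.smul_mem _ r h
      refine ext_coeff fun m => ?_
      change (Pi.single n (r • a) : ℕ → FL deg) m = r • (Pi.single n a : ℕ → FL deg) m
      rw [Pi.single_smul, Pi.smul_apply]
  refine hcl x fun n => ⟨∑ m ∈ Finset.range n, single (coeff x m) (coeff_mem x m),
    Submodule.sum_mem _ fun m _ => hsingle _ _ _, (mem_fil _ _).2 fun m hm => ?_⟩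
  rw [map_sub, Pi.sub_apply, map_sum, Finset.sum_apply, Finset.sum_eq_single m]
  · simp [coeff_single]
  · intro b _ hb; simp [coeff_single, hb.symm]
  · intro h; exact absurd (Finset.mem_range.2 hm) h

lemma hom_ext {M : CGL.{u}} (f g : Hom (free deg) M)
    (h : ∀ x, f.app _ (gen x rfl) = g.app _ (gen x rfl)) {k : ℤ} (x : free deg k) :
    f.app k x = g.app k x := by
  refine closed_induction (fun k => LinearMap.eqLocus (f.app k) (g.app k)) h ?_ ?_ x
  · intro i j k h x y hx hy
    simp only [LinearMap.mem_eqLocus] at *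
    rw [f.map_bracket, g.map_bracket, hx, hy]
  · intro k x hx
    simp only [LinearMap.mem_eqLocus] at *
    refine sub_eq_zero.1 (M.separated _ fun n => ?_)
    obtain ⟨y, hy, hxy⟩ := hx n
    have := sub_mem (f.map_fil n _ hxy) (g.map_fil n _ hxy)
    rw [map_sub, map_sub, hy] at this
    simpa using this

section lift

variable {M : CGL.{u}} (m : ∀ x, M (deg x))

/-- The value of a bracketing. -/
def ev : ∀ t : FreeMagma X, M (treeDeg deg t)
  | .of x => m x
  | .mul s t => M.bracket rfl (ev s) (ev t)

/-- Evaluation of combinations of bracketings. -/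
def evLin : (FreeMagma X →₀ ℚ) →ₗ[ℚ] (∀ k, M k) :=
  Finsupp.lift _ ℚ _ fun t => Pi.single (treeDeg deg t) (ev m t)

lemma evLin_tree (t : FreeMagma X) : evLin m (tree t) = Pi.single (treeDeg deg t) (ev m t) := by
  simp [evLin]

lemma evLin_tree_apply (t : FreeMagma X) {k : ℤ} (h : treeDeg deg t = k) :
    evLin m (tree t) k = h ▸ ev m t := by
  subst h; simp [evLin_tree]

lemma evLin_tree_ne (t : FreeMagma X) {k : ℤ} (h : treeDeg deg t ≠ k) :
    evLin m (tree t) k = 0 := by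
  rw [evLin_tree, Pi.single_eq_of_ne h.symm]

lemma evLin_left (s : FreeMagma X) (a : FreeMagma X →₀ ℚ) {j k : ℤ} (h : treeDeg deg s + j = k) :
    evLin m (treeMul X (tree s) a) k = M.bracket h (ev m s) (evLin m a j) := by
  induction a using Finsupp.induction_linear with
  | zero => simp
  | add f g hf hg => simp only [map_add, Pi.add_apply, hf, hg]
  | single t c =>
    have ht : Finsupp.single t c = c • tree t := by simp
    rw [ht]
    simp only [map_smul, Pi.smul_apply, treeMul_tree]
    congr 1
    by_cases hj : treeDeg deg t = j
    · subst hj; subst h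
      rw [evLin_tree_apply m t rfl]
      exact evLin_tree_apply m (s * t) rfl
    · rw [evLin_tree_ne m t hj, map_zero]
      exact evLin_tree_ne m _ fun h' => hj (by
        change treeDeg deg s + treeDeg deg t = k at h'; omega)

lemma evLin_right (s : FreeMagma X) (a : FreeMagma X →₀ ℚ) {j k : ℤ} (h : j + treeDeg deg s = k) :
    evLin m (treeMul X a (tree s)) k = M.bracket h (evLin m a j) (ev m s) := by
  induction a using Finsupp.induction_linear with
  | zero => simp
  | add f g hf hg => simp only [map_add, Pi.add_apply, LinearMap.add_apply, hf, hg]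
  | single t c =>
    have ht : Finsupp.single t c = c • tree t := by simp
    rw [ht]
    simp only [map_smul, Pi.smul_apply, LinearMap.smul_apply, treeMul_tree]
    congr 1
    by_cases hj : treeDeg deg t = j
    · subst hj; subst h
      rw [evLin_tree_apply m t rfl]
      exact evLin_tree_apply m (t * s) rfl
    · rw [evLin_tree_ne m t hj, map_zero, LinearMap.zero_apply]
      exact evLin_tree_ne m _ fun h' => hj (by
        change treeDeg deg t + treeDeg deg s = k at h'; omega)

lemma evLin_rel (a : FreeMagma X →₀ ℚ) (ha : LieRel deg a) : evLin m a = 0 := by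
  induction ha with
  | skew s t =>
    funext k
    rw [map_add, map_smul, Pi.add_apply, Pi.smul_apply, Pi.zero_apply]
    by_cases hk : treeDeg deg s + treeDeg deg t = k
    · subst hk
      have e1 : evLin m (tree (s * t)) (treeDeg deg s + treeDeg deg t) =
          M.bracket rfl (ev m s) (ev m t) := evLin_tree_apply m (s * t) rfl
      have e2 : evLin m (tree (t * s)) (treeDeg deg s + treeDeg deg t) =
          M.bracket (add_comm _ _) (ev m t) (ev m s) := by
        rw [← treeMul_tree, evLin_left m t (tree s) (add_comm _ _), evLin_tree_apply m s rfl]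
      rw [e1, e2, M.skew rfl (add_comm _ _)]
      module
    · rw [evLin_tree_ne m (s * t) hk, evLin_tree_ne m (t * s)
        (by change treeDeg deg t + treeDeg deg s ≠ k; omega)]
      simp
  | jacobi s t r =>
    funext k
    rw [map_sub, map_sub, map_smul, Pi.sub_apply, Pi.sub_apply, Pi.smul_apply, Pi.zero_apply]
    by_cases hk : treeDeg deg s + (treeDeg deg t + treeDeg deg r) = k
    · have e1 : evLin m (tree (s * (t * r))) k =
          M.bracket hk (ev m s) (M.bracket rfl (ev m t) (ev m r)) := by
        rw [← treeMul_tree, evLin_left m s _ hk, ← treeMul_tree, evLin_left m t _ rfl,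
          evLin_tree_apply m r rfl]
      have e2 : evLin m (tree (s * t * r)) k =
          M.bracket (by omega) (M.bracket rfl (ev m s) (ev m t)) (ev m r) := by
        rw [← treeMul_tree, evLin_right m r _ (j := treeDeg deg s + treeDeg deg t) (by omega),
          ← treeMul_tree, evLin_left m s _ rfl, evLin_tree_apply m t rfl]
      have e3 : evLin m (tree (t * (s * r))) k =
          M.bracket (by omega) (ev m t) (M.bracket rfl (ev m s) (ev m r)) := by
        rw [← treeMul_tree, evLin_left m t _ (j := treeDeg deg s + treeDeg deg r) (by omega),
          ← treeMul_tree, evLin_left m s _ rfl, evLin_tree_apply m r rfl]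
      rw [e1, e2, e3, M.jacobi rfl rfl rfl hk (by omega) (by omega)]
      module
    · rw [evLin_tree_ne m _ (by exact hk), evLin_tree_ne m (s * t * r)
        (by change treeDeg deg s + treeDeg deg t + treeDeg deg r ≠ k; omega),
        evLin_tree_ne m (t * (s * r))
        (by change treeDeg deg t + (treeDeg deg s + treeDeg deg r) ≠ k; omega)]
      simp
  | left s a _ ih =>
    funext k
    rw [evLin_left m s a (j := k - treeDeg deg s) (by omega), ih]
    simp
  | right s a _ ih =>
    funext k
    rw [evLin_right m s a (j := k - treeDeg deg s) (by omega), ih]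
    simp

/-- The extension to `𝕃(X)` of a map on the generators. -/
def evQ : FL deg →ₗ[ℚ] (∀ k, M k) :=
  (lieIdeal deg).liftQ (evLin m) (Submodule.span_le.2 fun a ha => evLin_rel m a ha)

lemma evQ_mk (t : FreeMagma X) {k : ℤ} (h : treeDeg deg t = k) :
    evQ m (FL.mk deg t) k = h ▸ ev m t := evLin_tree_apply m t h

lemma evQ_br {p q : ℕ} {i j k : ℤ} (h : i + j = k) {a b : FL deg} (ha : a ∈ FL.homog deg p i)
    (hb : b ∈ FL.homog deg q j) :
    evQ m (FL.br deg a b) k = M.bracket h (evQ m a i) (evQ m b j) := by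
  induction ha, hb using Submodule.span_induction₂ with
  | mem_mem a b ha hb =>
    obtain ⟨s, rfl, rfl, rfl⟩ := ha
    obtain ⟨t, rfl, rfl, rfl⟩ := hb
    subst h
    rw [FL.br_mk, evQ_mk m s rfl, evQ_mk m t rfl]
    exact evQ_mk m (s * t) rfl
  | zero_left => simp
  | zero_right => simp
  | add_left x y z _ _ _ h1 h2 => simp only [map_add, LinearMap.add_apply, Pi.add_apply, h1, h2]
  | add_right x y z _ _ _ h1 h2 => simp only [map_add, Pi.add_apply, h1, h2]
  | smul_left r x y _ _ h => simp only [map_smul, LinearMap.smul_apply, Pi.smul_apply, h]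
  | smul_right r x y _ _ h => simp only [map_smul, Pi.smul_apply, h]

lemma ev_mem (t : FreeMagma X) : ev m t ∈ M.fil t.length (treeDeg deg t) := by
  induction t with
  | ih1 x =>
    change m x ∈ M.fil 1 (deg x)
    rw [M.fil_one]; trivial
  | ih2 s t hs ht => exact M.fil_bracket rfl _ _ hs ht

lemma evQ_mem {n : ℕ} {k : ℤ} {a : FL deg} (ha : a ∈ FL.homog deg n k) :
    evQ m a k ∈ M.fil n k := by
  induction ha using Submodule.span_induction with
  | mem a ha =>
    obtain ⟨t, rfl, rfl, rfl⟩ := ha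
    rw [evQ_mk m t rfl]; exact ev_mem m t
  | zero => simp
  | add a b _ _ h1 h2 => rw [map_add]; exact add_mem h1 h2
  | smul r a _ h => rw [map_smul]; exact Submodule.smul_mem _ _ h

/-- Partial sums. -/
def evPart (N : ℕ) {k : ℤ} (f : free deg k) : M k := ∑ n ∈ Finset.range N, evQ m (coeff f n) k

lemma exists_ev {k : ℤ} (f : free deg k) : ∃ y : M k, ∀ N, y - evPart m N f ∈ M.fil N k :=
  M.complete (fun N => evPart m N f) fun N => by
    simp only [evPart, Finset.sum_range_succ, add_sub_cancel_left]
    exact evQ_mem m (coeff_mem f N)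

/-- The value of an infinite series of brackets. -/
def evLim {k : ℤ} (f : free deg k) : M k := (exists_ev m f).choose

lemma evLim_spec {k : ℤ} (f : free deg k) (N : ℕ) : evLim m f - evPart m N f ∈ M.fil N k :=
  (exists_ev m f).choose_spec N

lemma evLim_unique {k : ℤ} (f : free deg k) (y : M k) (h : ∀ N, y - evPart m N f ∈ M.fil N k) :
    evLim m f = y := by
  refine sub_eq_zero.1 (M.separated _ fun n => ?_)
  have := sub_mem (evLim_spec m f n) (h n)
  simpa using this

/-- The universal property of `𝕃̂(V)`: the morphism with given values on the generators. -/
def lift : Hom (free deg) M where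
  app k :=
    { toFun := evLim m
      map_add' := fun f g => by
        refine evLim_unique m _ _ fun N => ?_
        have := add_mem (evLim_spec m f N) (evLim_spec m g N)
        have e : evPart m N (f + g) = evPart m N f + evPart m N g := by
          simp [evPart, Finset.sum_add_distrib]
        rw [e]
        convert this using 1
        abel
      map_smul' := fun c f => by
        refine evLim_unique m _ _ fun N => ?_
        have := Submodule.smul_mem _ c (evLim_spec m f N)
        have e : evPart m N (c • f) = c • evPart m N f := by
          simp [evPart, Finset.smul_sum]
        rw [e, RingHom.id_apply, ← smul_sub]
        exact this }
  map_bracket {i j k} h f g := by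
    change evLim m _ = M.bracket h (evLim m f) (evLim m g)
    refine evLim_unique m _ _ fun N => ?_
    have e : evPart m N ((free deg).bracket h f g) =
        ∑ p ∈ Finset.range N, ∑ q ∈ Finset.range N, if p + q < N then
          M.bracket h (evQ m (coeff f p) i) (evQ m (coeff g q) j) else 0 := by
      have e1 : ∀ n ∈ Finset.range N, evQ m (coeff ((free deg).bracket h f g) n) k =
          ∑ p ∈ Finset.range N, ∑ q ∈ Finset.range N, if p + q = n then
            M.bracket h (evQ m (coeff f p) i) (evQ m (coeff g q) j) else 0 := by
        intro n hn
        rw [coeff_bracket, map_sum, Finset.sum_apply, ← FL.sum_anti (Finset.mem_range.1 hn)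
          fun p q => M.bracket h (evQ m (coeff f p) i) (evQ m (coeff g q) j)]
        exact Finset.sum_congr rfl fun p _ => evQ_br m h (coeff_mem f _) (coeff_mem g _)
      rw [evPart, Finset.sum_congr rfl e1, Finset.sum_comm]
      refine Finset.sum_congr rfl fun p _ => ?_
      rw [Finset.sum_comm]
      refine Finset.sum_congr rfl fun q _ => ?_
      rw [Finset.sum_ite_eq]
      simp
    have e2 : M.bracket h (evPart m N f) (evPart m N g) -
        evPart m N ((free deg).bracket h f g) ∈ M.fil N k := by
      rw [e]
      simp only [evPart, map_sum, LinearMap.sum_apply]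
      rw [Finset.sum_comm, ← Finset.sum_sub_distrib]
      refine Submodule.sum_mem _ fun p _ => ?_
      rw [← Finset.sum_sub_distrib]
      refine Submodule.sum_mem _ fun q _ => ?_
      split_ifs with hpq
      · simp
      · rw [sub_zero]
        exact M.fil_anti (not_lt.1 hpq) _ (M.fil_bracket h _ _ (evQ_mem m (coeff_mem f p))
          (evQ_mem m (coeff_mem g q)))
    have e3 : M.bracket h (evLim m f) (evLim m g) - M.bracket h (evPart m N f) (evPart m N g) ∈
        M.fil N k := by
      have h1 := M.fil_bracket (p := N) (q := 0) h _ (evLim m g) (evLim_spec m f N)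
        (by rw [M.fil_zero]; trivial)
      have h2 := M.fil_bracket (p := 0) (q := N) h (evPart m N f) _
        (by rw [M.fil_zero]; trivial) (evLim_spec m g N)
      rw [zero_add] at h2
      rw [add_zero] at h1
      convert add_mem h1 h2 using 1
      simp only [map_sub, LinearMap.sub_apply]
      abel
    convert add_mem e3 e2 using 1
    abel
  map_fil n {k} f hf := by
    change evLim m f ∈ _
    have h := evLim_spec m f n
    have e : evPart m n f = 0 := by
      refine Finset.sum_eq_zero fun p hp => ?_
      rw [(mem_fil f n).1 hf p (Finset.mem_range.1 hp), map_zero, Pi.zero_apply]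
    rwa [e, sub_zero] at h

lemma lift_gen (x : X) : (lift m).app _ (gen x rfl) = m x := by
  refine evLim_unique m _ _ fun N => ?_
  rcases N with _ | _ | N
  · rw [M.fil_zero]; trivial
  · rw [M.fil_one]; trivial
  · have e : evPart m (N + 2) (gen x rfl : free deg (deg x)) = m x := by
      rw [evPart, Finset.sum_eq_single 1]
      · simp only [gen, coeff_single, Pi.single_eq_same]
        exact evQ_mk m (.of x) rfl
      · intro n _ hn; simp [gen, coeff_single, hn]
      · intro h; exact absurd (Finset.mem_range.2 (by omega)) h
    rw [e, sub_self]; exact Submodule.zero_mem _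

end lift

/-- The projection `L ⊕ ε L → L`. -/
def dualFst (L : CGL.{u}) (r : ℤ) : Hom (L.dual r) L where
  app _ := LinearMap.fst ℚ _ _
  map_bracket _ _ _ := rfl
  map_fil _ _ _ h := h.1

/-- The morphism `x ↦ x + ε D x` for the derivation `D` with values `g` on the generators. -/
def derHom {r : ℤ} (g : ∀ x, free deg (deg x + r)) : Hom (free deg) ((free deg).dual r) :=
  lift (M := (free deg).dual r) fun x => (gen x rfl, g x)

lemma derHom_fst {r : ℤ} (g : ∀ x, free deg (deg x + r)) {k : ℤ} (x : free deg k) :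
    ((derHom g).app k x).1 = x :=
  hom_ext ((dualFst _ r).comp (derHom g)) (Hom.id _) (fun y => by
    exact congrArg Prod.fst (lift_gen (M := (free deg).dual r) (fun x => (gen x rfl, g x)) y)) x

/-- The derivation of degree `r` of `𝕃̂(V)` with given values on the generators. -/
def der (r : ℤ) (g : ∀ x, free deg (deg x + r)) : Der (free deg) r where
  app {i j} h := by
    subst h
    exact (LinearMap.snd ℚ _ _).comp ((derHom g).app i)
  leibniz {i j k i' j' k'} h hi hj hk h₁ h₂ x y := by
    subst hi hj hk
    have := congrArg Prod.snd ((derHom g).map_bracket h x y)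
    change _ = (free deg).bracket _ _ ((derHom g).app j y).1 +
      ((-1 : ℚ) ^ (r * i)) • (free deg).bracket _ ((derHom g).app i x).1 _ at this
    rw [derHom_fst, derHom_fst] at this
    exact this
  map_fil n i j h x hx := by
    subst h
    exact ((derHom g).map_fil n x hx).2

lemma der_gen (r : ℤ) (g : ∀ x, free deg (deg x + r)) (x : X) :
    (der r g).app rfl (gen x rfl) = g x := by
  exact congrArg Prod.snd (lift_gen (M := (free deg).dual r) (fun x => (gen x rfl, g x)) x)

/-- The differential of `𝕃̂(V)` with given values on the generators, provided that its square
vanishes on the generators. -/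
def differential (g : ∀ x, free deg (deg x + -1))
    (hg : ∀ x, (der (-1) g).app rfl (g x) = 0) : Differential (free deg) where
  toDer := der (-1) g
  sq_zero {i j k} h h' x := by
    subst h h'
    refine closed_induction
      (fun i => LinearMap.ker (((der (-1) g).app rfl).comp ((der (-1) g).app (i := i) rfl)))
      (fun y => ?_) ?_ ?_ x
    · rw [LinearMap.mem_ker, LinearMap.comp_apply, der_gen, hg]
    · intro i j k h x y hx hy
      rw [LinearMap.mem_ker, LinearMap.comp_apply] at *
      rw [(der (-1) g).leibniz h rfl rfl rfl (by omega) (by omega), map_add, map_smul,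
        (der (-1) g).leibniz (k' := k + -1 + -1) (by omega) rfl rfl rfl (by omega)
          (j' := j + -1) (by omega),
        (der (-1) g).leibniz (k' := k + -1 + -1) (by omega) rfl rfl rfl (by omega) (by omega), hx, hy]
      have e : ((-1 : ℚ) ^ (-1 * (i + -1))) = - ((-1 : ℚ) ^ (-1 * i)) := by
        rw [mul_add, sgn_add]; norm_num
      rw [e]
      simp
    · intro k x hx
      rw [LinearMap.mem_ker]
      refine (free deg).separated _ fun n => ?_
      obtain ⟨y, hy, hxy⟩ := hx n
      have := (der (-1) g).map_fil n rfl _ ((der (-1) g).map_fil n rfl _ hxy)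
      rw [map_sub, map_sub] at this
      rw [LinearMap.mem_ker, LinearMap.comp_apply] at hy
      rw [hy, sub_zero] at this
      exact this

end free

/-- A family of subspaces that is a closed graded Lie subalgebra. -/
structure IsClosedSubalgebra (L : CGL.{u}) (P : ∀ k, Submodule ℚ (L k)) : Prop where
  bracket_mem : ∀ {i j k : ℤ} (h : i + j = k) (x : L i) (y : L j), x ∈ P i → y ∈ P j →
    L.bracket h x y ∈ P k
  closed : ∀ {k : ℤ} (x : L k), (∀ n, ∃ y ∈ P k, x - y ∈ L.fil n k) → x ∈ P k

/-- `L` is the completed coproduct `L' ⨿̂ 𝕃̂(W)` in complete graded Lie algebras, where `W` has the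
homogeneous basis `Y`, included by `g`, and `f : L' → L` is the canonical inclusion. -/
def IsFreeExtension {L' L : CGL.{u}} (f : Hom L' L) {Y : Type u} (deg : Y → ℤ)
    (g : ∀ y, L (deg y)) : Prop :=
  ∀ (M : CGL.{u}) (φ : Hom L' M) (m : ∀ y, M (deg y)),
    ∃! h : Hom L M, h.comp f = φ ∧ ∀ y, h.app _ (g y) = m y

/-- The zero Lie algebra. -/
def zero : CGL.{u} where
  obj _ := PUnit
  bracket _ := 0
  skew _ _ _ _ := rfl
  jacobi _ _ _ _ _ _ _ _ _ := rfl
  fil _ _ := ⊤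
  fil_one _ := rfl
  fil_anti _ _ := le_rfl
  fil_bracket _ _ _ _ _ := trivial
  separated _ _ := rfl
  complete _ _ := ⟨0, fun _ => trivial⟩

end CGL

/-- A complete differential graded Lie algebra. -/
structure CDGL where
  /-- the underlying complete graded Lie algebra -/
  lie : CGL.{u}
  /-- the differential -/
  diff : lie.Differential

namespace CDGL

instance : CoeFun CDGL.{u} (fun _ => ℤ → Type u) := ⟨fun L => L.lie.obj⟩

/-- Morphisms of complete differential graded Lie algebras. -/
@[ext] structure Hom (L M : CDGL.{u}) extends CGL.Hom L.lie M.lie where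
  comm : ∀ {i j : ℤ} (h : i + -1 = j) (x : L i), app j (L.diff.app h x) = M.diff.app h (app i x)

/-- The identity. -/
def Hom.id (L : CDGL.{u}) : Hom L L := ⟨CGL.Hom.id L.lie, fun _ _ => rfl⟩

/-- Composition, `g` after `f`. -/
def Hom.comp {L M N : CDGL.{u}} (g : Hom M N) (f : Hom L M) : Hom L N where
  toHom := g.toHom.comp f.toHom
  comm h x := by
    change g.app _ (f.app _ _) = N.diff.app h (g.app _ (f.app _ x))
    rw [f.comm, g.comm]

/-- `H_k(L, d) = 0` for `k < 0`; the category **cDGL** consists of the complete differential graded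
Lie algebras with this property and of all morphisms between them. -/
def HNonneg (L : CDGL.{u}) : Prop :=
  ∀ {i j k : ℤ} (h : i + -1 = j) (h' : j + -1 = k), j < 0 →
    ∀ x : L j, L.diff.app h' x = 0 → ∃ y : L i, L.diff.app h y = x

/-! ### Maurer-Cartan elements and weak equivalences -/

/-- Maurer-Cartan elements: `da = -½[a, a]`. -/
def IsMC (L : CDGL.{u}) (a : L (-1)) : Prop :=
  L.diff.app (show (-1 : ℤ) + -1 = -2 by norm_num) a =
    -(1 / 2 : ℚ) • L.lie.bracket (show (-1 : ℤ) + -1 = -2 by norm_num) a a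

/-- The perturbed differential `d_a = d + ad_a`. -/
def dPert (L : CDGL.{u}) (a : L (-1)) {i j : ℤ} (h : i + -1 = j) : L i →ₗ[ℚ] L j :=
  L.diff.app h + L.lie.bracket (show -1 + i = j by omega) a

/-- `x` of degree `0` is a path from `a` to `b`:
`dx = ad_x b + ∑ₙ (Bₙ / n!) ad_xⁿ (b - a)`. Since the Lawrence-Sullivan interval is freely generated,
as complete Lie algebra, by `a`, `b`, `x`, with this differential on `x` and with `a` and `b`
Maurer-Cartan, such an `x` for Maurer-Cartan elements `a`, `b` is the same as a morphism from the
Lawrence-Sullivan interval that maps its endpoints to `a` and `b`. -/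
def IsPath (L : CDGL.{u}) (a b : L (-1)) (x : L 0) : Prop :=
  L.lie.IsSum (fun n => (bernoulli n / (n.factorial : ℚ)) • ((L.lie.ad x (-1)) ^ n) (b - a))
    (L.diff.app (show (0 : ℤ) + -1 = -1 by norm_num) x - L.lie.ad x (-1) b)

/-- The (left) equivalence of Maurer-Cartan elements. -/
def MCEquiv (L : CDGL.{u}) (a b : L (-1)) : Prop := ∃ x : L 0, L.IsPath a b x

/-- `f : (L', d_a) → (L, d_{f a})` is an isomorphism in homology (injective and surjective). -/
def Hom.IsQuasiIsoAt {L' L : CDGL.{u}} (f : Hom L' L) (a : L' (-1)) : Prop :=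
  ∀ {i j k : ℤ} (h : i + -1 = j) (h' : j + -1 = k),
    (∀ x : L' j, L'.dPert a h' x = 0 → (∃ y : L i, L.dPert (f.app _ a) h y = f.app _ x) →
      ∃ z : L' i, L'.dPert a h z = x) ∧
    (∀ y : L j, L.dPert (f.app _ a) h' y = 0 →
      ∃ x : L' j, L'.dPert a h' x = 0 ∧ ∃ w : L i, f.app _ x - y = L.dPert (f.app _ a) h w)

/-- Weak equivalences: bijective on the classes of Maurer-Cartan elements, and isomorphic in homology
for all perturbed differentials. -/
structure Hom.IsWeakEquiv {L' L : CDGL.{u}} (f : Hom L' L) : Prop where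
  mc_injective : ∀ a b : L' (-1), L'.IsMC a → L'.IsMC b →
    L.MCEquiv (f.app _ a) (f.app _ b) → L'.MCEquiv a b
  mc_surjective : ∀ c : L (-1), L.IsMC c → ∃ a : L' (-1), L'.IsMC a ∧ L.MCEquiv (f.app _ a) c
  quasiIso : ∀ a : L' (-1), L'.IsMC a → f.IsQuasiIsoAt a

/-- Fibrations: surjections. -/
def Hom.IsFibration {L' L : CDGL.{u}} (f : Hom L' L) : Prop :=
  ∀ k, Function.Surjective (f.app k)

/-- Cofibrations: the left lifting property with respect to all trivial fibrations of **cDGL**. -/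
def Hom.IsCofibration {L' L : CDGL.{u}} (f : Hom L' L) : Prop :=
  ∀ (A B : CDGL.{u}), A.HNonneg → B.HNonneg → ∀ q : Hom A B, q.IsFibration → q.IsWeakEquiv →
    ∀ (φ : Hom L' A) (χ : Hom L B), q.comp φ = χ.comp f →
      ∃ Φ : Hom L A, Φ.comp f = φ ∧ q.comp Φ = χ

/-- `P` is the completed coproduct `A ⨿̂ B`, with the inclusions `j₀` and `j₁`. -/
def IsCoproduct {A B P : CDGL.{u}} (j₀ : Hom A P) (j₁ : Hom B P) : Prop :=
  ∀ (M : CDGL.{u}) (f : Hom A M) (g : Hom B M), ∃! h : Hom P M, h.comp j₀ = f ∧ h.comp j₁ = g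

/-- Cylinder objects: the fold map of `L` factors as `p ∘ (ι₀ + ι₁)`, with a cofibration
`ι₀ + ι₁ : L ⨿̂ L → C` and a weak equivalence `p : C → L` in **cDGL**. -/
structure IsCylinderObject {L C : CDGL.{u}} (ι₀ ι₁ : Hom L C) (p : Hom C L) : Prop where
  hNonneg : C.HNonneg
  p_ι₀ : p.comp ι₀ = Hom.id L
  p_ι₁ : p.comp ι₁ = Hom.id L
  cofibration : ∃ (P : CDGL.{u}) (j₀ j₁ : Hom L P) (ι : Hom P C), IsCoproduct j₀ j₁ ∧
    ι.comp j₀ = ι₀ ∧ ι.comp j₁ = ι₁ ∧ ι.IsCofibration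
  weakEquiv : p.IsWeakEquiv

/-! ### Free maps and inductive algebras -/

/-- The generators of the Lawrence-Sullivan interval. -/
inductive LSGen : Type u
  | a | b | x

/-- Their degrees. -/
def lsDeg : LSGen.{u} → ℤ
  | .a => -1
  | .b => -1
  | .x => 0

/-- The morphism `𝕃̂(a, b, x) → L` of complete Lie algebras with given values on `a`, `b`, `x`. -/
def lsMap (L : CDGL.{u}) (a b : L (-1)) (x : L 0) : CGL.Hom (CGL.free lsDeg.{u}) L.lie :=
  CGL.free.lift fun
    | .a => a
    | .b => b
    | .x => x

/-- `𝕃̂(a, b, x)` is a sub cDGL of `L`, isomorphic to the Lawrence-Sullivan interval. -/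
structure IsLSInterval (L : CDGL.{u}) (a b : L (-1)) (x : L 0) : Prop where
  mc_a : L.IsMC a
  mc_b : L.IsMC b
  path : L.IsPath a b x
  injective : ∀ k, Function.Injective ((L.lsMap a b x).app k)

/-- Homogeneous elements `W = U ⊕ sU ⊕ V` of `L`, given by bases: `u` and `su` of `U` and `sU`;
`mc` of `V₋₁`; `cyc` and `pth` of `V₀ = V₀' ⊕ V₀''`; and `cell` of `V_{≥ 1}`. -/
structure Gens (L : CDGL.{u}) where
  (S A Z P N : Type u)
  (degS : S → ℤ)
  (degN : N → ℤ)
  one_le : ∀ n, 1 ≤ degN n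
  (u : ∀ s, L (degS s))
  (su : ∀ s, L (degS s + 1))
  (mc : A → L (-1))
  (cyc : Z → L 0)
  (pth : P → L 0)
  (cell : ∀ n, L (degN n))

namespace Gens

variable {L' L : CDGL.{u}} (G : Gens L)

/-- The index set of the basis of `W`. -/
inductive Idx : Type u
  | u (s : G.S) | su (s : G.S) | mc (a : G.A) | cyc (z : G.Z) | pth (p : G.P) | cell (n : G.N)

/-- The degrees. -/
def deg : G.Idx → ℤ
  | .u s => G.degS s
  | .su s => G.degS s + 1
  | .mc _ => -1
  | .cyc _ => 0
  | .pth _ => 0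
  | .cell n => G.degN n

/-- The basis of `W`. -/
def elt : ∀ y : G.Idx, L (G.deg y)
  | .u s => G.u s
  | .su s => G.su s
  | .mc a => G.mc a
  | .cyc z => G.cyc z
  | .pth p => G.pth p
  | .cell n => G.cell n

/-- Whether a basis element belongs to `U ⊕ sU ⊕ V_{< m}`. -/
def below (m : ℤ) : G.Idx → Prop
  | .u _ => True
  | .su _ => True
  | y => G.deg y < m

/-- Membership in `L' ⨿̂ 𝕃̂(U ⊕ sU ⊕ V_{< m})`, the closed Lie subalgebra of `L` generated by the image
of `f : L' → L` and by `U ⊕ sU ⊕ V_{< m}`. -/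
def InStage (f : Hom L' L) (m : ℤ) {k : ℤ} (x : L k) : Prop :=
  ∀ P : ∀ k, Submodule ℚ (L k), L.lie.IsClosedSubalgebra P → (∀ k y, f.app k y ∈ P k) →
    (∀ y, G.below m y → G.elt y ∈ P (G.deg y)) → x ∈ P k

end Gens

/-- Free maps `f : L' → L = L' ⨿̂ 𝕃̂(U ⊕ sU ⊕ V)`. The Maurer-Cartan elements that the generators in
`V₀''` and `V_{≥ 1}` refer to belong to the part generated by `L'`, `U ⊕ sU` and the generators in `V`
of lower degree. -/
def Hom.IsFreeMap {L' L : CDGL.{u}} (f : Hom L' L) : Prop :=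
  ∃ G : Gens L,
    CGL.IsFreeExtension f.toHom G.deg G.elt ∧
    (∀ s, L.diff.app (by omega) (G.su s) = G.u s) ∧
    (∀ s, L.diff.app rfl (G.u s) = 0) ∧
    (∀ a, L.IsMC (G.mc a)) ∧
    (∀ z, L.diff.app rfl (G.cyc z) = 0) ∧
    (∀ x, ∃ a b : L (-1), G.InStage f 0 a ∧ G.InStage f 0 b ∧ L.IsLSInterval a b (G.pth x)) ∧
    (∀ n, ∃ a : L (-1), L.IsMC a ∧ G.InStage f (G.degN n) a ∧
      G.InStage f (G.degN n) (L.dPert a rfl (G.cell n)))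

/-- The zero object. -/
def zero : CDGL.{u} where
  lie := CGL.zero
  diff :=
    { app := fun _ => 0
      leibniz := fun _ _ _ _ _ _ _ _ => rfl
      map_fil := fun _ _ _ _ _ _ => trivial
      sq_zero := fun _ _ _ => rfl }

/-- The morphism `0 → L`. -/
def fromZero (L : CDGL.{u}) : Hom zero L where
  app _ := 0
  map_bracket _ _ _ := by simp
  map_fil _ _ _ _ := by simp
  comm _ _ := by simp

/-- Inductive algebras: `0 → L` is a free map. -/
def IsInductive (L : CDGL.{u}) : Prop := L.fromZero.IsFreeMap

end CDGL

/-! ### The cylinder construction -/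

namespace Cylinder

open CGL

/-- A basis of `V ⊕ V̂ ⊕ V̄`, and also of `V ⊕ V' ⊕ sV'`, for a graded vector space `V` with homogeneous
basis `X`: `base x` is `x`, `hat x` is `x̂` or `x'`, and `bar x` is `x̄` or `sx'`. -/
inductive Idx (X : Type u) : Type u
  | base (x : X) | hat (x : X) | bar (x : X)

variable {X : Type u}

/-- The degrees. -/
def deg (δ : X → ℤ) : Idx X → ℤ
  | .base x => δ x
  | .hat x => δ x
  | .bar x => δ x + 1

variable {δ : X → ℤ}

/-- The inclusion `𝕃̂(V) → 𝕃̂(V ⊕ V' ⊕ sV')`. -/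
def incl : Hom (free δ) (free (deg δ)) := free.lift fun x => free.gen (.base x) rfl

/-- The values of `d` on the generators of `𝕃̂(V ⊕ V' ⊕ sV')`: the given differential on `V`,
`dv' = 0` and `dsv' = v'`. -/
def dGen (d : Differential (free δ)) : ∀ y, free (deg δ) (deg δ y + -1)
  | .base x => incl.app _ (d.app rfl (free.gen x rfl))
  | .hat _ => 0
  | .bar x => free.gen (Idx.hat x) (by simp [deg])

lemma der_incl (d : Differential (free δ)) {i j : ℤ} (h : i + -1 = j) (x : free δ i) :
    (free.der (-1) (dGen d)).app h (incl.app i x) = incl.app j (d.app h x) := by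
  subst h
  refine free.closed_induction (fun i => LinearMap.eqLocus
    (((free.der (-1) (dGen d)).app rfl).comp (incl.app i)) ((incl.app _).comp (d.app rfl)))
    (fun x => ?_) ?_ ?_ x
  · rw [LinearMap.mem_eqLocus, LinearMap.comp_apply, incl, free.lift_gen]
    exact free.der_gen (-1) (dGen d) (.base x)
  · intro i j k h x y hx hy
    rw [LinearMap.mem_eqLocus, LinearMap.comp_apply, LinearMap.comp_apply] at *
    rw [incl.map_bracket, (free.der (-1) (dGen d)).leibniz h rfl rfl rfl (by omega) (by omega), hx,
      hy, d.leibniz h rfl rfl rfl (by omega) (by omega), map_add, map_smul, incl.map_bracket,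
      incl.map_bracket]
  · intro k x hx
    rw [LinearMap.mem_eqLocus]
    refine sub_eq_zero.1 ((free (deg δ)).separated _ fun n => ?_)
    obtain ⟨y, hy, hxy⟩ := hx n
    have h1 := (free.der (-1) (dGen d)).map_fil n rfl _ (incl.map_fil n _ hxy)
    have h2 := incl.map_fil n _ (d.map_fil n rfl _ hxy)
    have h3 := sub_mem h1 h2
    rw [LinearMap.mem_eqLocus, LinearMap.comp_apply, LinearMap.comp_apply] at hy
    rw [map_sub, map_sub, map_sub, map_sub, hy] at h3
    simpa using h3

lemma der_hat (d : Differential (free δ)) (x : X) {i j : ℤ} (h : δ x = i) (h' : i + -1 = j) :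
    (free.der (-1) (dGen d)).app h' (free.gen (.hat x) (show deg δ (.hat x) = i from h)) = 0 := by
  subst h h'
  exact free.der_gen (-1) (dGen d) (.hat x)

/-- The differential `d` of `𝕃̂(V ⊕ V' ⊕ sV')`. -/
def diff (d : Differential (free δ)) : Differential (free (deg δ)) :=
  free.differential (dGen d) fun
    | .base x => by
      change (free.der (-1) (dGen d)).app rfl (incl.app _ (d.app rfl (free.gen x rfl))) = 0
      rw [der_incl, d.sq_zero, map_zero]
    | .hat _ => map_zero _
    | .bar x => der_hat d x (by simp [deg]) rfl

/-- The derivation `i` of degree `1`: `i(v) = sv'`, `i(v') = i(sv') = 0`. -/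
def homotopy : Der (free (deg δ)) 1 :=
  free.der 1 fun
    | .base x => free.gen (.bar x) rfl
    | .hat _ => 0
    | .bar _ => 0

/-- The derivation `θ = i ∘ d + d ∘ i` of degree `0`. -/
def theta (d : Differential (free δ)) (k : ℤ) : Module.End ℚ (free (deg δ) k) :=
  (homotopy.app (show k - 1 + 1 = k by omega)).comp ((diff d).app (show k + -1 = k - 1 by omega)) +
    ((diff d).app (show k + 1 + -1 = k by omega)).comp (homotopy.app (show k + 1 = k + 1 from rfl))

/-- `e^θ(x) = ∑ₙ θⁿ(x) / n!`. -/
def expTheta (d : Differential (free δ)) {k : ℤ} (x : free (deg δ) k) : free (deg δ) k :=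
  (free (deg δ)).sum fun n => (1 / (n.factorial : ℚ)) • ((theta d k) ^ n) x

/-- The morphism `ψ : 𝕃̂(V ⊕ V̂ ⊕ V̄) → 𝕃̂(V ⊕ V' ⊕ sV')` of complete Lie algebras: `ψ(v) = v`,
`ψ(v̂) = e^θ(v)` and `ψ(v̄) = sv'`. -/
def psi (d : Differential (free δ)) : Hom (free (deg δ)) (free (deg δ)) :=
  free.lift fun
    | .base x => free.gen (.base x) rfl
    | .hat x => expTheta d (free.gen (.base x) rfl)
    | .bar x => free.gen (.bar x) rfl

/-- The cylinder construction `(𝕃̂(V ⊕ V̂ ⊕ V̄), D)`, `D = ψ⁻¹ ∘ d ∘ ψ`, where `ψ` is an isomorphism. -/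
def cyl (d : Differential (free δ)) (ψ : Iso (free (deg δ)) (free (deg δ))) : CDGL.{u} where
  lie := free (deg δ)
  diff := ψ.pull (diff d)

end Cylinder

end

/-! Everything is carried to the model `𝕃̂(V ⊕ V' ⊕ sV')`, the algebra `𝕃̂(V)` with contractible
generators added. The derivation `θ = id + di` commutes with `d`, kills `V'` and `sV'`, and
satisfies `θ(v) = v' + i(dv)`, where `i(dv)` lies in `sV'` modulo brackets. So `θ²` vanishes on
generators modulo brackets, `θ` is topologically nilpotent (`exists_theta_pow_mem`), and `e^θ` is a
morphism of complete DGLs with `e^θ(v) ≡ v + v' + i(dv)`. Its linear part and that of `ψ` are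
triangular, and a morphism of free complete Lie algebras that is invertible modulo brackets is
invertible (`exists_expIso`, `exists_psiIso`). Through `ψ` the cylinder becomes the model, `ι₀`
becomes the inclusion `incl`, `ι₁` becomes `e^θ ∘ incl`, and `p` becomes the projection. Hence `ι₀`
is free on `U = V'`, `sU = sV'`, and so is `ι₁`, which differs from it by the automorphism `e^θ`
(`isFreeMap_incl`).

The deformation `v ↦ v`, `sv' ↦ t sv'` and integration over `t` give a homotopy `h` on the kernel of
the projection that preserves the filtration. Brackets raise the filtration, so `h` solves perturbed
equations by successive approximation: the kernel is acyclic for every `d_a`, and paths lift with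
given ends. Together with the section `ι₀` this makes `p` a weak equivalence
(`Contraction.isWeakEquiv`). The equation of a path is solved for its source, `a = gauge x b`, so
that statements on paths become statements on the gauge action. Concatenation of paths, usually done
by the Baker-Campbell-Hausdorff product, comes from lifting paths in a universal example.

Free maps are cofibrations by induction on the degree of the generators
(`Hom.IsFreeMap.isCofibration`): trivial fibrations lift Maurer-Cartan elements, solutions of `d_a x
= w`, and paths with given ends.

For `ι₀ + ι₁`, let `q : A → B` be a trivial fibration with data `φ₀`, `φ₁` on the two ends and `χ`
on the model. Lifting the values on `sV'` arbitrarily gives `Φ₀` that extends `φ₀` and lies over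
`χ`, but `Φ₀ ∘ e^θ ∘ incl` and `φ₁` agree only in `B`. The path object of `A` over `B` maps to `A
×_B A` by a trivial fibration, and an inductive `L` is cofibrant, so the two are joined by a
homotopy `H` over `B`. Homotopy extension deforms `Φ₀`, keeping `φ₀` fixed and following `H`; the
value at `t = 1` is the required lift (`exists_lift`). Homotopy extension itself is again successive
approximation: adding `κ` to the values on `sV'` changes the value on `e^θ(v)`, to first order, by
`dκ(v)` plus the change on `i(dv)`. With `κ = h(error)` this is `dh(error) + hd(error) = error`
(`correction`). -/

namespace CGL

/-! ### Convergent series in a complete filtration -/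

section Series

variable {L M : CGL.{u}}

lemma mem_fil_one {k : ℤ} (x : L k) : x ∈ L.fil 1 k := by rw [L.fil_one]; trivial

lemma mem_fil_zero {k : ℤ} (x : L k) : x ∈ L.fil 0 k := by rw [L.fil_zero]; trivial

lemma bracket_mem_left {n : ℕ} {i j k : ℤ} (h : i + j = k) {x : L i} (y : L j)
    (hx : x ∈ L.fil n i) : L.bracket h x y ∈ L.fil (n + 1) k :=
  L.fil_bracket h x y hx (mem_fil_one y)

lemma bracket_mem_right {n : ℕ} {i j k : ℤ} (h : i + j = k) (x : L i) {y : L j}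
    (hy : y ∈ L.fil n j) : L.bracket h x y ∈ L.fil (n + 1) k := by
  rw [add_comm]; exact L.fil_bracket h x y (mem_fil_one x) hy

lemma bracket_sub_mem {N p q r s : ℕ} {i j k : ℤ} (h : i + j = k) {x x' : L i} {y y' : L j}
    (hx : x' - x ∈ L.fil p i) (hy' : y' ∈ L.fil q j) (hx' : x ∈ L.fil r i)
    (hy : y' - y ∈ L.fil s j) (h₁ : N ≤ p + q) (h₂ : N ≤ r + s) :
    L.bracket h x' y' - L.bracket h x y ∈ L.fil N k := by
  have := add_mem (L.fil_anti h₁ _ (L.fil_bracket h _ _ hx hy'))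
    (L.fil_anti h₂ _ (L.fil_bracket h _ _ hx' hy))
  convert this using 1
  simp only [map_sub, LinearMap.sub_apply]; abel

lemma fil_succ_le {n : ℕ} {k : ℤ} {x : L k} (hx : x ∈ L.fil (n + 1) k) : x ∈ L.fil n k :=
  L.fil_anti n.le_succ k hx

lemma eq_of_sub_mem {k : ℤ} {x y : L k} (h : ∀ n, x - y ∈ L.fil n k) : x = y :=
  sub_eq_zero.1 (L.separated _ h)

lemma mem_of_sub_mem {k : ℤ} {n : ℕ} {x y : L k} (h : x - y ∈ L.fil n k) (hy : y ∈ L.fil n k) :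
    x ∈ L.fil n k := by
  simpa using add_mem h hy

lemma IsSum.unique {k : ℤ} {x : ℕ → L k} {s t : L k} (hs : L.IsSum x s) (ht : L.IsSum x t) :
    s = t := by
  refine eq_of_sub_mem fun N => ?_
  obtain ⟨n₁, h₁⟩ := hs N
  obtain ⟨n₂, h₂⟩ := ht N
  have := sub_mem (h₁ (max n₁ n₂) (le_max_left _ _)) (h₂ (max n₁ n₂) (le_max_right _ _))
  simpa using this

lemma IsSum.map {k l : ℤ} {x : ℕ → L k} {s : L k} (hs : L.IsSum x s) (f : L k →ₗ[ℚ] M l)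
    (hf : ∀ n, ∀ y ∈ L.fil n k, f y ∈ M.fil n l) : M.IsSum (fun n => f (x n)) (f s) := by
  intro N
  obtain ⟨n₀, h⟩ := hs N
  refine ⟨n₀, fun n hn => ?_⟩
  have := hf N _ (h n hn)
  rwa [map_sub, map_sum] at this

lemma IsSum.add {k : ℤ} {x y : ℕ → L k} {s t : L k} (hs : L.IsSum x s) (ht : L.IsSum y t) :
    L.IsSum (fun n => x n + y n) (s + t) := by
  intro N
  obtain ⟨n₁, h₁⟩ := hs N
  obtain ⟨n₂, h₂⟩ := ht N
  refine ⟨max n₁ n₂, fun n hn => ?_⟩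
  have := add_mem (h₁ n (le_trans (le_max_left _ _) hn)) (h₂ n (le_trans (le_max_right _ _) hn))
  rw [Finset.sum_add_distrib]
  convert this using 1
  abel

lemma IsSum.tendsto {k : ℤ} {x : ℕ → L k} {s : L k} (hs : L.IsSum x s) (N : ℕ) :
    ∃ n₀, ∀ n ≥ n₀, x n ∈ L.fil N k := by
  obtain ⟨n₀, h⟩ := hs N
  refine ⟨n₀, fun n hn => ?_⟩
  have := sub_mem (h n hn) (h (n + 1) (by omega))
  rw [Finset.sum_range_succ] at this
  simpa using this

lemma sum_range_sub_mem {k : ℤ} {x : ℕ → L k} {N n₀ : ℕ} (h : ∀ n ≥ n₀, x n ∈ L.fil N k) {n : ℕ}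
    (hn : n₀ ≤ n) : ∑ m ∈ Finset.range n, x m - ∑ m ∈ Finset.range n₀, x m ∈ L.fil N k := by
  rw [Finset.sum_range_sub_sum_range hn]
  exact Submodule.sum_mem _ fun m hm => h m (by simpa using (Finset.mem_filter.1 hm).2)

/-- The subspaces of the filtration are closed, so an estimate on all partial tails passes to the
limit. -/
lemma IsSum.sub_mem {k : ℤ} {x : ℕ → L k} {s : L k} (hs : L.IsSum x s) {N n₀ : ℕ}
    (h : ∀ n ≥ n₀, x n ∈ L.fil N k) : s - ∑ m ∈ Finset.range n₀, x m ∈ L.fil N k := by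
  obtain ⟨n₁, h₁⟩ := hs N
  have := add_mem (h₁ (max n₀ n₁) (le_max_right _ _)) (sum_range_sub_mem h (le_max_left n₀ n₁))
  simpa using this

lemma IsSum.mem {k : ℤ} {x : ℕ → L k} {s : L k} (hs : L.IsSum x s) {N : ℕ}
    (h : ∀ n, x n ∈ L.fil N k) : s ∈ L.fil N k := by
  simpa using hs.sub_mem (n₀ := 0) fun n _ => h n

lemma isSum_of_eventually_zero {k : ℤ} {x : ℕ → L k} (n₀ : ℕ) (h : ∀ n ≥ n₀, x n = 0) :
    L.IsSum x (∑ n ∈ Finset.range n₀, x n) := fun N => ⟨n₀, fun n hn => by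
  rw [← neg_sub]
  exact neg_mem (sum_range_sub_mem (fun m hm => by rw [h m hm]; exact zero_mem _) hn)⟩

/-- As in any ultrametric setting, convergence only needs terms tending to zero. The thresholds are
replaced by a monotone sequence so that completeness applies to a subsequence of the partial sums.
-/
lemma exists_isSum {k : ℤ} {x : ℕ → L k} (h : ∀ N, ∃ n₀, ∀ n ≥ n₀, x n ∈ L.fil N k) :
    ∃ s, L.IsSum x s := by
  choose f hf using h
  let g : ℕ → ℕ := fun N => ∑ m ∈ Finset.range (N + 1), f m
  have hg : ∀ N, f N ≤ g N := fun N =>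
    Finset.single_le_sum (f := f) (fun _ _ => Nat.zero_le _) (Finset.self_mem_range_succ N)
  have hmono : ∀ N, g N ≤ g (N + 1) := fun N => by
    change _ ≤ ∑ m ∈ Finset.range (N + 1 + 1), f m
    rw [Finset.sum_range_succ]; exact Nat.le_add_right _ _
  obtain ⟨s, hs⟩ := L.complete (fun N => ∑ m ∈ Finset.range (g N), x m) fun N =>
    sum_range_sub_mem (fun n hn => hf N n ((hg N).trans hn)) (hmono N)
  refine ⟨s, fun N => ⟨g N, fun n hn => ?_⟩⟩
  have := sub_mem (hs N) (sum_range_sub_mem (fun n hn => hf N n ((hg N).trans hn)) hn)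
  simpa using this

lemma exists_isSum_of_mem {k : ℤ} {x : ℕ → L k} (h : ∀ n, x n ∈ L.fil n k) :
    ∃ s, L.IsSum x s :=
  exists_isSum fun N => ⟨N, fun n hn => L.fil_anti hn k (h n)⟩

lemma sum_spec {k : ℤ} {x : ℕ → L k} (h : ∃ s, L.IsSum x s) : L.IsSum x (L.sum x) := by
  rw [CGL.sum, dif_pos h]; exact h.choose_spec

/-- The Cauchy product of convergent series. -/
lemma IsSum.bracket {i j k : ℤ} (h : i + j = k) {x : ℕ → L i} {y : ℕ → L j} {s : L i} {t : L j}
    (hs : L.IsSum x s) (ht : L.IsSum y t) :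
    L.IsSum (fun n => ∑ p ∈ Finset.HasAntidiagonal.antidiagonal n,
      L.bracket h (x p.1) (y p.2)) (L.bracket h s t) := by
  intro N
  obtain ⟨n₁, h₁⟩ := hs N
  obtain ⟨n₂, h₂⟩ := ht N
  obtain ⟨n₃, h₃⟩ := hs.tendsto N
  obtain ⟨n₄, h₄⟩ := ht.tendsto N
  refine ⟨n₁ + n₂ + n₃ + n₄, fun n hn => ?_⟩
  have e : ∑ m ∈ Finset.range n, ∑ p ∈ Finset.HasAntidiagonal.antidiagonal m,
      L.bracket h (x p.1) (y p.2) = ∑ p ∈ Finset.range n, ∑ q ∈ Finset.range n,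
        if p + q < n then L.bracket h (x p) (y q) else 0 := by
    rw [Finset.sum_congr rfl fun m hm => FL.sum_anti (Finset.mem_range.1 hm)
      fun p q => L.bracket h (x p) (y q), Finset.sum_comm]
    refine Finset.sum_congr rfl fun p _ => ?_
    rw [Finset.sum_comm]
    refine Finset.sum_congr rfl fun q _ => ?_
    rw [Finset.sum_ite_eq]
    simp
  have e₂ : L.bracket h (∑ m ∈ Finset.range n, x m) (∑ m ∈ Finset.range n, y m) -
      ∑ m ∈ Finset.range n, ∑ p ∈ Finset.HasAntidiagonal.antidiagonal m,
        L.bracket h (x p.1) (y p.2) ∈ L.fil N k := by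
    rw [e]
    simp only [map_sum, LinearMap.sum_apply]
    rw [Finset.sum_comm, ← Finset.sum_sub_distrib]
    refine Submodule.sum_mem _ fun p _ => ?_
    rw [← Finset.sum_sub_distrib]
    refine Submodule.sum_mem _ fun q _ => ?_
    split_ifs with hpq
    · simp
    · rw [sub_zero]
      -- Since `p + q ≥ n ≥ n₃ + n₄`, one of the two factors is already in the `N`-th step.
      rcases le_or_gt n₃ p with hp | hp
      · exact fil_succ_le (bracket_mem_left h _ (h₃ p hp))
      · exact fil_succ_le (bracket_mem_right h _ (h₄ q (by omega)))
  have e₃ := fil_succ_le (bracket_mem_left h t (h₁ n (by omega)))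
  have e₄ := fil_succ_le (bracket_mem_right h (∑ m ∈ Finset.range n, x m) (h₂ n (by omega)))
  convert add_mem (add_mem e₃ e₄) e₂ using 1
  simp only [map_sub, LinearMap.sub_apply]
  abel

end Series

/-- Components of equal degrees are the same. -/
def castDeg (L : CGL.{u}) {i j : ℤ} (h : i = j) : L i ≃ₗ[ℚ] L j := by
  subst h; exact LinearEquiv.refl ℚ _

@[simp] lemma castDeg_rfl (L : CGL.{u}) {i : ℤ} (x : L i) : L.castDeg rfl x = x := rfl

/-- Homomorphisms are determined by their components. -/
lemma Hom.ext_app {L M : CGL.{u}} {f g : Hom L M} (h : ∀ k x, f.app k x = g.app k x) : f = g :=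
  Hom.ext (funext fun k => LinearMap.ext (h k))

/-! ### Density arguments in free complete Lie algebras -/

namespace free

variable {X : Type u} {deg : X → ℤ}

/-- A closed graded subspace of `𝕃̂(V)` that contains the generators and all brackets is everything. -/
lemma closed_induction' (P : ∀ k, Submodule ℚ (free deg k)) (hgen : ∀ x, gen x rfl ∈ P (deg x))
    (hbr : ∀ {i j k : ℤ} (h : i + j = k) (x : free deg i) (y : free deg j),
      (free deg).bracket h x y ∈ P k) (n : ℕ) (hcl : ∀ k, (free deg).fil n k ≤ P k)
    {k : ℤ} (x : free deg k) : x ∈ P k := by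
  refine closed_induction P hgen (fun h x y _ _ => hbr h x y) (fun x hx => ?_) x
  obtain ⟨y, hy, hxy⟩ := hx n
  simpa using add_mem (hcl _ hxy) hy

/-- A morphism of Lie algebras that commutes with derivations on the generators commutes with them. -/
lemma comm_der {M : CGL.{u}} {r : ℤ} (f : Hom (free deg) M) (D : Der (free deg) r) (D' : Der M r)
    (hgen : ∀ x, f.app _ (D.app rfl (gen x rfl)) = D'.app rfl (f.app _ (gen x rfl)))
    {i j : ℤ} (h : i + r = j) (x : free deg i) : f.app j (D.app h x) = D'.app h (f.app i x) := by
  subst h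
  refine closed_induction (fun i => LinearMap.eqLocus ((f.app _).comp (D.app rfl))
    ((D'.app rfl).comp (f.app i))) hgen ?_ ?_ x
  · intro i j k h x y hx hy
    rw [LinearMap.mem_eqLocus, LinearMap.comp_apply, LinearMap.comp_apply] at *
    rw [f.map_bracket, D.leibniz h rfl rfl rfl (by omega) (by omega), map_add, map_smul,
      f.map_bracket, f.map_bracket, hx, hy, D'.leibniz h rfl rfl rfl (by omega) (by omega)]
  · intro k x hx
    rw [LinearMap.mem_eqLocus]
    refine eq_of_sub_mem fun n => ?_
    obtain ⟨y, hy, hxy⟩ := hx n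
    have h3 := sub_mem (f.map_fil n _ (D.map_fil n rfl _ hxy)) (D'.map_fil n rfl _ (f.map_fil n _ hxy))
    rw [LinearMap.mem_eqLocus, LinearMap.comp_apply, LinearMap.comp_apply] at hy
    rw [map_sub, map_sub, map_sub, map_sub, hy] at h3
    simpa using h3

/-- Two morphisms that agree modulo `Fⁿ` on the generators agree modulo `Fⁿ`, and modulo `Fⁿ⁺¹` on
brackets. -/
lemma sub_mem_of_gen {M : CGL.{u}} (f g : Hom (free deg) M) (n : ℕ)
    (h : ∀ x, f.app _ (gen x rfl) - g.app _ (gen x rfl) ∈ M.fil n (deg x)) {k : ℤ} (x : free deg k) :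
    f.app k x - g.app k x ∈ M.fil n k := by
  refine closed_induction (fun k => (M.fil n k).comap (f.app k - g.app k)) h ?_ ?_ x
  · intro i j k h x y hx hy
    simp only [Submodule.mem_comap, LinearMap.sub_apply] at *
    rw [f.map_bracket, g.map_bracket]
    have h1 := fil_succ_le (bracket_mem_left h (f.app j y) hx)
    have h2 := fil_succ_le (bracket_mem_right h (g.app i x) hy)
    convert add_mem h1 h2 using 1
    simp only [map_sub, LinearMap.sub_apply]; abel
  · intro k x hx
    obtain ⟨y, hy, hxy⟩ := hx n
    simp only [Submodule.mem_comap, LinearMap.sub_apply] at *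
    have := sub_mem (f.map_fil n _ hxy) (g.map_fil n _ hxy)
    convert add_mem this hy using 1
    simp only [map_sub]; abel

/-- In a bracket one factor changes by an element of `Fⁿ` while the other lies in `F¹`. This gain of
one step is what lets brackets be neglected in first order computations. -/
lemma sub_bracket_mem_of_gen {M : CGL.{u}} (f g : Hom (free deg) M) (n : ℕ)
    (h : ∀ x, f.app _ (gen x rfl) - g.app _ (gen x rfl) ∈ M.fil n (deg x)) {i j k : ℤ}
    (hk : i + j = k) (x : free deg i) (y : free deg j) :
    f.app k ((free deg).bracket hk x y) - g.app k ((free deg).bracket hk x y) ∈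
      M.fil (n + 1) k := by
  rw [f.map_bracket, g.map_bracket]
  have h1 := bracket_mem_left hk (f.app j y) (sub_mem_of_gen f g n h x)
  have h2 := bracket_mem_right hk (g.app i x) (sub_mem_of_gen f g n h y)
  convert add_mem h1 h2 using 1
  simp only [map_sub, LinearMap.sub_apply]; abel

end free

end CGL

/-! ### Successive approximation and morphisms that are unipotent for the filtration -/

namespace CGL

/-- Successive approximation: a system of conditions `R n` on the unknowns `x`, in closed
subspaces `S`, that can be solved step by step has a common solution. -/
lemma successive_approximation {L : CGL.{u}} {ι : Type*} {deg : ι → ℤ}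
    (S : ∀ a, Submodule ℚ (L (deg a)))
    (hS : ∀ a x, (∀ n, ∃ y ∈ S a, x - y ∈ L.fil n (deg a)) → x ∈ S a)
    (R : ℕ → (∀ a, L (deg a)) → Prop) (h0 : R 0 0)
    (hstep : ∀ n x, (∀ a, x a ∈ S a) → R n x →
      ∃ k : ∀ a, L (deg a), (∀ a, k a ∈ S a) ∧ (∀ a, k a ∈ L.fil n (deg a)) ∧ R (n + 1) (x + k))
    (hcl : ∀ n x y, (∀ a, x a ∈ S a) → (∀ a, y a ∈ S a) → R n x →
      (∀ a, y a - x a ∈ L.fil n (deg a)) → R n y) :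
    ∃ x, (∀ a, x a ∈ S a) ∧ ∀ n, R n x := by
  choose! k hkS hkF hkR using hstep
  let x : ℕ → ∀ a, L (deg a) := fun n => Nat.rec 0 (fun n x => x + k n x) n
  have hx : ∀ n, (∀ a, x n a ∈ S a) ∧ R n (x n) := by
    intro n
    induction n with
    | zero => exact ⟨fun a => zero_mem _, h0⟩
    | succ n ih => exact ⟨fun a => add_mem (ih.1 a) (hkS n _ ih.1 ih.2 a), hkR n _ ih.1 ih.2⟩
  have hlim : ∀ a, ∃ y : L (deg a), ∀ n, y - x n a ∈ L.fil n (deg a) := fun a =>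
    L.complete (fun n => x n a) fun n => by
      change x n a + k n (x n) a - x n a ∈ _
      rw [add_sub_cancel_left]
      exact hkF n _ (hx n).1 (hx n).2 a
  choose y hy using hlim
  have hyS : ∀ a, y a ∈ S a := fun a => hS a _ fun n => ⟨x n a, (hx n).1 a, hy a n⟩
  -- By `hcl` the condition `R n` depends on the unknowns only modulo `Fⁿ`, so it passes to the
  -- limit.
  exact ⟨y, hyS, fun n => hcl n (x n) y (hx n).1 hyS (hx n).2 fun a => hy a n⟩

/-- Successive approximation with a single unknown. -/
lemma successive_approximation_one {L : CGL.{u}} {k : ℤ} (S : Submodule ℚ (L k))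
    (hS : ∀ x, (∀ n, ∃ y ∈ S, x - y ∈ L.fil n k) → x ∈ S) (R : ℕ → L k → Prop) (h0 : R 0 0)
    (hstep : ∀ n, ∀ x ∈ S, R n x → ∃ y ∈ S, y ∈ L.fil n k ∧ R (n + 1) (x + y))
    (hcl : ∀ n, ∀ x ∈ S, ∀ y ∈ S, R n x → y - x ∈ L.fil n k → R n y) :
    ∃ x ∈ S, ∀ n, R n x := by
  obtain ⟨x, hx, hR⟩ := successive_approximation (L := L) (ι := Unit) (deg := fun _ => k)
    (fun _ => S) (fun _ => hS) (fun n x => R n (x ())) h0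
    (fun n x hx hR => by
      obtain ⟨y, hy, hyF, hyR⟩ := hstep n (x ()) (hx ()) hR
      exact ⟨fun _ => y, fun _ => hy, fun _ => hyF, hyR⟩)
    (fun n x y hx hy hR h => hcl n _ (hx ()) _ (hy ()) hR (h ()))
  exact ⟨x (), hx (), hR⟩

/-- The kernel of a morphism is closed. -/
lemma Hom.ker_closed {L M : CGL.{u}} (f : Hom L M) {k : ℤ} (x : L k)
    (h : ∀ n, ∃ y ∈ LinearMap.ker (f.app k), x - y ∈ L.fil n k) : x ∈ LinearMap.ker (f.app k) := by
  rw [LinearMap.mem_ker]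
  refine M.separated _ fun n => ?_
  obtain ⟨y, hy, hxy⟩ := h n
  have := f.map_fil n _ hxy
  rwa [map_sub, LinearMap.mem_ker.1 hy, sub_zero] at this

/-- An endomorphism that is the identity on the associated graded algebra is an isomorphism. -/
lemma exists_iso_of_unipotent {L : CGL.{u}} (f : Hom L L)
    (hf : ∀ (n : ℕ) {k : ℤ} (x : L k), x ∈ L.fil n k → f.app k x - x ∈ L.fil (n + 1) k) :
    ∃ e : Iso L L, e.hom = f := by
  -- The morphism reflects the filtration; this yields both injectivity and the fact that the
  -- inverse is filtered.
  have hinj : ∀ (n : ℕ) {k : ℤ} (x : L k), f.app k x ∈ L.fil n k → x ∈ L.fil n k := by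
    intro n
    induction n with
    | zero => exact fun x _ => mem_fil_zero x
    | succ n ih =>
      intro k x hx
      have := sub_mem hx (hf n x (ih x (fil_succ_le hx)))
      simpa using this
  -- The correction at each stage is the remaining error, because `f` is the identity on the graded
  -- quotients.
  have hsurj : ∀ k, Function.Surjective (f.app k) := by
    intro k y
    obtain ⟨x, -, hx⟩ := successive_approximation_one (L := L) (k := k) ⊤ (fun _ _ => trivial)
      (fun n x => y - f.app k x ∈ L.fil n k) (mem_fil_zero _)
      (fun n x _ hx => ⟨y - f.app k x, trivial, hx, by
        have := neg_mem (hf n _ hx)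
        convert this using 1
        simp only [map_add]; abel⟩)
      (fun n x _ z _ hx hz => by
        have := sub_mem hx (f.map_fil n _ hz)
        convert this using 1
        simp only [map_sub]; abel)
    exact ⟨x, (eq_of_sub_mem hx).symm⟩
  let E : ∀ k, L k ≃ₗ[ℚ] L k := fun k => LinearEquiv.ofBijective (f.app k)
    ⟨(injective_iff_map_eq_zero _).2 fun x hx => L.separated x fun n =>
      hinj n x (by rw [hx]; exact zero_mem _), hsurj k⟩
  have hE : ∀ k x, f.app k ((E k).symm x) = x := fun k x => (E k).apply_symm_apply x
  have hE' : ∀ k x, (E k).symm (f.app k x) = x := fun k x => (E k).symm_apply_apply x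
  refine ⟨⟨f, ⟨fun k => (E k).symm, fun {i j k} h x y => ?_, fun n k x hx => ?_⟩, hE, hE'⟩, rfl⟩
  · change (E k).symm _ = L.bracket h ((E i).symm x) ((E j).symm y)
    apply (E k).injective
    change f.app k _ = f.app k _
    rw [hE, f.map_bracket, hE, hE]
  · refine hinj n _ ?_
    change f.app k ((E k).symm x) ∈ _
    rwa [hE]

namespace free

variable {X : Type u} {deg : X → ℤ}

/-- A subspace that contains the bracketings of length at least `n` and some `Fᴺ` contains `Fⁿ`. -/
lemma fil_le_of_tree {k : ℤ} (n N : ℕ) (P : Submodule ℚ (free deg k))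
    (ht : ∀ t : FreeMagma X, treeDeg deg t = k → n ≤ t.length →
      ∀ h : FL.mk deg t ∈ FL.homog deg t.length k, single (FL.mk deg t) h ∈ P)
    (hN : (free deg).fil N k ≤ P) : (free deg).fil n k ≤ P := by
  intro x hx
  have hsingle : ∀ (m : ℕ) (a : FL deg) (ha : a ∈ FL.homog deg m k), n ≤ m → single a ha ∈ P := by
    intro m a ha hm
    induction ha using Submodule.span_induction with
    | mem a h =>
      obtain ⟨t, rfl, rfl, rfl⟩ := h
      exact ht t rfl hm _
    | zero =>
      convert P.zero_mem
      refine ext_coeff fun l => ?_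
      change (Pi.single m 0 : ℕ → FL deg) l = 0
      simp
    | add a b ha hb h1 h2 =>
      convert add_mem h1 h2
      refine ext_coeff fun l => ?_
      change (Pi.single m (a + b) : ℕ → FL deg) l =
        (Pi.single m a : ℕ → FL deg) l + (Pi.single m b : ℕ → FL deg) l
      rw [Pi.single_add, Pi.add_apply]
    | smul r a ha h =>
      convert Submodule.smul_mem _ r h
      refine ext_coeff fun l => ?_
      change (Pi.single m (r • a) : ℕ → FL deg) l = r • (Pi.single m a : ℕ → FL deg) l
      rw [Pi.single_smul, Pi.smul_apply]
  have h1 : ∑ m ∈ Finset.range N, single (coeff x m) (coeff_mem x m) ∈ P := by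
    refine Submodule.sum_mem _ fun m _ => ?_
    rcases lt_or_ge m n with h | h
    · convert P.zero_mem
      refine ext_coeff fun l => ?_
      change (Pi.single m (coeff x m) : ℕ → FL deg) l = 0
      rw [(mem_fil x n).1 hx m h]
      simp
    · exact hsingle _ _ _ h
  have h2 : x - ∑ m ∈ Finset.range N, single (coeff x m) (coeff_mem x m) ∈ P := by
    refine hN ((mem_fil _ _).2 fun m hm => ?_)
    rw [map_sub, Pi.sub_apply, map_sum, Finset.sum_apply, Finset.sum_eq_single m]
    · simp [coeff_single]
    · intro b _ hb; simp [coeff_single, hb.symm]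
    · intro h; exact absurd (Finset.mem_range.2 hm) h
  simpa using add_mem h2 h1

/-- A subspace that contains all brackets and some `Fᴺ` contains `F²`. -/
lemma fil_two_le {k : ℤ} (N : ℕ) (P : Submodule ℚ (free deg k))
    (hbr : ∀ {i j : ℤ} (h : i + j = k) (x : free deg i) (y : free deg j),
      (free deg).bracket h x y ∈ P)
    (hN : (free deg).fil N k ≤ P) : (free deg).fil 2 k ≤ P := by
  refine fil_le_of_tree 2 N P (fun t h ht _ => ?_) hN
  subst h
  induction t with
  | ih1 x => exact absurd ht (by simp)
  | ih2 s t _ _ =>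
    exact (congrArg (· ∈ P) (single_mul (deg := deg) s t)).mp
      (hbr rfl (single _ (mk_mem (deg := deg) s)) (single _ (mk_mem (deg := deg) t)))

/-- An endomorphism of `𝕃̂(V)` that is the identity modulo brackets is an isomorphism. -/
lemma exists_iso_of_gen (f : Hom (free deg) (free deg))
    (hf : ∀ x, f.app _ (gen x rfl) - gen x rfl ∈ (free deg).fil 2 (deg x)) :
    ∃ e : Iso (free deg) (free deg), e.hom = f := by
  have htree : ∀ t : FreeMagma X, f.app _ (single _ (mk_mem t)) - single _ (mk_mem t) ∈
      (free deg).fil (t.length + 1) (treeDeg deg t) := by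
    intro t
    induction t with
    | ih1 x => exact hf x
    | ih2 s t hs ht =>
      have e := single_mul (deg := deg) s t
      change f.app _ (single _ (mk_mul_mem s t)) - single _ (mk_mul_mem s t) ∈
        (free deg).fil (s.length + t.length + 1) _
      rw [← e, f.map_bracket]
      have hmem : ∀ r : FreeMagma X, single _ (mk_mem (deg := deg) r) ∈
          (free deg).fil r.length (treeDeg deg r) := fun r m hm => by
        change (Pi.single r.length (FL.mk deg r) : ℕ → FL deg) m = 0
        rw [Pi.single_eq_of_ne hm.ne]
      have hs' : f.app _ (single _ (mk_mem s)) - single _ (mk_mem s) ∈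
        (free deg).fil (s.length + 1) (treeDeg deg s) := hs
      have ht' : f.app _ (single _ (mk_mem t)) - single _ (mk_mem t) ∈
        (free deg).fil (t.length + 1) (treeDeg deg t) := ht
      -- Changing one factor, of length `p`, by an element of `F^{p+1}` changes the bracket with a
      -- factor of length `q` by an element of `F^{p+q+1}`.
      exact bracket_sub_mem rfl hs' (f.map_fil _ _ (hmem t)) (hmem s) ht' (by omega) (by omega)
  refine exists_iso_of_unipotent f fun n k => ?_
  refine fil_le_of_tree n (n + 1) (((free deg).fil (n + 1) k).comap (f.app k - LinearMap.id))
    (fun t h ht _ => ?_) (fun x hx => ?_)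
  · subst h
    exact (free deg).fil_anti (Nat.succ_le_succ ht) _ (htree t)
  · exact sub_mem (f.map_fil _ _ hx) hx

end free

end CGL

/-! ### Power series in `ad x` -/

namespace CGL

section AdSeries

variable {L M : CGL.{u}}

lemma ad_apply (x : L 0) (k : ℤ) (v : L k) : L.ad x k v = L.bracket (zero_add k) x v := rfl

lemma ad_pow_mem (x : L 0) {k : ℤ} {m : ℕ} (n : ℕ) {v : L k} (hv : v ∈ L.fil m k) :
    (L.ad x k ^ n) v ∈ L.fil (m + n) k := by
  induction n with
  | zero => simpa using hv
  | succ n ih =>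
    rw [pow_succ', Module.End.mul_apply]
    exact bracket_mem_right _ x ih

lemma aeval_ad_mem (x : L 0) {k : ℤ} {m N : ℕ} {p : Polynomial ℚ} (hp : Polynomial.X ^ N ∣ p)
    {v : L k} (hv : v ∈ L.fil m k) : Polynomial.aeval (L.ad x k) p v ∈ L.fil (m + N) k := by
  obtain ⟨r, rfl⟩ := hp
  rw [map_mul, map_pow, Polynomial.aeval_X, Module.End.mul_apply]
  refine ad_pow_mem x N ?_
  rw [Polynomial.aeval_eq_sum_range, LinearMap.sum_apply]
  exact Submodule.sum_mem _ fun n _ => Submodule.smul_mem _ _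
    (L.fil_anti (Nat.le_add_right m n) _ (ad_pow_mem x n hv))

lemma X_pow_dvd_trunc_sub {m n : ℕ} (h : m ≤ n) (f : PowerSeries ℚ) :
    Polynomial.X ^ m ∣ PowerSeries.trunc n f - PowerSeries.trunc m f := by
  rw [Polynomial.X_pow_dvd_iff]
  intro d hd
  rw [Polynomial.coeff_sub, PowerSeries.coeff_trunc, PowerSeries.coeff_trunc, if_pos hd,
    if_pos (hd.trans_le h), sub_self]

lemma X_pow_dvd_trunc_mul_sub (n : ℕ) (f g : PowerSeries ℚ) :
    Polynomial.X ^ n ∣ PowerSeries.trunc n (f * g) -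
      PowerSeries.trunc n f * PowerSeries.trunc n g := by
  rw [Polynomial.X_pow_dvd_iff]
  intro d hd
  rw [Polynomial.coeff_sub, PowerSeries.coeff_trunc, if_pos hd, PowerSeries.coeff_mul,
    Polynomial.coeff_mul, sub_eq_zero]
  refine Finset.sum_congr rfl fun p hp => ?_
  have := Finset.HasAntidiagonal.mem_antidiagonal.1 hp
  rw [PowerSeries.coeff_trunc, PowerSeries.coeff_trunc, if_pos (by omega), if_pos (by omega)]

/-- `ad x` raises the filtration, so the truncation at order `n` already determines the value modulo
`Fⁿ`, whatever the coefficients of `f` are. -/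
lemma exists_adSeries (x : L 0) (f : PowerSeries ℚ) {k : ℤ} (v : L k) :
    ∃ y, ∀ n, y - Polynomial.aeval (L.ad x k) (PowerSeries.trunc n f) v ∈ L.fil n k :=
  L.complete _ fun n => by
    rw [← LinearMap.sub_apply, ← map_sub]
    simpa using aeval_ad_mem x (m := 0) (X_pow_dvd_trunc_sub n.le_succ f) (mem_fil_zero v)

lemma adSeries_unique (x : L 0) (f : PowerSeries ℚ) {k : ℤ} (v : L k) {y z : L k}
    (hy : ∀ n, y - Polynomial.aeval (L.ad x k) (PowerSeries.trunc n f) v ∈ L.fil n k)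
    (hz : ∀ n, z - Polynomial.aeval (L.ad x k) (PowerSeries.trunc n f) v ∈ L.fil n k) : y = z :=
  eq_of_sub_mem fun n => by simpa using sub_mem (hy n) (hz n)

/-- The operator `f(ad x)` for a power series `f`. -/
noncomputable def adSeries (x : L 0) (f : PowerSeries ℚ) (k : ℤ) : L k →ₗ[ℚ] L k where
  toFun v := (exists_adSeries x f v).choose
  map_add' v w := adSeries_unique x f (v + w) (exists_adSeries x f (v + w)).choose_spec fun n => by
    rw [map_add, add_sub_add_comm]
    exact add_mem ((exists_adSeries x f v).choose_spec n) ((exists_adSeries x f w).choose_spec n)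
  map_smul' c v := adSeries_unique x f (c • v) (exists_adSeries x f (c • v)).choose_spec fun n => by
    rw [map_smul, RingHom.id_apply, ← smul_sub]
    exact Submodule.smul_mem _ c ((exists_adSeries x f v).choose_spec n)

lemma adSeries_spec (x : L 0) (f : PowerSeries ℚ) {k : ℤ} (v : L k) (n : ℕ) :
    adSeries x f k v - Polynomial.aeval (L.ad x k) (PowerSeries.trunc n f) v ∈ L.fil n k :=
  (exists_adSeries x f v).choose_spec n

lemma adSeries_eq (x : L 0) (f : PowerSeries ℚ) {k : ℤ} {v y : L k}
    (hy : ∀ n, y - Polynomial.aeval (L.ad x k) (PowerSeries.trunc n f) v ∈ L.fil n k) :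
    adSeries x f k v = y := adSeries_unique x f v (adSeries_spec x f v) hy

lemma adSeries_isSum (x : L 0) (f : PowerSeries ℚ) {k : ℤ} (v : L k) :
    L.IsSum (fun n => PowerSeries.coeff n f • (L.ad x k ^ n) v) (adSeries x f k v) := by
  intro N
  refine ⟨N, fun n hn => L.fil_anti hn k ?_⟩
  convert adSeries_spec x f v n using 2
  have e : PowerSeries.trunc n f =
      ∑ m ∈ Finset.range n, Polynomial.monomial m (PowerSeries.coeff m f) := by
    ext d
    simp [PowerSeries.coeff_trunc, Polynomial.coeff_monomial]
  rw [e, map_sum, LinearMap.sum_apply]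
  refine Finset.sum_congr rfl fun m _ => ?_
  rw [Polynomial.aeval_monomial, Module.End.mul_apply, Module.algebraMap_end_apply]

lemma adSeries_mul (x : L 0) (f g : PowerSeries ℚ) {k : ℤ} (v : L k) :
    adSeries x (f * g) k v = adSeries x f k (adSeries x g k v) := by
  refine adSeries_eq x _ fun n => ?_
  have h1 := adSeries_spec x f (adSeries x g k v) n
  have h2 := aeval_ad_mem x (p := PowerSeries.trunc n f) (N := 0) (by simp) (adSeries_spec x g v n)
  have h3 := aeval_ad_mem x (m := 0) (X_pow_dvd_trunc_mul_sub n f g) (mem_fil_zero v)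
  rw [add_zero] at h2
  rw [zero_add] at h3
  convert sub_mem (add_mem h1 h2) h3 using 1
  simp only [map_sub, map_mul, LinearMap.sub_apply, Module.End.mul_apply]
  abel

lemma adSeries_one (x : L 0) {k : ℤ} (v : L k) : adSeries x 1 k v = v := by
  refine adSeries_eq x _ fun n => ?_
  rcases n with _ | n
  · exact mem_fil_zero _
  · rw [PowerSeries.trunc_one, map_one, Module.End.one_apply, sub_self]
    exact zero_mem _

lemma adSeries_add (x : L 0) (f g : PowerSeries ℚ) {k : ℤ} (v : L k) :
    adSeries x (f + g) k v = adSeries x f k v + adSeries x g k v := by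
  refine adSeries_eq x _ fun n => ?_
  rw [map_add, map_add, LinearMap.add_apply, add_sub_add_comm]
  exact add_mem (adSeries_spec x f v n) (adSeries_spec x g v n)

lemma adSeries_X (x : L 0) {k : ℤ} (v : L k) : adSeries x PowerSeries.X k v = L.ad x k v := by
  refine IsSum.unique (adSeries_isSum x PowerSeries.X v) ?_
  have := isSum_of_eventually_zero (L := L)
    (x := fun n => PowerSeries.coeff n (PowerSeries.X : PowerSeries ℚ) • (L.ad x k ^ n) v) 2
    fun n hn => by rw [PowerSeries.coeff_X, if_neg (by omega), zero_smul]
  simpa [Finset.sum_range_succ, PowerSeries.coeff_X] using this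

lemma adSeries_neg (x : L 0) (f : PowerSeries ℚ) {k : ℤ} (v : L k) :
    adSeries (-x) f k v = adSeries x (PowerSeries.rescale (-1) f) k v := by
  refine IsSum.unique (adSeries_isSum (-x) f v) ?_
  convert adSeries_isSum x (PowerSeries.rescale (-1) f) v using 2 with n
  have : L.ad (-x) k = (-1 : ℚ) • L.ad x k := by
    rw [ad, map_neg, neg_one_smul]; rfl
  rw [this, smul_pow, LinearMap.smul_apply, smul_smul, PowerSeries.coeff_rescale, mul_comm]

lemma Hom.map_ad_pow (φ : Hom L M) (x : L 0) (n : ℕ) {k : ℤ} (v : L k) :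
    φ.app k ((L.ad x k ^ n) v) = (M.ad (φ.app 0 x) k ^ n) (φ.app k v) := by
  induction n with
  | zero => rfl
  | succ n ih =>
    rw [pow_succ', pow_succ', Module.End.mul_apply, Module.End.mul_apply, ← ih]
    exact φ.map_bracket _ _ _

lemma Hom.map_adSeries (φ : Hom L M) (x : L 0) (f : PowerSeries ℚ) {k : ℤ} (v : L k) :
    φ.app k (adSeries x f k v) = adSeries (φ.app 0 x) f k (φ.app k v) := by
  refine IsSum.unique ?_ (adSeries_isSum _ f _)
  convert (adSeries_isSum x f v).map (φ.app k) (fun n y hy => φ.map_fil n y hy) using 2 with n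
  rw [map_smul, φ.map_ad_pow]

/-- The first variation of `f(ad x) v`. -/
lemma adSeries_variation (x y : L 0) (f : PowerSeries ℚ) {k : ℤ} (v e : L k) {n : ℕ}
    (hy : y ∈ L.fil n 0) (he : e ∈ L.fil n k) :
    adSeries (x + y) f k (v + e) - adSeries x f k v - PowerSeries.coeff 0 f • e ∈
      L.fil (n + 1) k := by
  -- Every positive power involves a bracket with `x` or `y`, which costs one step; so only the
  -- constant coefficient of `f` contributes to the first variation.
  have hpow : ∀ m, (L.ad (x + y) k ^ (m + 1)) (v + e) - (L.ad x k ^ (m + 1)) v ∈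
      L.fil (n + 1) k := by
    have hone : ∀ w w' : L k, w' - w ∈ L.fil n k →
        L.ad (x + y) k w' - L.ad x k w ∈ L.fil (n + 1) k := by
      intro w w' hw
      have h1 := bracket_mem_left (zero_add k) w' hy
      have h2 := bracket_mem_right (zero_add k) x hw
      convert add_mem h1 h2 using 1
      simp only [ad_apply, map_add, map_sub, LinearMap.add_apply]; abel
    intro m
    induction m with
    | zero => simpa using hone v (v + e) (by simpa using he)
    | succ m ih =>
      rw [pow_succ', pow_succ' _ (m + 1), Module.End.mul_apply, Module.End.mul_apply]
      exact hone _ _ (fil_succ_le ih)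
  have h := (adSeries_isSum (x + y) f (v + e)).add ((adSeries_isSum x f v).map (-LinearMap.id)
    fun n y hy => neg_mem hy)
  have := h.sub_mem (N := n + 1) (n₀ := 1) fun m hm => by
    obtain ⟨m, rfl⟩ : ∃ l, m = l + 1 := ⟨m - 1, by omega⟩
    have := Submodule.smul_mem _ (PowerSeries.coeff (m + 1) f) (hpow m)
    convert this using 1
    simp only [LinearMap.neg_apply, LinearMap.id_apply, smul_sub]; abel
  convert this using 1
  simp only [Finset.range_one, Finset.sum_singleton, pow_zero, Module.End.one_apply,
    LinearMap.neg_apply, LinearMap.id_apply, smul_add]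
  abel

end AdSeries

/-- The power series `(e^t - 1) / t`. -/
noncomputable def expDiv : PowerSeries ℚ := PowerSeries.mk fun n => 1 / ((n + 1).factorial : ℚ)

lemma X_mul_expDiv : PowerSeries.X * expDiv = PowerSeries.exp ℚ - 1 := by
  ext n
  rcases n with _ | n
  · simp
  · rw [PowerSeries.coeff_succ_X_mul, expDiv, PowerSeries.coeff_mk, map_sub, PowerSeries.coeff_exp,
      PowerSeries.coeff_one, if_neg (by omega)]
    simp

/-- This inversion solves the path equation for `b - a`, turning the Bernoulli series into `(e^t -
1) / t`. -/
lemma bernoulli_mul_expDiv : bernoulliPowerSeries ℚ * expDiv = 1 := by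
  have h := bernoulliPowerSeries_mul_exp_sub_one ℚ
  rw [← X_mul_expDiv] at h
  have : PowerSeries.X * (bernoulliPowerSeries ℚ * expDiv) = (PowerSeries.X : PowerSeries ℚ) * 1 := by
    rw [mul_one, mul_left_comm, h]
  exact mul_left_cancel₀ PowerSeries.X_ne_zero this

/-- From `((e^{-t} - 1) / (-t)) · e^t = (e^t - 1) / t`. It is the reason why the gauge action of
`-x` undoes that of `x`. -/
lemma rescale_expDiv_mul_exp :
    PowerSeries.rescale (-1) expDiv * PowerSeries.exp ℚ = expDiv := by
  have h1 : -PowerSeries.X * PowerSeries.rescale (-1) expDiv =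
      PowerSeries.rescale (-1) (PowerSeries.exp ℚ) - 1 := by
    have := congrArg (PowerSeries.rescale (-1 : ℚ)) X_mul_expDiv
    rw [map_mul, PowerSeries.rescale_neg_one_X, map_sub, map_one] at this
    exact this
  have h2 : PowerSeries.rescale (-1) (PowerSeries.exp ℚ) * PowerSeries.exp ℚ = 1 := by
    rw [mul_comm]; exact PowerSeries.exp_mul_exp_neg_eq_one
  refine mul_left_cancel₀ (PowerSeries.X_ne_zero (R := ℚ)) ?_
  rw [X_mul_expDiv]
  linear_combination (-PowerSeries.exp ℚ) * h1 - h2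

end CGL

open CGL

lemma CGL.IsSum.cons {L : CGL.{u}} {k : ℤ} {x : ℕ → L k} {s : L k}
    (h : L.IsSum (fun n => x (n + 1)) s) : L.IsSum x (x 0 + s) := by
  intro N
  obtain ⟨n₀, hn₀⟩ := h N
  refine ⟨n₀ + 1, fun n hn => ?_⟩
  obtain ⟨n, rfl⟩ : ∃ m, n = m + 1 := ⟨n - 1, by omega⟩
  have := hn₀ n (by omega)
  rw [Finset.sum_range_succ']
  convert this using 1
  abel

/-! ### Perturbed differentials, paths and the gauge action -/

namespace CDGL

variable {L M : CDGL.{u}}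

lemma Hom.ext_app {f g : Hom L M} (h : ∀ k x, f.app k x = g.app k x) : f = g :=
  Hom.ext (funext fun k => LinearMap.ext (h k))

lemma Hom.congr_app {f g : Hom L M} (h : f = g) (k : ℤ) (x : L k) : f.app k x = g.app k x := by
  rw [h]

lemma bracket_comm_odd (x y : L (-1)) (h : (-1 : ℤ) + -1 = -2) :
    L.lie.bracket h x y = L.lie.bracket h y x := by
  rw [L.lie.skew h h]; norm_num

lemma diff_ad (x : L 0) (c : L (-1)) (h : (-1 : ℤ) + -1 = -2) :
    L.diff.app h (L.lie.ad x (-1) c) =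
      L.lie.bracket h (L.diff.app (show (0 : ℤ) + -1 = -1 by norm_num) x) c +
        L.lie.ad x (-2) (L.diff.app h c) := by
  rw [ad_apply, L.diff.leibniz (zero_add (-1)) (show (0 : ℤ) + -1 = -1 by norm_num) h h h
    (zero_add (-2))]
  simp [ad_apply]

lemma dPert_map (f : Hom L M) (a : L (-1)) {i j : ℤ} (h : i + -1 = j) (x : L i) :
    f.app j (L.dPert a h x) = M.dPert (f.app _ a) h (f.app i x) := by
  simp only [dPert, LinearMap.add_apply, map_add, f.comm, f.map_bracket]

lemma dPert_mem (a : L (-1)) {i j : ℤ} (h : i + -1 = j) {n : ℕ} {x : L i} (hx : x ∈ L.lie.fil n i) :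
    L.dPert a h x ∈ L.lie.fil n j :=
  add_mem (L.diff.map_fil n h x hx) (fil_succ_le (bracket_mem_right _ a hx))

/-- The square of `d + ad_a` is `ad` of the curvature `da + ½[a, a]`, as the Jacobi identity gives
`[a, [a, x]] = ½[[a, a], x]` for odd `a`. -/
lemma dPert_sq {a : L (-1)} (ha : L.IsMC a) {i j k : ℤ} (h : i + -1 = j) (h' : j + -1 = k)
    (x : L i) : L.dPert a h' (L.dPert a h x) = 0 := by
  have e1 := L.diff.leibniz (i := -1) (j := i) (k := j) (i' := -2) (j' := j) (k' := k) (by omega)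
    (by omega) h h' (by omega) (by omega) a x
  have e2 := L.lie.jacobi (i := -1) (j := -1) (k := i) (ij := -2) (jk := j) (ik := j) (n := k)
    (by omega) (by omega) (by omega) (by omega) (by omega) (by omega) a a x
  simp only [dPert, LinearMap.add_apply, map_add, L.diff.sq_zero]
  rw [e1, ha]
  norm_num at e2 ⊢
  have e3 : L.lie.bracket (show -1 + j = k by omega) a
      (L.lie.bracket (show -1 + i = j by omega) a x) = (1 / 2 : ℚ) •
        L.lie.bracket (show -2 + i = k by omega)
          (L.lie.bracket (show (-1 : ℤ) + -1 = -2 by omega) a a) x := by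
    have : (2 : ℚ) • L.lie.bracket (show -1 + j = k by omega) a
      (L.lie.bracket (show -1 + i = j by omega) a x) =
        L.lie.bracket (show -2 + i = k by omega)
          (L.lie.bracket (show (-1 : ℤ) + -1 = -2 by omega) a a) x := by
      rw [two_smul]; nth_rewrite 1 [e2]; abel
    rw [← this, smul_smul]; norm_num
  rw [e3]
  norm_num

lemma isMC_map (f : Hom L M) {a : L (-1)} (ha : L.IsMC a) : M.IsMC (f.app _ a) := by
  rw [IsMC, ← f.comm, ha, map_smul, f.map_bracket]

lemma isMC_zero : L.IsMC 0 := by simp [IsMC]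

/-- The gauge action: the source of the path `x` with target `b`. -/
noncomputable def gauge (L : CDGL.{u}) (x : L 0) (b : L (-1)) : L (-1) :=
  b + adSeries x expDiv (-1)
    (L.lie.ad x (-1) b - L.diff.app (show (0 : ℤ) + -1 = -1 by norm_num) x)

/-- The Bernoulli series is invertible, so the path equation determines the source from `x` and the
target. From here on paths are handled through this closed formula. -/
lemma isPath_iff {a b : L (-1)} {x : L 0} : L.IsPath a b x ↔ a = L.gauge x b := by
  have hB : L.lie.IsSum
      (fun n => (bernoulli n / (n.factorial : ℚ)) • ((L.lie.ad x (-1)) ^ n) (b - a))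
      (adSeries x (bernoulliPowerSeries ℚ) (-1) (b - a)) := by
    convert adSeries_isSum x (bernoulliPowerSeries ℚ) (b - a) using 3 with n
    simp [bernoulliPowerSeries]
  have key : L.gauge x b = b - adSeries x expDiv (-1)
      (L.diff.app (show (0 : ℤ) + -1 = -1 by norm_num) x - L.lie.ad x (-1) b) := by
    rw [gauge, ← neg_sub (L.diff.app _ x), map_neg, ← sub_eq_add_neg]
  rw [key]
  constructor
  · intro h
    rw [IsSum.unique h hB, ← adSeries_mul, mul_comm, bernoulli_mul_expDiv, adSeries_one]
    abel
  · intro h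
    have e : b - a = adSeries x expDiv (-1)
      (L.diff.app (show (0 : ℤ) + -1 = -1 by norm_num) x - L.lie.ad x (-1) b) := by
      rw [h]; abel
    rw [e, ← adSeries_mul, bernoulli_mul_expDiv, adSeries_one] at hB
    rw [IsPath, e]
    exact hB

lemma map_gauge (f : Hom L M) (x : L 0) (b : L (-1)) :
    f.app _ (L.gauge x b) = M.gauge (f.app _ x) (f.app _ b) := by
  rw [gauge, gauge, map_add, f.map_adSeries, map_sub, f.comm, ad_apply, ad_apply, f.map_bracket]

lemma isPath_map (f : Hom L M) {a b : L (-1)} {x : L 0} (h : L.IsPath a b x) :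
    M.IsPath (f.app _ a) (f.app _ b) (f.app _ x) := by
  rw [isPath_iff] at *
  rw [h, map_gauge]

lemma gauge_zero (b : L (-1)) : L.gauge 0 b = b := by
  simp [gauge, ad_apply]

/-- As `ad_x b = -[b, x]`, the series is applied to `-d_b x`; cycles of `d_b` in degree `0`
therefore fix `b`. -/
lemma gauge_of_dPert_eq_zero {x : L 0} {b : L (-1)}
    (h : L.dPert b (show (0 : ℤ) + -1 = -1 by norm_num) x = 0) : L.gauge x b = b := by
  have : L.lie.ad x (-1) b - L.diff.app (show (0 : ℤ) + -1 = -1 by norm_num) x = 0 := by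
    rw [dPert, LinearMap.add_apply] at h
    rw [ad_apply, L.lie.skew (zero_add (-1)) (show (-1 : ℤ) + 0 = -1 by norm_num)]
    rw [← neg_eq_zero, ← h]
    simp
  rw [gauge, this, map_zero, add_zero]

/-- For equal ends the Bernoulli series is zero, and what remains of the path equation is `dx - ad_x
b = d_b x`. So loops at `b` are cycles of `d_b`. -/
lemma dPert_eq_zero_of_isPath {x : L 0} {b : L (-1)} (h : L.IsPath b b x) :
    L.dPert b (show (0 : ℤ) + -1 = -1 by norm_num) x = 0 := by
  have h0 : L.lie.IsSum
      (fun n => (bernoulli n / (n.factorial : ℚ)) • ((L.lie.ad x (-1)) ^ n) (b - b)) 0 := by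
    simpa using isSum_of_eventually_zero (L := L.lie) (k := -1) (x := fun n =>
      (bernoulli n / (n.factorial : ℚ)) • ((L.lie.ad x (-1)) ^ n) (b - b)) 0 (by simp)
  have := IsSum.unique h h0
  rw [ad_apply, L.lie.skew (zero_add (-1)) (show (-1 : ℤ) + 0 = -1 by norm_num)] at this
  rw [dPert, LinearMap.add_apply, ← this]
  simp

/-- With `w = ad_x b - dx` and `E(t) = (e^t - 1) / t`, the element `-x` acts on `b + E(ad x) w` by
adding `-E(-ad x) e^{ad x} w = -E(ad x) w`. -/
lemma gauge_neg (x : L 0) (b : L (-1)) : L.gauge (-x) (L.gauge x b) = b := by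
  set w := L.lie.ad x (-1) b - L.diff.app (show (0 : ℤ) + -1 = -1 by norm_num) x with hw
  have e1 : L.gauge x b = b + adSeries x expDiv (-1) w := rfl
  have e2 : L.lie.ad (-x) (-1) (L.gauge x b) -
      L.diff.app (show (0 : ℤ) + -1 = -1 by norm_num) (-x) =
        -adSeries x (PowerSeries.exp ℚ) (-1) w := by
    have : adSeries x (PowerSeries.exp ℚ) (-1) w =
        L.lie.ad x (-1) (adSeries x expDiv (-1) w) + w := by
      rw [← sub_add_cancel (PowerSeries.exp ℚ) 1, ← X_mul_expDiv, adSeries_add, adSeries_mul,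
        adSeries_X, adSeries_one]
    rw [this, e1, hw]
    simp only [ad_apply, map_neg, LinearMap.neg_apply, map_add]
    abel
  rw [gauge, e2, e1, map_neg, adSeries_neg, ← adSeries_mul, rescale_expDiv_mul_exp]
  abel

/-- Only the constant coefficient `1` of `(e^t - 1) / t` contributes modulo `Fⁿ⁺¹`, and `[y, b]` is
negligible. To first order `y` thus translates by `-dy`, which makes path equations solvable by a
homotopy for `d`. -/
lemma gauge_variation (x y : L 0) (b : L (-1)) {n : ℕ} (hy : y ∈ L.lie.fil n 0) :
    L.gauge (x + y) b - L.gauge x b + L.diff.app (show (0 : ℤ) + -1 = -1 by norm_num) y ∈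
      L.lie.fil (n + 1) (-1) := by
  have hd : (0 : ℤ) + -1 = -1 := by norm_num
  have h0 : L.lie.ad y (-1) b ∈ L.lie.fil (n + 1) (-1) := bracket_mem_left _ b hy
  have h1 := adSeries_variation x y expDiv (L.lie.ad x (-1) b - L.diff.app hd x)
    (L.lie.ad y (-1) b - L.diff.app hd y) hy (sub_mem (fil_succ_le h0) (L.diff.map_fil n hd y hy))
  have e : L.lie.ad (x + y) (-1) b - L.diff.app hd (x + y) =
      L.lie.ad x (-1) b - L.diff.app hd x + (L.lie.ad y (-1) b - L.diff.app hd y) := by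
    simp only [ad_apply, map_add, LinearMap.add_apply]; abel
  have e0 : PowerSeries.coeff 0 expDiv = (1 : ℚ) := by simp [expDiv]
  rw [e0, one_smul] at h1
  rw [gauge, gauge, e]
  convert add_mem h1 h0 using 1
  abel

lemma gauge_sub_mem (x y : L 0) (b : L (-1)) {n : ℕ} (hy : y ∈ L.lie.fil n 0) :
    L.gauge (x + y) b - L.gauge x b ∈ L.lie.fil n (-1) := by
  have := sub_mem (fil_succ_le (gauge_variation x y b hy))
    (L.diff.map_fil n (show (0 : ℤ) + -1 = -1 by norm_num) y hy)
  simpa using this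

/-- The gauge action preserves Maurer-Cartan elements. -/
lemma isMC_gauge (x : L 0) {b : L (-1)} (hb : L.IsMC b) : L.IsMC (L.gauge x b) := by
  have hd : (0 : ℤ) + -1 = -1 := by norm_num
  have h2 : (-1 : ℤ) + -1 = -2 := by norm_num
  set dx := L.diff.app hd x with hdx
  set w := L.lie.ad x (-1) b - dx with hw
  -- `c n` is the coefficient of `tⁿ` in `gauge (t x) b`, the solution of `c' = ad_x c - dx` with
  -- `c(0) = b`; the recursion `hrec` is this equation.
  let c : ℕ → L (-1) := fun n => Nat.rec b (fun n _ => (1 / ((n + 1).factorial : ℚ)) •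
    (L.lie.ad x (-1) ^ n) w) n
  have hsum : L.lie.IsSum c (L.gauge x b) := by
    refine IsSum.cons (x := c) ?_
    convert adSeries_isSum x expDiv w using 2 with n
    rw [expDiv, PowerSeries.coeff_mk]
  have hrec : ∀ n : ℕ, ((n : ℚ) + 1) • c (n + 1) =
      L.lie.ad x (-1) (c n) - if n = 0 then dx else 0 := by
    intro n
    rcases n with _ | n
    · simp [c, hw]
    · change _ • ((1 / ((n + 1 + 1).factorial : ℚ)) • (L.lie.ad x (-1) ^ (n + 1)) w) =
        L.lie.ad x (-1) ((1 / ((n + 1).factorial : ℚ)) • (L.lie.ad x (-1) ^ n) w) - _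
      rw [map_smul, smul_smul, if_neg (by omega), sub_zero, pow_succ', Module.End.mul_apply]
      congr 1
      rw [Nat.factorial_succ (n + 1)]
      have : ((n + 1).factorial : ℚ) ≠ 0 := by positivity
      push_cast
      field_simp
  -- `q` and `r` are the coefficients of `[c, c]` and `[ad_x c, c]`.
  let q : ℕ → L (-2) := fun n => ∑ p ∈ Finset.HasAntidiagonal.antidiagonal n,
    L.lie.bracket h2 (c p.1) (c p.2)
  let r : ℕ → L (-2) := fun n => ∑ p ∈ Finset.HasAntidiagonal.antidiagonal n,
    L.lie.bracket h2 (L.lie.ad x (-1) (c p.1)) (c p.2)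
  have hxq : ∀ n, L.lie.ad x (-2) (q n) = (2 : ℚ) • r n := by
    intro n
    have : ∀ p : ℕ × ℕ, L.lie.ad x (-2) (L.lie.bracket h2 (c p.1) (c p.2)) =
        L.lie.bracket h2 (L.lie.ad x (-1) (c p.1)) (c p.2) +
          L.lie.bracket h2 (L.lie.ad x (-1) (c p.2)) (c p.1) := by
      intro p
      rw [bracket_comm_odd (L.lie.ad x (-1) (c p.2)), ad_apply, ad_apply, ad_apply,
        L.lie.jacobi (zero_add _) h2 (zero_add _) (zero_add _) h2 h2]
      simp
    simp only [q, map_sum, this]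
    rw [Finset.sum_add_distrib, two_smul]
    congr 1
    exact Finset.Nat.sum_antidiagonal_swap (f := fun p =>
      L.lie.bracket h2 (L.lie.ad x (-1) (c p.1)) (c p.2))
  have hq : ∀ n : ℕ, ((n : ℚ) + 1) • q (n + 1) =
      (2 : ℚ) • (r n - L.lie.bracket h2 dx (c n)) := by
    intro n
    have e1 : ((n : ℚ) + 1) • q (n + 1) =
        ∑ p ∈ Finset.HasAntidiagonal.antidiagonal (n + 1),
          (p.1 : ℚ) • L.lie.bracket h2 (c p.1) (c p.2) +
        ∑ p ∈ Finset.HasAntidiagonal.antidiagonal (n + 1),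
          (p.2 : ℚ) • L.lie.bracket h2 (c p.1) (c p.2) := by
      rw [← Finset.sum_add_distrib, Finset.smul_sum]
      refine Finset.sum_congr rfl fun p hp => ?_
      rw [← add_smul]
      congr 1
      have := Finset.HasAntidiagonal.mem_antidiagonal.1 hp
      exact_mod_cast this.symm
    have e2 : ∑ p ∈ Finset.HasAntidiagonal.antidiagonal (n + 1),
          (p.2 : ℚ) • L.lie.bracket h2 (c p.1) (c p.2) =
        ∑ p ∈ Finset.HasAntidiagonal.antidiagonal (n + 1),
          (p.1 : ℚ) • L.lie.bracket h2 (c p.1) (c p.2) := by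
      rw [← Finset.Nat.sum_antidiagonal_swap]
      refine Finset.sum_congr rfl fun p _ => ?_
      rw [Prod.fst_swap, Prod.snd_swap, bracket_comm_odd]
    have e3 : ∑ p ∈ Finset.HasAntidiagonal.antidiagonal (n + 1),
          (p.1 : ℚ) • L.lie.bracket h2 (c p.1) (c p.2) = r n - L.lie.bracket h2 dx (c n) := by
      rw [Finset.Nat.sum_antidiagonal_succ]
      simp only [Nat.cast_zero, zero_smul, zero_add]
      have : ∀ p : ℕ × ℕ, ((p.1 + 1 : ℕ) : ℚ) • L.lie.bracket h2 (c (p.1 + 1)) (c p.2) =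
          L.lie.bracket h2 (L.lie.ad x (-1) (c p.1)) (c p.2) -
            if p.1 = 0 then L.lie.bracket h2 dx (c p.2) else 0 := by
        intro p
        rw [← LinearMap.smul_apply, ← map_smul, Nat.cast_add, Nat.cast_one, hrec, map_sub,
          LinearMap.sub_apply]
        split_ifs <;> simp
      simp only [this, Finset.sum_sub_distrib]
      congr 1
      rw [Finset.sum_eq_single (0, n)]
      · simp
      · rintro ⟨p, q⟩ hp hne
        rw [if_neg]
        intro h0
        have := Finset.HasAntidiagonal.mem_antidiagonal.1 hp
        simp only at h0 this
        exact hne (by rw [h0, Prod.mk.injEq]; omega)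
      · intro h; exact absurd (Finset.HasAntidiagonal.mem_antidiagonal.2 (zero_add n)) h
    rw [e1, e2, e3, two_smul]
  -- The curvature `k = dc + ½[c, c]` satisfies the linear equation `k' = ad_x k` with `k(0) = 0`,
  -- so all its coefficients vanish.
  have hzero : ∀ n, L.diff.app h2 (c n) + (1 / 2 : ℚ) • q n = 0 := by
    intro n
    induction n with
    | zero =>
      have : q 0 = L.lie.bracket h2 b b := by simp [q, c]
      rw [this]
      change L.diff.app h2 b + _ = 0
      rw [hb]; simp
    | succ n ih =>
      have hn : ((n : ℚ) + 1) ≠ 0 := by positivity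
      refine (smul_eq_zero.1 ?_).resolve_left hn
      rw [smul_add, ← map_smul, hrec, smul_comm, hq, smul_smul, map_sub, diff_ad, ← hdx,
        eq_neg_of_add_eq_zero_left ih, map_neg, map_smul, hxq, smul_smul]
      have : L.diff.app h2 (if n = 0 then dx else 0) = 0 := by
        split_ifs
        · rw [hdx, L.diff.sq_zero]
        · simp
      rw [this]
      norm_num
      abel
  have hs := (hsum.map (L.diff.app h2) (fun n y hy => L.diff.map_fil n h2 y hy)).add
    ((hsum.bracket h2 hsum).map ((1 / 2 : ℚ) • LinearMap.id) fun n y hy => Submodule.smul_mem _ _ hy)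
  have hs0 := isSum_of_eventually_zero (L := L.lie) (x := fun n => L.diff.app h2 (c n) +
    ((1 / 2 : ℚ) • (LinearMap.id : L (-2) →ₗ[ℚ] L (-2))) (q n)) 0 fun n _ => hzero n
  have := IsSum.unique hs hs0
  rw [IsMC, neg_smul]
  exact eq_neg_of_add_eq_zero_left this

end CDGL

/-! ### Contractions of the kernel of a morphism -/

namespace CDGL

variable {C L : CDGL.{u}}

/-- The kernel of `p` is acyclic with respect to the perturbed differential `d_a`. -/
def Hom.AcyclicAt (p : Hom C L) (a : C (-1)) : Prop :=
  ∀ {i j k : ℤ} (h : i + -1 = j) (h' : j + -1 = k) (x : C j), p.app j x = 0 →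
    C.dPert a h' x = 0 → ∃ y : C i, p.app i y = 0 ∧ C.dPert a h y = x

/-- The exact sequence of the kernel by hand: surjectivity lifts cycles and bounding elements to
chains, and acyclicity of the kernel corrects the defects of the lifts. -/
lemma Hom.AcyclicAt.isQuasiIsoAt {p : Hom C L} (hp : p.IsFibration) {a : C (-1)} (ha : C.IsMC a)
    (h : p.AcyclicAt a) : p.IsQuasiIsoAt a := by
  intro i j k hij hjk
  refine ⟨fun x hx ⟨y, hy⟩ => ?_, fun y hy => ?_⟩
  · obtain ⟨y, rfl⟩ := hp i y
    obtain ⟨z, -, hz⟩ := h hij hjk (x - C.dPert a hij y)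
      (by rw [map_sub, dPert_map, hy, sub_self]) (by rw [map_sub, hx, dPert_sq ha, sub_zero])
    exact ⟨z + y, by rw [map_add, hz]; abel⟩
  · obtain ⟨x, rfl⟩ := hp j y
    obtain ⟨z, hz, hzx⟩ := h hjk (show k + -1 = k - 1 by omega) (C.dPert a hjk x)
      (by rw [dPert_map, hy]) (dPert_sq ha _ _ _)
    exact ⟨x - z, by rw [map_sub, hzx, sub_self], 0, by rw [map_sub, hz, map_zero]; abel⟩

/-- Injectivity in homology gives `z` bounding `x`, perhaps outside the kernel. Its image is a
cycle, hence homologous to the image of a cycle `z'`; subtracting `z'` and a lifted boundary moves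
`z` into the kernel. -/
lemma Hom.IsQuasiIsoAt.acyclicAt {p : Hom C L} (hp : p.IsFibration) {a : C (-1)} (ha : C.IsMC a)
    (h : p.IsQuasiIsoAt a) : p.AcyclicAt a := by
  intro i j k hij hjk x hpx hx
  obtain ⟨z, hz⟩ := (h hij hjk).1 x hx ⟨0, by rw [map_zero, hpx]⟩
  obtain ⟨z', hz', w, hw⟩ := (h (show i + 1 + -1 = i by omega) hij).2 (p.app i z)
    (by rw [← dPert_map, hz, hpx])
  obtain ⟨w, rfl⟩ := hp _ w
  rw [← dPert_map] at hw
  refine ⟨z - z' + C.dPert a (show i + 1 + -1 = i by omega) w, ?_, ?_⟩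
  · rw [map_add, map_sub, ← hw]; abel
  · rw [map_add, map_sub, hz, hz', dPert_sq ha]; abel

/-- At `a = 0` the perturbed differential is `d`, so injectivity in homology carries the vanishing
in negative degrees back from `L` to `C`. -/
lemma Hom.IsQuasiIsoAt.hNonneg {p : Hom C L} (h : p.IsQuasiIsoAt 0) (hL : L.HNonneg) :
    C.HNonneg := by
  intro i j k hij hjk hj x hx
  have hC : ∀ {i j : ℤ} (h : i + -1 = j) (x : C i), C.dPert 0 h x = C.diff.app h x := by
    intros; simp [dPert]
  have hL' : ∀ {i j : ℤ} (h : i + -1 = j) (x : L i), L.dPert 0 h x = L.diff.app h x := by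
    intros; simp [dPert]
  obtain ⟨y, hy⟩ := hL hij hjk hj (p.app j x) (by rw [← p.comm, hx, map_zero])
  obtain ⟨z, hz⟩ := (h hij hjk).1 x (by rw [hC, hx]) ⟨y, by rw [map_zero, hL', hy]⟩
  exact ⟨z, by rw [← hC, hz]⟩

/-- A contraction of the kernel of `p` that preserves the filtration. -/
structure Contraction (p : Hom C L) where
  /-- the homotopy -/
  h : ∀ {i j : ℤ}, i + 1 = j → C i →ₗ[ℚ] C j
  map_fil : ∀ (n : ℕ) {i j : ℤ} (e : i + 1 = j) (x : C i), x ∈ C.lie.fil n i → h e x ∈ C.lie.fil n j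
  map_ker : ∀ {i j : ℤ} (e : i + 1 = j) (x : C i), p.app i x = 0 → p.app j (h e x) = 0
  homotopy : ∀ {i j k : ℤ} (e : i + 1 = j) (e' : k + 1 = i) (f : j + -1 = i) (f' : i + -1 = k)
    (x : C i), p.app i x = 0 → C.diff.app f (h e x) + h e' (C.diff.app f' x) = x

namespace Contraction

variable {p : Hom C L}

/-- The perturbation `ad_a` raises the filtration, so `h` inverts `d_a` to first order. If the error
`e = x - d_a y` lies in `Fⁿ`, adding `h e` to `y` leaves `h(de) - [a, h e]` with `de = -[a, e]`,
which lies in `Fⁿ⁺¹`. -/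
lemma acyclicAt (c : Contraction p) (a : C (-1)) (ha : C.IsMC a) : p.AcyclicAt a := by
  intro i j k hij hjk x hpx hx
  obtain ⟨y, hy, hR⟩ := successive_approximation_one (L := C.lie) (LinearMap.ker (p.app i))
    p.ker_closed (fun n y => x - C.dPert a hij y ∈ C.lie.fil n j) (mem_fil_zero _)
    (fun n y hy hR => by
      rw [LinearMap.mem_ker] at hy
      set e := x - C.dPert a hij y with he
      have hpe : p.app j e = 0 := by rw [he, map_sub, hpx, dPert_map, hy, map_zero, sub_zero]
      have hde : C.dPert a hjk e = 0 := by rw [he, map_sub, hx, dPert_sq ha, sub_zero]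
      have hji : j + 1 = i := by omega
      have hkj : k + 1 = j := by omega
      refine ⟨c.h hji e, c.map_ker _ _ hpe, c.map_fil n _ _ hR, ?_⟩
      have h1 := c.homotopy hji hkj hij hjk e hpe
      have h2 : C.diff.app hjk e = - C.lie.bracket (show -1 + j = k by omega) a e := by
        rw [dPert, LinearMap.add_apply] at hde
        exact eq_neg_of_add_eq_zero_left hde
      have h3 := c.map_fil (n + 1) hkj _ (neg_mem (bracket_mem_right (show -1 + j = k by omega) a hR))
      have h4 := bracket_mem_right (show -1 + i = j by omega) a (c.map_fil n hji e hR)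
      rw [h2] at h1
      convert sub_mem h3 h4 using 1
      rw [map_add, ← sub_sub, ← he]
      nth_rewrite 1 [← h1]
      rw [dPert, LinearMap.add_apply]
      abel)
    (fun n y _ z _ hR hz => by
      have := sub_mem hR (dPert_mem a hij hz)
      convert this using 1
      rw [map_sub]; abel)
  exact ⟨y, hy, (eq_of_sub_mem hR).symm⟩

lemma isQuasiIsoAt (c : Contraction p) (hp : p.IsFibration) (a : C (-1)) (ha : C.IsMC a) : p.IsQuasiIsoAt a :=
  Hom.AcyclicAt.isQuasiIsoAt hp ha (c.acyclicAt a ha)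

/-- Paths with given end points can be lifted. -/
lemma exists_isPath (c : Contraction p) (hp : p.IsFibration) {a b : C (-1)} (ha : C.IsMC a)
    (hb : C.IsMC b) {x : L 0}
    (hx : L.IsPath (p.app _ a) (p.app _ b) x) : ∃ y : C 0, C.IsPath a b y ∧ p.app _ y = x := by
  obtain ⟨x, rfl⟩ := hp 0 x
  rw [isPath_iff, ← map_gauge] at hx
  have hd : (0 : ℤ) + -1 = -1 := by norm_num
  have h2 : (-1 : ℤ) + -1 = -2 := by norm_num
  -- The error `r = gauge (x + y) b - a` is a difference of Maurer-Cartan elements, so `dr = -½([g,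
  -- r] + [r, a])` is one step deeper than `r`. Adding `h r` to `y` changes the gauge by `-d(h r)`
  -- to first order and leaves `h(dr)`.
  obtain ⟨y, hy, hR⟩ := successive_approximation_one (L := C.lie) (LinearMap.ker (p.app 0))
    p.ker_closed (fun n y => C.gauge (x + y) b - a ∈ C.lie.fil n (-1)) (mem_fil_zero _)
    (fun n y hy hR => by
      rw [LinearMap.mem_ker] at hy
      set g := C.gauge (x + y) b with hg
      have hgm : C.IsMC g := isMC_gauge _ hb
      have hpr : p.app _ (g - a) = 0 := by
        rw [map_sub, hx, hg, map_gauge, map_add, hy, add_zero, map_gauge, sub_self]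
      have hh : (-1 : ℤ) + 1 = 0 := by norm_num
      have hh' : (-2 : ℤ) + 1 = -1 := by norm_num
      refine ⟨c.h hh (g - a), c.map_ker _ _ hpr, c.map_fil n _ _ hR, ?_⟩
      have h1 := c.homotopy hh hh' hd h2 _ hpr
      have hdr : C.diff.app h2 (g - a) ∈ C.lie.fil (n + 1) (-2) := by
        have e : C.diff.app h2 (g - a) = -(1 / 2 : ℚ) • (C.lie.bracket h2 g (g - a) +
            C.lie.bracket h2 (g - a) a) := by
          rw [map_sub, hgm, ha, ← smul_sub]
          congr 1
          simp only [map_sub, LinearMap.sub_apply]; abel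
        rw [e]
        exact Submodule.smul_mem _ _ (add_mem (bracket_mem_right _ _ hR) (bracket_mem_left _ _ hR))
      have h3 := gauge_variation (x + y) _ b (c.map_fil n hh (g - a) hR)
      have h4 := c.map_fil (n + 1) hh' _ hdr
      convert add_mem h3 h4 using 1
      rw [add_assoc, ← add_assoc x y, h1]
      abel)
    (fun n y _ z _ hR hz => by
      have := add_mem (gauge_sub_mem (x + y) _ b hz) hR
      convert this using 1
      rw [show x + y + (z - y) = x + z by abel]; abel)
  exact ⟨x + y, isPath_iff.2 (eq_of_sub_mem hR).symm, by
    rw [map_add, LinearMap.mem_ker.1 hy, add_zero]⟩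

/-- A contractible morphism with a section is a weak equivalence. -/
lemma isWeakEquiv (c : Contraction p) (s : Hom L C) (hs : p.comp s = Hom.id L) : p.IsWeakEquiv := by
  have hs' : ∀ k x, p.app k (s.app k x) = x := fun k x => Hom.congr_app hs k x
  have hp : p.IsFibration := fun k x => ⟨s.app k x, hs' k x⟩
  refine ⟨fun a b ha hb ⟨x, hx⟩ => ?_, fun b hb => ⟨s.app _ b, isMC_map s hb, 0, ?_⟩,
    c.isQuasiIsoAt hp⟩
  · obtain ⟨y, hy, -⟩ := c.exists_isPath hp ha hb hx
    exact ⟨y, hy⟩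
  · rw [hs', isPath_iff, gauge_zero]

end Contraction

end CDGL

/-! ### Subalgebras, products and forms in one variable -/

namespace CGL

lemma IsClosedSubalgebra.fil_le {L : CGL.{u}} {P : ∀ k, Submodule ℚ (L k)}
    (hP : L.IsClosedSubalgebra P) {k : ℤ} (x : ℕ → P k)
    (hx : ∀ n, ((x (n + 1) : L k) - x n) ∈ L.fil n k) : ∃ y : P k, ∀ n, (y : L k) - x n ∈ L.fil n k := by
  obtain ⟨y, hy⟩ := L.complete (fun n => (x n : L k)) hx
  exact ⟨⟨y, hP.closed y fun n => ⟨x n, (x n).2, hy n⟩⟩, hy⟩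

/-- A closed graded Lie subalgebra as a complete graded Lie algebra. -/
def sub (L : CGL.{u}) (P : ∀ k, Submodule ℚ (L k)) (hP : L.IsClosedSubalgebra P) : CGL.{u} where
  obj k := P k
  bracket h := LinearMap.mk₂ ℚ
    (fun x y => ⟨L.bracket h x y, hP.bracket_mem h _ _ x.2 y.2⟩)
    (by intros; ext; simp) (by intros; ext; simp) (by intros; ext; simp) (by intros; ext; simp)
  skew h h' x y := Subtype.ext (L.skew h h' _ _)
  jacobi hij hjk hik h₁ h₂ h₃ x y z := Subtype.ext (L.jacobi hij hjk hik h₁ h₂ h₃ _ _ _)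
  fil n k := (L.fil n k).comap (P k).subtype
  fil_one k := by rw [L.fil_one]; rfl
  fil_anti h k := Submodule.comap_mono (L.fil_anti h k)
  fil_bracket h x y hx hy := L.fil_bracket h _ _ hx hy
  separated x h := Subtype.ext (L.separated _ h)
  complete x h := hP.fil_le x h

/-- The product of two complete graded Lie algebras. -/
def prod (L M : CGL.{u}) : CGL.{u} where
  obj k := L k × M k
  bracket h := LinearMap.mk₂ ℚ (fun x y => (L.bracket h x.1 y.1, M.bracket h x.2 y.2))
    (by intros; ext <;> simp) (by intros; ext <;> simp) (by intros; ext <;> simp)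
    (by intros; ext <;> simp)
  skew h h' x y := Prod.ext (L.skew h h' _ _) (M.skew h h' _ _)
  jacobi hij hjk hik h₁ h₂ h₃ x y z :=
    Prod.ext (L.jacobi hij hjk hik h₁ h₂ h₃ _ _ _) (M.jacobi hij hjk hik h₁ h₂ h₃ _ _ _)
  fil n k := (L.fil n k).prod (M.fil n k)
  fil_one k := by rw [L.fil_one, M.fil_one, Submodule.prod_top]
  fil_anti h k := Submodule.prod_mono (L.fil_anti h k) (M.fil_anti h _)
  fil_bracket h x y hx hy := ⟨L.fil_bracket h _ _ hx.1 hy.1, M.fil_bracket h _ _ hx.2 hy.2⟩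
  separated x h := Prod.ext (L.separated _ fun n => (h n).1) (M.separated _ fun n => (h n).2)
  complete x h := by
    obtain ⟨y, hy⟩ := L.complete (fun n => (x n).1) fun n => (h n).1
    obtain ⟨z, hz⟩ := M.complete (fun n => (x n).2) fun n => (h n).2
    exact ⟨(y, z), fun n => ⟨hy n, hz n⟩⟩

/-- Formal power series `∑ₙ xₙ tⁿ` with coefficients in `L`. -/
def seq (L : CGL.{u}) : CGL.{u} where
  obj k := ℕ → L k
  bracket h := LinearMap.mk₂ ℚ
    (fun f g n => ∑ p ∈ Finset.HasAntidiagonal.antidiagonal n, L.bracket h (f p.1) (g p.2))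
    (by intros; ext n; simp [Finset.sum_add_distrib])
    (by intros; ext n; simp [Finset.smul_sum])
    (by intros; ext n; simp [Finset.sum_add_distrib])
    (by intros; ext n; simp [Finset.smul_sum])
  skew {i j k} h h' f g := by
    ext n
    simp only [LinearMap.mk₂_apply, Pi.smul_apply, Finset.smul_sum]
    rw [← Finset.Nat.sum_antidiagonal_swap]
    exact Finset.sum_congr rfl fun p _ => L.skew h h' _ _
  jacobi {i j k ij jk ik n'} hij hjk hik h₁ h₂ h₃ f g w := by
    ext n
    simp only [LinearMap.mk₂_apply, Pi.smul_apply, Finset.smul_sum, Pi.add_apply, map_sum,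
      LinearMap.sum_apply]
    rw [FL.sum_anti₂ n.lt_succ_self fun p q r => L.bracket h₁ (f p) (L.bracket hjk (g q) (w r)),
      FL.sum_anti₂ n.lt_succ_self fun q p r =>
        ((-1 : ℚ) ^ (i * j)) • L.bracket h₃ (g q) (L.bracket hik (f p) (w r)),
      ← Finset.Nat.sum_antidiagonal_swap]
    simp only [Prod.fst_swap, Prod.snd_swap]
    rw [FL.sum_anti₂ n.lt_succ_self fun r p q => L.bracket h₂ (L.bracket hij (f p) (g q)) (w r)]
    have e1 : ∀ F : ℕ → ℕ → ℕ → L n', (∑ r ∈ Finset.range n.succ, ∑ p ∈ Finset.range n.succ,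
        ∑ q ∈ Finset.range n.succ, F r p q) = ∑ p ∈ Finset.range n.succ, ∑ q ∈ Finset.range n.succ,
        ∑ r ∈ Finset.range n.succ, F r p q := by
      intro F
      rw [Finset.sum_comm]
      exact Finset.sum_congr rfl fun p _ => Finset.sum_comm
    rw [e1 (fun r p q => if r + p + q = n then L.bracket h₂ (L.bracket hij (f p) (g q)) (w r) else 0),
      Finset.sum_comm (f := fun q p => ∑ r ∈ Finset.range n.succ, if q + p + r = n then
        ((-1 : ℚ) ^ (i * j)) • L.bracket h₃ (g q) (L.bracket hik (f p) (w r)) else 0),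
      ← Finset.sum_add_distrib]
    refine Finset.sum_congr rfl fun p _ => ?_
    rw [← Finset.sum_add_distrib]
    refine Finset.sum_congr rfl fun q _ => ?_
    rw [← Finset.sum_add_distrib]
    refine Finset.sum_congr rfl fun r _ => ?_
    rw [show r + p + q = p + q + r by omega, show q + p + r = p + q + r by omega]
    split_ifs
    · exact L.jacobi hij hjk hik h₁ h₂ h₃ _ _ _
    · simp
  fil n k := Submodule.pi Set.univ fun _ => L.fil n k
  fil_one k := by
    simp only [L.fil_one]
    exact eq_top_iff.2 fun _ _ _ _ => trivial
  fil_anti h k f hf m _ := L.fil_anti h k (hf m trivial)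
  fil_bracket h f g hf hg m _ := by
    simp only [LinearMap.mk₂_apply]
    exact Submodule.sum_mem _ fun p _ => L.fil_bracket h _ _ (hf p.1 trivial) (hg p.2 trivial)
  separated f h := funext fun m => L.separated _ fun n => h n m trivial
  complete {k} x h := by
    choose y hy using fun m => L.complete (fun n => x n m) fun n => h n m trivial
    exact ⟨y, fun n m _ => hy m n⟩

namespace seq

variable {L : CGL.{u}}

/-- The series with given coefficients. -/
def mk {k : ℤ} (f : ℕ → L k) : L.seq k := f

/-- The coefficients of a series. -/
def coeff (n : ℕ) {k : ℤ} : L.seq k →ₗ[ℚ] L k := LinearMap.proj (φ := fun _ : ℕ => L k) n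

@[simp] lemma coeff_mk {k : ℤ} (f : ℕ → L k) (n : ℕ) : coeff n (mk f) = f n := rfl

@[ext] lemma ext {k : ℤ} {f g : L.seq k} (h : ∀ n, coeff n f = coeff n g) : f = g := funext h

lemma coeff_bracket {i j k : ℤ} (h : i + j = k) (f : L.seq i) (g : L.seq j)
    (n : ℕ) : coeff n (L.seq.bracket h f g) =
      ∑ p ∈ Finset.HasAntidiagonal.antidiagonal n, L.bracket h (coeff p.1 f) (coeff p.2 g) := rfl

lemma mem_fil {k : ℤ} {n : ℕ} {f : L.seq k} :
    f ∈ L.seq.fil n k ↔ ∀ m, coeff m f ∈ L.fil n k :=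
  ⟨fun h m => h m trivial, fun h m _ => h m⟩

end seq

/-- A derivation of `L`, acting on the coefficients of power series. -/
def Der.seq {L : CGL.{u}} {r : ℤ} (D : Der L r) : Der L.seq r where
  app {i j} h :=
    { toFun := fun x => seq.mk fun n => D.app h (seq.coeff n x)
      map_add' := fun x y => seq.ext fun n => by simp
      map_smul' := fun c x => seq.ext fun n => by simp }
  leibniz {i j k i' j' k'} h hi hj hk h₁ h₂ x y := by
    ext n
    simp only [LinearMap.coe_mk, AddHom.coe_mk, map_add, map_smul, seq.coeff_mk, seq.coeff_bracket,
      map_sum, Finset.smul_sum]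
    rw [← Finset.sum_add_distrib]
    exact Finset.sum_congr rfl fun p _ => D.leibniz h hi hj hk h₁ h₂ _ _
  map_fil n i j h x hx := seq.mem_fil.2 fun m => D.map_fil n h _ (seq.mem_fil.1 hx m)

/-- The derivative with respect to `t`. -/
def seqDeriv (L : CGL.{u}) : Der L.seq 0 where
  app {i j} h :=
    { toFun := fun x => seq.mk fun n =>
        ((n : ℚ) + 1) • L.castDeg (show i = j by omega) (seq.coeff (n + 1) x)
      map_add' := fun x y => seq.ext fun n => by simp
      map_smul' := fun c x => seq.ext fun n => by simp [smul_comm c] }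
  leibniz {i j k i' j' k'} h hi hj hk h₁ h₂ x y := by
    obtain rfl : i = i' := by omega
    obtain rfl : j = j' := by omega
    obtain rfl : k = k' := by omega
    ext n
    simp only [LinearMap.coe_mk, AddHom.coe_mk, map_add, map_smul, seq.coeff_mk, seq.coeff_bracket,
      castDeg_rfl, Finset.smul_sum, zero_mul, zpow_zero, one_smul, LinearMap.smul_apply]
    -- On the antidiagonal the factor `n + 1` is `p.1 + p.2`, which distributes the derivative over
    -- both factors.
    have e1 : ∑ p ∈ Finset.HasAntidiagonal.antidiagonal (n + 1),
        ((n : ℚ) + 1) • L.bracket h (seq.coeff p.1 x) (seq.coeff p.2 y) =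
        ∑ p ∈ Finset.HasAntidiagonal.antidiagonal (n + 1),
          (p.1 : ℚ) • L.bracket h (seq.coeff p.1 x) (seq.coeff p.2 y) +
        ∑ p ∈ Finset.HasAntidiagonal.antidiagonal (n + 1),
          (p.2 : ℚ) • L.bracket h (seq.coeff p.1 x) (seq.coeff p.2 y) := by
      rw [← Finset.sum_add_distrib]
      refine Finset.sum_congr rfl fun p hp => ?_
      rw [← add_smul]
      congr 1
      have := Finset.HasAntidiagonal.mem_antidiagonal.1 hp
      exact_mod_cast this.symm
    rw [e1, Finset.Nat.sum_antidiagonal_succ, Finset.Nat.sum_antidiagonal_succ']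
    simp
  map_fil n i j h x hx := by
    obtain rfl : i = j := by omega
    exact seq.mem_fil.2 fun m => Submodule.smul_mem _ _ (seq.mem_fil.1 hx (m + 1))

lemma coeff_seqDeriv (L : CGL.{u}) {i j : ℤ} (h : i + 0 = j) (x : L.seq i) (n : ℕ) :
    seq.coeff n (L.seqDeriv.app h x) =
      ((n : ℚ) + 1) • L.castDeg (show i = j by omega) (seq.coeff (n + 1) x) := rfl

/-- The differential `d(x + ε y) = dx + ε (∂x - dy)` of `L ⊕ ε L`, with `ε` of degree `-1`. -/
def dualDifferential {L : CGL.{u}} (δ : Differential L) (D : Der L 0)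
    (hD : ∀ {i j i' j' : ℤ} (h : i + -1 = j) (hi : i + 0 = i') (hj : j + 0 = j')
      (h' : i' + -1 = j') (x : L i), D.app hj (δ.app h x) = δ.app h' (D.app hi x)) :
    Differential (L.dual 1) where
  app {i j} h := ((δ.app h).comp (LinearMap.fst ℚ _ _)).prod
    ((D.app (show i + 0 = j + 1 by omega)).comp (LinearMap.fst ℚ _ _) -
      (δ.app (show i + 1 + -1 = j + 1 by omega)).comp (LinearMap.snd ℚ _ _))
  leibniz {i j k i' j' k'} h hi hj hk h₁ h₂ x y := by
    refine Prod.ext (δ.leibniz h hi hj hk h₁ h₂ _ _) ?_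
    change D.app (show k + 0 = k' + 1 by omega) (L.bracket h x.1 y.1) -
        δ.app (show k + 1 + -1 = k' + 1 by omega)
          (L.bracket (show i + 1 + j = k + 1 by omega) x.2 y.1 +
            ((-1 : ℚ) ^ (1 * i)) • L.bracket (show i + (j + 1) = k + 1 by omega) x.1 y.2) =
      (L.bracket (show i' + 1 + j = k' + 1 by omega)
        (D.app (show i + 0 = i' + 1 by omega) x.1 - δ.app (show i + 1 + -1 = i' + 1 by omega) x.2)
          y.1 + ((-1 : ℚ) ^ (1 * i')) • L.bracket (show i' + (j + 1) = k' + 1 by omega)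
            (δ.app hi x.1) y.2) +
      ((-1 : ℚ) ^ (-1 * i)) • (L.bracket (show i + 1 + j' = k' + 1 by omega) x.2 (δ.app hj y.1) +
        ((-1 : ℚ) ^ (1 * i)) • L.bracket (show i + (j' + 1) = k' + 1 by omega) x.1
          (D.app (show j + 0 = j' + 1 by omega) y.1 - δ.app (show j + 1 + -1 = j' + 1 by omega) y.2))
    rw [D.leibniz h (show i + 0 = i' + 1 by omega) (show j + 0 = j' + 1 by omega) _
      (show i' + 1 + j = k' + 1 by omega) (show i + (j' + 1) = k' + 1 by omega), map_add, map_smul,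
      δ.leibniz (show i + 1 + j = k + 1 by omega) (show i + 1 + -1 = i' + 1 by omega) hj _
        (show i' + 1 + j = k' + 1 by omega) (show i + 1 + j' = k' + 1 by omega),
      δ.leibniz (show i + (j + 1) = k + 1 by omega) hi (show j + 1 + -1 = j' + 1 by omega) _
        (show i' + (j + 1) = k' + 1 by omega) (show i + (j' + 1) = k' + 1 by omega)]
    have s1 : ((-1 : ℚ) ^ (1 * i)) = (-1 : ℚ) ^ i := by rw [one_mul]
    have s2 : ((-1 : ℚ) ^ (-1 * i)) = (-1 : ℚ) ^ i := by
      rw [neg_one_mul, zpow_neg, inv_eq_of_mul_eq_one_left (sgn_sq i)]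
    have s3 : ((-1 : ℚ) ^ (1 * i')) = -(-1 : ℚ) ^ i := by
      rw [one_mul, ← hi, sgn_add]; norm_num
    have s4 : ((-1 : ℚ) ^ (-1 * (i + 1))) = -(-1 : ℚ) ^ i := by
      rw [mul_add, sgn_add, s2]; norm_num
    have s5 : ((-1 : ℚ) ^ (0 * i)) = 1 := by simp
    rw [s1, s2, s3, s4, s5]
    simp only [map_sub, LinearMap.sub_apply, smul_add, smul_sub, smul_smul, neg_smul, sgn_sq, one_smul]
    abel
  map_fil n i j h x hx := ⟨δ.map_fil n h _ hx.1,
    sub_mem (D.map_fil n _ _ hx.1) (δ.map_fil n _ _ hx.2)⟩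
  sq_zero {i j k} h h' x := by
    refine Prod.ext (δ.sq_zero h h' _) ?_
    change D.app (show j + 0 = k + 1 by omega) (δ.app h x.1) -
      δ.app (show j + 1 + -1 = k + 1 by omega) (D.app (show i + 0 = j + 1 by omega) x.1 -
        δ.app (show i + 1 + -1 = j + 1 by omega) x.2) = 0
    rw [map_sub, δ.sq_zero, sub_zero, hD h (show i + 0 = j + 1 by omega) _
      (show j + 1 + -1 = k + 1 by omega), sub_self]

end CGL

namespace CDGL

/-- A closed differential graded Lie subalgebra. -/
def sub (L : CDGL.{u}) (P : ∀ k, Submodule ℚ (L k)) (hP : L.lie.IsClosedSubalgebra P)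
    (hd : ∀ {i j : ℤ} (h : i + -1 = j), ∀ x ∈ P i, L.diff.app h x ∈ P j) : CDGL.{u} where
  lie := L.lie.sub P hP
  diff :=
    { app := fun h => (L.diff.app h).restrict (hd h)
      leibniz := fun h hi hj hk h₁ h₂ _ _ => Subtype.ext (L.diff.leibniz h hi hj hk h₁ h₂ _ _)
      map_fil := fun n _ _ h _ hx => L.diff.map_fil n h _ hx
      sq_zero := fun h₁ h₂ _ => Subtype.ext (L.diff.sq_zero h₁ h₂ _) }

/-- The product. -/
def prod (L M : CDGL.{u}) : CDGL.{u} where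
  lie := L.lie.prod M.lie
  diff :=
    { app := fun h => (L.diff.app h).prodMap (M.diff.app h)
      leibniz := fun h hi hj hk h₁ h₂ _ _ => Prod.ext (L.diff.leibniz h hi hj hk h₁ h₂ _ _)
        (M.diff.leibniz h hi hj hk h₁ h₂ _ _)
      map_fil := fun n _ _ h _ hx => ⟨L.diff.map_fil n h _ hx.1, M.diff.map_fil n h _ hx.2⟩
      sq_zero := fun h₁ h₂ _ => Prod.ext (L.diff.sq_zero h₁ h₂ _) (M.diff.sq_zero h₁ h₂ _) }

/-- The algebra of forms `x(t) + dt y(t)` with formal power series `x`, `y` over `A`. -/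
def forms (A : CDGL.{u}) : CDGL.{u} where
  lie := A.lie.seq.dual 1
  diff := CGL.dualDifferential
    { toDer := A.diff.seq
      sq_zero := fun h h' _ => CGL.seq.ext fun _ => A.diff.sq_zero h h' _ } A.lie.seqDeriv (by
        intro i j i' j' h hi hj h' x
        obtain rfl : i = i' := by omega
        obtain rfl : j = j' := by omega
        ext n
        exact (map_smul (A.diff.app h') ((n : ℚ) + 1) (CGL.seq.coeff (n + 1) x)).symm)

end CDGL

/-! ### The path object of `A` over `B` -/

namespace CDGL

namespace forms

variable {A : CDGL.{u}}

/-- The part of a form without `dt`. -/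
def fst {k : ℤ} : A.forms k →ₗ[ℚ] A.lie.seq k := LinearMap.fst ℚ (A.lie.seq k) (A.lie.seq (k + 1))

/-- The coefficient of `dt`. -/
def snd {k : ℤ} : A.forms k →ₗ[ℚ] A.lie.seq (k + 1) :=
  LinearMap.snd ℚ (A.lie.seq k) (A.lie.seq (k + 1))

/-- The form `x + dt y`. -/
def mk {k : ℤ} (x : A.lie.seq k) (y : A.lie.seq (k + 1)) : A.forms k := (x, y)

lemma ext {k : ℤ} {x y : A.forms k} (h₁ : fst x = fst y) (h₂ : snd x = snd y) : x = y :=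
  Prod.ext h₁ h₂

lemma fst_bracket {i j k : ℤ} (h : i + j = k) (x : A.forms i) (y : A.forms j) :
    fst (A.forms.lie.bracket h x y) = A.lie.seq.bracket h (fst x) (fst y) := rfl

lemma snd_bracket {i j k : ℤ} (h : i + j = k) (x : A.forms i) (y : A.forms j) :
    snd (A.forms.lie.bracket h x y) =
      A.lie.seq.bracket (show i + 1 + j = k + 1 by omega) (snd x) (fst y) +
        ((-1 : ℚ) ^ (1 * i)) • A.lie.seq.bracket (show i + (j + 1) = k + 1 by omega)
          (fst x) (snd y) := rfl

lemma fst_diff {i j : ℤ} (h : i + -1 = j) (x : A.forms i) (n : ℕ) :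
    seq.coeff n (fst (A.forms.diff.app h x)) = A.diff.app h (seq.coeff n (fst x)) := rfl

lemma snd_diff {i j : ℤ} (h : i + -1 = j) (x : A.forms i) (n : ℕ) :
    seq.coeff n (snd (A.forms.diff.app h x)) =
      ((n : ℚ) + 1) • A.lie.castDeg (show i = j + 1 by omega) (seq.coeff (n + 1) (fst x)) -
        A.diff.app (show i + 1 + -1 = j + 1 by omega) (seq.coeff n (snd x)) := rfl

lemma mem_fil {k : ℤ} {n : ℕ} {x : A.forms k} : x ∈ A.forms.lie.fil n k ↔
    (∀ m, seq.coeff m (fst x) ∈ A.lie.fil n k) ∧ ∀ m, seq.coeff m (snd x) ∈ A.lie.fil n (k + 1) :=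
  and_congr seq.mem_fil seq.mem_fil

end forms

open forms

variable {A B : CDGL.{u}} (q : Hom A B)

/-- The forms `∑ xₙ tⁿ + dt ∑ yₙ tⁿ` with `xₙ ∈ Fⁿ` and `yₙ ∈ Fⁿ⁺¹` that become constant in `B`. -/
def pathSub (k : ℤ) : Submodule ℚ (A.forms k) where
  carrier := {x | (∀ n, seq.coeff n (fst x) ∈ A.lie.fil n k) ∧
    (∀ n, q.app _ (seq.coeff (n + 1) (fst x)) = 0) ∧
    (∀ n, seq.coeff n (snd x) ∈ A.lie.fil (n + 1) (k + 1)) ∧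
    ∀ n, q.app _ (seq.coeff n (snd x)) = 0}
  add_mem' {x y} hx hy := ⟨fun n => by rw [map_add, map_add]; exact add_mem (hx.1 n) (hy.1 n),
    fun n => by rw [map_add, map_add, map_add, hx.2.1, hy.2.1, add_zero],
    fun n => by rw [map_add, map_add]; exact add_mem (hx.2.2.1 n) (hy.2.2.1 n),
    fun n => by rw [map_add, map_add, map_add, hx.2.2.2, hy.2.2.2, add_zero]⟩
  zero_mem' := ⟨fun n => by rw [map_zero, map_zero]; exact zero_mem _,
    fun n => by rw [map_zero, map_zero, map_zero],
    fun n => by rw [map_zero, map_zero]; exact zero_mem _,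
    fun n => by rw [map_zero, map_zero, map_zero]⟩
  smul_mem' c x hx := ⟨fun n => by rw [map_smul, map_smul]; exact Submodule.smul_mem _ _ (hx.1 n),
    fun n => by rw [map_smul, map_smul, map_smul, hx.2.1, smul_zero],
    fun n => by rw [map_smul, map_smul]; exact Submodule.smul_mem _ _ (hx.2.2.1 n),
    fun n => by rw [map_smul, map_smul, map_smul, hx.2.2.2, smul_zero]⟩

lemma castDeg_mem {i j : ℤ} (h : i = j) {n : ℕ} {x : A i} (hx : x ∈ A.lie.fil n i) :
    A.lie.castDeg h x ∈ A.lie.fil n j := by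
  subst h; exact hx

lemma app_castDeg {L M : CGL.{u}} (f : CGL.Hom L M) {i j : ℤ} (h : i = j) (x : L i) :
    f.app j (L.castDeg h x) = M.castDeg h (f.app i x) := by
  subst h; rfl

/-- The bounds `Fⁿ` for `tⁿ` and `Fⁿ⁺¹` for `tⁿ dt` are multiplicative. Every product that
contributes to a nonconstant coefficient has a factor that dies in `B`. -/
lemma pathSub_closed : A.forms.lie.IsClosedSubalgebra (pathSub q) where
  bracket_mem {i j k} h x y hx hy := by
    refine ⟨fun n => ?_, fun n => ?_, fun n => ?_, fun n => ?_⟩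
    · rw [fst_bracket, seq.coeff_bracket]
      refine Submodule.sum_mem _ fun p hp => ?_
      rw [← Finset.HasAntidiagonal.mem_antidiagonal.1 hp]
      exact A.lie.fil_bracket h _ _ (hx.1 _) (hy.1 _)
    · rw [fst_bracket, seq.coeff_bracket, map_sum]
      refine Finset.sum_eq_zero fun p hp => ?_
      rw [q.map_bracket]
      obtain ⟨p₁, p₂⟩ := p
      have := Finset.HasAntidiagonal.mem_antidiagonal.1 hp
      rcases p₁ with _ | p₁
      · obtain rfl : p₂ = n + 1 := by simpa using this
        rw [hy.2.1, map_zero]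
      · rw [hx.2.1, map_zero, LinearMap.zero_apply]
    · rw [snd_bracket, map_add, map_smul, seq.coeff_bracket, seq.coeff_bracket]
      refine add_mem (Submodule.sum_mem _ fun p hp => ?_)
        (Submodule.smul_mem _ _ (Submodule.sum_mem _ fun p hp => ?_))
      all_goals rw [← Finset.HasAntidiagonal.mem_antidiagonal.1 hp]
      · rw [add_right_comm]
        exact A.lie.fil_bracket _ _ _ (hx.2.2.1 _) (hy.1 _)
      · rw [add_assoc]
        exact A.lie.fil_bracket _ _ _ (hx.1 _) (hy.2.2.1 _)
    · rw [snd_bracket, map_add, map_smul, seq.coeff_bracket, seq.coeff_bracket, map_add, map_smul,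
        map_sum, map_sum, Finset.sum_eq_zero, Finset.sum_eq_zero, smul_zero, add_zero]
      · intro p _; rw [q.map_bracket, hy.2.2.2, map_zero]
      · intro p _; rw [q.map_bracket, hx.2.2.2, map_zero, LinearMap.zero_apply]
  closed {k} x hx := by
    refine ⟨fun n => ?_, fun n => ?_, fun n => ?_, fun n => ?_⟩
    · obtain ⟨y, hy, hxy⟩ := hx n
      have := (mem_fil.1 hxy).1 n
      rw [map_sub, map_sub] at this
      exact mem_of_sub_mem this (hy.1 n)
    · refine LinearMap.mem_ker.1 (q.ker_closed _ fun m => ?_)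
      obtain ⟨y, hy, hxy⟩ := hx m
      have := (mem_fil.1 hxy).1 (n + 1)
      rw [map_sub, map_sub] at this
      exact ⟨_, hy.2.1 n, this⟩
    · obtain ⟨y, hy, hxy⟩ := hx (n + 1)
      have := (mem_fil.1 hxy).2 n
      rw [map_sub, map_sub] at this
      exact mem_of_sub_mem this (hy.2.2.1 n)
    · refine LinearMap.mem_ker.1 (q.ker_closed _ fun m => ?_)
      obtain ⟨y, hy, hxy⟩ := hx m
      have := (mem_fil.1 hxy).2 n
      rw [map_sub, map_sub] at this
      exact ⟨_, hy.2.2.2 n, this⟩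

/-- Differentiation moves the coefficient of `tⁿ⁺¹` to `tⁿ dt`. This is where the shifted bound
`Fⁿ⁺¹` on the coefficients of `tⁿ dt` fits; integration uses the same shift backwards. -/
lemma pathSub_diff {i j : ℤ} (h : i + -1 = j) (x : A.forms i) (hx : x ∈ pathSub q i) :
    A.forms.diff.app h x ∈ pathSub q j := by
  refine ⟨fun n => ?_, fun n => ?_, fun n => ?_, fun n => ?_⟩
  · rw [fst_diff]; exact A.diff.map_fil n h _ (hx.1 n)
  · rw [fst_diff, q.comm, hx.2.1, map_zero]
  · rw [snd_diff]
    exact sub_mem (Submodule.smul_mem _ _ (castDeg_mem _ (hx.1 (n + 1))))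
      (A.diff.map_fil _ _ _ (hx.2.2.1 n))
  · rw [snd_diff, map_sub, map_smul, app_castDeg, hx.2.1, q.comm, hx.2.2.2]
    simp

/-- The path object of `A` over `B`. -/
def pathObj : CDGL.{u} := A.forms.sub (pathSub q) (pathSub_closed q) (pathSub_diff q)

namespace pathObj

variable {q}

/-- The coefficient of `tⁿ`. -/
def cf (n : ℕ) {k : ℤ} : pathObj q k →ₗ[ℚ] A k :=
  (seq.coeff n).comp (fst.comp (pathSub q k).subtype)

/-- The coefficient of `tⁿ dt`. -/
def cdt (n : ℕ) {k : ℤ} : pathObj q k →ₗ[ℚ] A (k + 1) :=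
  (seq.coeff n).comp (snd.comp (pathSub q k).subtype)

lemma cf_mem {k : ℤ} (x : pathObj q k) (n : ℕ) : cf n x ∈ A.lie.fil n k := x.2.1 n
lemma cdt_mem {k : ℤ} (x : pathObj q k) (n : ℕ) : cdt n x ∈ A.lie.fil (n + 1) (k + 1) := x.2.2.2.1 n
lemma map_cf {k : ℤ} (x : pathObj q k) (n : ℕ) : q.app k (cf (n + 1) x) = 0 := x.2.2.1 n
lemma map_cdt {k : ℤ} (x : pathObj q k) (n : ℕ) : q.app (k + 1) (cdt n x) = 0 := x.2.2.2.2 n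

/-- The form with given coefficients. -/
def mk {k : ℤ} (x : ℕ → A k) (y : ℕ → A (k + 1)) (h₁ : ∀ n, x n ∈ A.lie.fil n k)
    (h₂ : ∀ n, q.app k (x (n + 1)) = 0) (h₃ : ∀ n, y n ∈ A.lie.fil (n + 1) (k + 1))
    (h₄ : ∀ n, q.app (k + 1) (y n) = 0) : pathObj q k :=
  ⟨forms.mk (seq.mk x) (seq.mk y), h₁, h₂, h₃, h₄⟩

@[simp] lemma cf_mk {k : ℤ} (x : ℕ → A k) (y : ℕ → A (k + 1)) (h₁ h₂ h₃ h₄) (n : ℕ) :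
    cf n (mk (q := q) x y h₁ h₂ h₃ h₄) = x n := rfl

@[simp] lemma cdt_mk {k : ℤ} (x : ℕ → A k) (y : ℕ → A (k + 1)) (h₁ h₂ h₃ h₄) (n : ℕ) :
    cdt n (mk (q := q) x y h₁ h₂ h₃ h₄) = y n := rfl

lemma ext {k : ℤ} {x y : pathObj q k} (h₁ : ∀ n, cf n x = cf n y) (h₂ : ∀ n, cdt n x = cdt n y) :
    x = y := Subtype.ext (forms.ext (seq.ext h₁) (seq.ext h₂))

lemma mem_fil {k : ℤ} {n : ℕ} {x : pathObj q k} : x ∈ (pathObj q).lie.fil n k ↔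
    (∀ m, cf m x ∈ A.lie.fil n k) ∧ ∀ m, cdt m x ∈ A.lie.fil n (k + 1) := forms.mem_fil

lemma cf_bracket {i j k : ℤ} (h : i + j = k) (x : pathObj q i) (y : pathObj q j) (n : ℕ) :
    cf n ((pathObj q).lie.bracket h x y) = ∑ p ∈ Finset.HasAntidiagonal.antidiagonal n,
      A.lie.bracket h (cf p.1 x) (cf p.2 y) := rfl

lemma cf_diff {i j : ℤ} (h : i + -1 = j) (x : pathObj q i) (n : ℕ) :
    cf n ((pathObj q).diff.app h x) = A.diff.app h (cf n x) := rfl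

lemma cdt_diff {i j : ℤ} (h : i + -1 = j) (x : pathObj q i) (n : ℕ) :
    cdt n ((pathObj q).diff.app h x) =
      ((n : ℚ) + 1) • A.lie.castDeg (show i = j + 1 by omega) (cf (n + 1) x) -
        A.diff.app (show i + 1 + -1 = j + 1 by omega) (cdt n x) := rfl

/-- Evaluation at `t = 0`. -/
def ev₀ : Hom (pathObj q) A where
  app _ := cf 0
  map_bracket h x y := by rw [cf_bracket]; simp
  map_fil _ _ _ hx := (mem_fil.1 hx).1 0
  comm _ _ := rfl

lemma ev₀_app {k : ℤ} (x : pathObj q k) : ev₀.app k x = cf 0 x := rfl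

lemma cf_isSum {k : ℤ} (x : pathObj q k) :
    A.lie.IsSum (fun n => cf n x) (A.lie.sum fun n => cf n x) :=
  sum_spec (exists_isSum_of_mem (cf_mem x))

/-- Evaluation at `t = 1`. -/
noncomputable def ev₁ : Hom (pathObj q) A where
  app k :=
    { toFun := fun x => A.lie.sum fun n => cf n x
      map_add' := fun x y => IsSum.unique (cf_isSum (x + y)) (by
        simp only [map_add]; exact (cf_isSum x).add (cf_isSum y))
      map_smul' := fun c x => IsSum.unique (cf_isSum (c • x)) (by
        simp only [map_smul]
        exact (cf_isSum x).map (c • LinearMap.id) fun n y hy => Submodule.smul_mem _ _ hy) }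
  map_bracket h x y := IsSum.unique (cf_isSum _) ((cf_isSum x).bracket h (cf_isSum y))
  map_fil n k x hx := (cf_isSum x).mem (mem_fil.1 hx).1
  comm h x := IsSum.unique (cf_isSum ((pathObj q).diff.app h x))
    ((cf_isSum x).map (A.diff.app h) fun n y hy => A.diff.map_fil n h y hy)

lemma ev₁_isSum {k : ℤ} (x : pathObj q k) : A.lie.IsSum (fun n => cf n x) (ev₁.app k x) :=
  cf_isSum x

/-- All nonconstant coefficients vanish in `B`, so only the value at `t = 0` is left. -/
lemma map_ev₁ {k : ℤ} (x : pathObj q k) : q.app k (ev₁.app k x) = q.app k (ev₀.app k x) := by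
  refine IsSum.unique ((ev₁_isSum x).map (q.app k) fun n y hy => q.map_fil n y hy) ?_
  have := isSum_of_eventually_zero (L := B.lie) (x := fun n => q.app k (cf n x)) 1 fun n hn => by
    obtain ⟨n, rfl⟩ : ∃ m, n = m + 1 := ⟨n - 1, by omega⟩
    exact map_cf x n
  simpa [ev₀_app] using this

/-- The form `x + t y`. -/
def line {k : ℤ} (x y : A k) (hy : q.app k y = 0) : pathObj q k :=
  mk (fun n => if n = 0 then x else if n = 1 then y else 0) (fun _ => 0)
    (fun n => by
      split_ifs with h h'
      · subst h; exact mem_fil_zero _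
      -- The coefficient of `t` only has to lie in `F¹`, which is everything; so lines through
      -- arbitrary points are admissible.
      · subst h'; exact mem_fil_one _
      · exact zero_mem _)
    (fun n => by
      rw [if_neg (by omega)]
      split_ifs
      · exact hy
      · exact map_zero _)
    (fun _ => zero_mem _) (fun _ => map_zero _)

@[simp] lemma ev₀_line {k : ℤ} (x y : A k) (hy : q.app k y = 0) : ev₀.app k (line x y hy) = x := rfl

@[simp] lemma ev₁_line {k : ℤ} (x y : A k) (hy : q.app k y = 0) :
    ev₁.app k (line x y hy) = x + y := by
  refine IsSum.unique (ev₁_isSum _) ?_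
  have := isSum_of_eventually_zero (L := A.lie) (x := fun n => cf n (line x y hy)) 2 fun n hn => by
    rw [line, cf_mk, if_neg (by omega), if_neg (by omega)]
  simpa [Finset.sum_range_succ, line] using this

lemma ev₀_fibration : (ev₀ : Hom (pathObj q) A).IsFibration := fun _ x =>
  ⟨line x 0 (map_zero _), rfl⟩

/-- The constant forms. -/
def const : Hom A (pathObj q) where
  app k :=
    { toFun := fun x => line x 0 (map_zero _)
      map_add' := fun x y => ext (fun n => by
        simp only [line, cf_mk, map_add]; split_ifs <;> simp) fun n => by simp [line]
      map_smul' := fun c x => ext (fun n => by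
        simp only [line, cf_mk, map_smul]; split_ifs <;> simp) fun n => by simp [line] }
  map_bracket {i j k} h x y := by
    refine ext (fun n => ?_) fun n => ?_
    · change cf n (line _ 0 (map_zero _)) =
        cf n ((pathObj q).lie.bracket h (line x 0 (map_zero _)) (line y 0 (map_zero _)))
      rw [cf_bracket]
      simp only [line, cf_mk, ite_self]
      rcases n with _ | n
      · simp
      · rw [if_neg (by omega), Finset.sum_eq_zero]
        rintro ⟨p₁, p₂⟩ hp
        have := Finset.HasAntidiagonal.mem_antidiagonal.1 hp
        simp only at this
        rcases p₁ with _ | p₁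
        · rw [if_neg (show ¬ p₂ = 0 by omega), map_zero]
        · rw [if_neg (show ¬ p₁ + 1 = 0 by omega), map_zero, LinearMap.zero_apply]
    · change 0 = seq.coeff n (snd (A.forms.lie.bracket h
        (line x 0 (map_zero _) : pathObj q i).1 (line y 0 (map_zero _) : pathObj q j).1))
      rw [snd_bracket, map_add, map_smul, seq.coeff_bracket, seq.coeff_bracket,
        Finset.sum_eq_zero, Finset.sum_eq_zero]
      · simp
      · intro p _
        exact map_zero (A.lie.bracket _ _)
      · intro p _
        rw [show seq.coeff p.1 (snd (line x 0 (map_zero _) : pathObj q _).1) = 0 from rfl, map_zero,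
          LinearMap.zero_apply]
  map_fil n k x hx := mem_fil.2 ⟨fun m => by
    simp only [LinearMap.coe_mk, AddHom.coe_mk, line, cf_mk]
    split_ifs
    exacts [hx, zero_mem _, zero_mem _], fun m => zero_mem _⟩
  comm h x := ext (fun n => by
    rw [cf_diff]
    simp only [LinearMap.coe_mk, AddHom.coe_mk, line, cf_mk]
    split_ifs <;> simp) fun n => by
      rw [cdt_diff]
      simp [line]

lemma const_app {k : ℤ} (x : A k) : (const : Hom A (pathObj q)).app k x = line x 0 (map_zero _) := rfl

end pathObj

end CDGL

/-! ### Integration of forms, and the fibre product -/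

namespace CDGL

variable {A B : CDGL.{u}} {q : Hom A B}

namespace pathObj

/-- The coefficients of the integral from `0` to `t`. -/
def primitiveCoeff {i j : ℤ} (e : i + 1 = j) (x : pathObj q i) : ℕ → A j
  | 0 => 0
  | n + 1 => (1 / ((n : ℚ) + 1)) • A.lie.castDeg e (cdt n x)

/-- The integral from `0` to `t` of the coefficient of `dt`. -/
def primitive {i j : ℤ} (e : i + 1 = j) : pathObj q i →ₗ[ℚ] pathObj q j where
  toFun x := mk (primitiveCoeff e x) (fun _ => 0)
    (fun n => by
      cases n with
      | zero => exact zero_mem _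
      | succ n => exact Submodule.smul_mem _ _ (castDeg_mem e (cdt_mem x n)))
    (fun n => by rw [primitiveCoeff, map_smul, app_castDeg, map_cdt, map_zero, smul_zero])
    (fun _ => zero_mem _) fun _ => map_zero _
  map_add' x y := by
    refine ext (fun n => ?_) fun n => ?_
    · rw [map_add, cf_mk, cf_mk, cf_mk]
      cases n with
      | zero => exact (add_zero _).symm
      | succ n => rw [primitiveCoeff, primitiveCoeff, primitiveCoeff, map_add, map_add, smul_add]
    · rw [map_add, cdt_mk, cdt_mk, cdt_mk, add_zero]
  map_smul' c x := by
    refine ext (fun n => ?_) fun n => ?_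
    · rw [map_smul, cf_mk, cf_mk]
      cases n with
      | zero => exact (smul_zero _).symm
      | succ n => rw [primitiveCoeff, primitiveCoeff, map_smul, map_smul, smul_comm, RingHom.id_apply]
    · rw [map_smul, cdt_mk, cdt_mk, smul_zero]

lemma cf_primitive {i j : ℤ} (e : i + 1 = j) (x : pathObj q i) (n : ℕ) :
    cf n (primitive e x) = primitiveCoeff e x n := rfl

lemma cdt_primitive {i j : ℤ} (e : i + 1 = j) (x : pathObj q i) (n : ℕ) :
    cdt n (primitive e x) = 0 := rfl

/-- The contraction `x + dt y ↦ ∫₀ᵗ y` of the kernel of the evaluation at `0`. -/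
def contraction₀ : Contraction (ev₀ : Hom (pathObj q) A) where
  h e := primitive e
  map_fil n i j e x hx := mem_fil.2 ⟨fun m => by
    rw [cf_primitive]
    cases m with
    | zero => exact zero_mem _
    | succ m => exact Submodule.smul_mem _ _ (castDeg_mem e ((mem_fil.1 hx).2 m)), fun m =>
      zero_mem _⟩
  map_ker _ _ _ := rfl
  homotopy {i j k} e e' f f' x hx := by
    subst e e'
    refine ext (fun n => ?_) fun n => ?_
    · rw [map_add, cf_diff, cf_primitive, cf_primitive]
      cases n with
      | zero =>
        rw [primitiveCoeff, primitiveCoeff, map_zero, add_zero]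
        -- Integration does not reach the constant coefficient; it vanishes because `x` lies in the
        -- kernel of the evaluation at `0`.
        exact hx.symm
      | succ n =>
        have : ((n : ℚ) + 1) ≠ 0 := by positivity
        rw [primitiveCoeff, primitiveCoeff, cdt_diff]
        simp only [castDeg_rfl]
        rw [map_smul, smul_sub, smul_smul, one_div_mul_cancel this, one_smul]
        abel
    · have : ((n : ℚ) + 1) ≠ 0 := by positivity
      rw [map_add, cdt_diff, cf_primitive, cdt_primitive, cdt_primitive, primitiveCoeff]
      simp only [castDeg_rfl]
      rw [smul_smul, mul_one_div_cancel this, one_smul, map_zero]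
      abel

lemma integral_isSum {k j : ℤ} (e : k + 1 = j) (x : pathObj q k) :
    A.lie.IsSum (fun n : ℕ => (1 / ((n : ℚ) + 1)) • A.lie.castDeg e (cdt n x))
      (A.lie.sum fun n : ℕ => (1 / ((n : ℚ) + 1)) • A.lie.castDeg e (cdt n x)) :=
  sum_spec (exists_isSum_of_mem fun n =>
    Submodule.smul_mem _ _ (fil_succ_le (castDeg_mem e (cdt_mem x n))))

/-- The integral from `0` to `1` of the coefficient of `dt`. -/
noncomputable def integral {k j : ℤ} (e : k + 1 = j) : pathObj q k →ₗ[ℚ] A j where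
  toFun x := A.lie.sum fun n : ℕ => (1 / ((n : ℚ) + 1)) • A.lie.castDeg e (cdt n x)
  map_add' x y := IsSum.unique (integral_isSum e (x + y)) (by
    simp only [map_add, smul_add]; exact (integral_isSum e x).add (integral_isSum e y))
  map_smul' c x := IsSum.unique (integral_isSum e (c • x)) (by
    simp only [map_smul]
    convert (integral_isSum e x).map (c • LinearMap.id) fun n y hy => Submodule.smul_mem _ _ hy
      using 2
    · rw [smul_comm]; rfl
    · rfl)

lemma integral_mem {n : ℕ} {k j : ℤ} (e : k + 1 = j) {x : pathObj q k}
    (hx : x ∈ (pathObj q).lie.fil n k) : integral e x ∈ A.lie.fil n j :=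
  (integral_isSum e x).mem fun m => Submodule.smul_mem _ _ (castDeg_mem e ((mem_fil.1 hx).2 m))

lemma map_integral {k j : ℤ} (e : k + 1 = j) (x : pathObj q k) : q.app j (integral e x) = 0 := by
  refine IsSum.unique ((integral_isSum e x).map (q.app j) fun n y hy => q.map_fil n y hy) ?_
  simpa using isSum_of_eventually_zero (L := B.lie) (x := fun n : ℕ => q.app j
    ((1 / ((n : ℚ) + 1)) • A.lie.castDeg e (cdt n x))) 0 fun n _ => by
      rw [map_smul, app_castDeg, map_cdt, map_zero, smul_zero]

/-- Stokes' theorem. -/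
lemma diff_integral {i j k : ℤ} (e : i + 1 = j) (e' : k + 1 = i) (f : j + -1 = i) (f' : i + -1 = k)
    (x : pathObj q i) : A.diff.app f (integral e x) + integral e' ((pathObj q).diff.app f' x) =
      ev₁.app i x - ev₀.app i x := by
  subst e e'
  have h1 := ((integral_isSum rfl x).map (A.diff.app f) fun n y hy => A.diff.map_fil n f y hy).add
    (integral_isSum rfl ((pathObj q).diff.app f' x))
  have h2 : (fun n : ℕ => A.diff.app f ((1 / ((n : ℚ) + 1)) • A.lie.castDeg rfl (cdt n x)) +
      (1 / ((n : ℚ) + 1)) • A.lie.castDeg rfl (cdt n ((pathObj q).diff.app f' x))) =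
      fun n => cf (n + 1) x := by
    funext n
    change A.diff.app f ((1 / ((n : ℚ) + 1)) • cdt n x) +
          (1 / ((n : ℚ) + 1)) • (((n : ℚ) + 1) • cf (n + 1) x - A.diff.app f (cdt n x)) = _
    have : ((n : ℚ) + 1) ≠ 0 := by positivity
    rw [map_smul, smul_sub, smul_smul, one_div_mul_cancel this, one_smul]
    abel
  rw [h2] at h1
  have h3 := IsSum.unique (ev₁_isSum x) (IsSum.cons (x := fun n => cf n x) h1)
  rw [h3, ev₀_app, add_sub_cancel_left]
  rfl

/-- A deformation of the identity of `A` over `B` that ends in a morphism that vanishes on the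
kernel of `q` gives a contraction. -/
noncomputable def contractionOfDeformation (H : Hom A (pathObj q))
    (h₁ : ∀ k x, ev₁.app k (H.app k x) = x)
    (h₀ : ∀ k x, q.app k x = 0 → ev₀.app k (H.app k x) = 0) : Contraction q where
  h {i _} e := (integral e).comp (H.app i)
  map_fil n _ _ e x hx := integral_mem e (H.map_fil n x hx)
  map_ker e _ _ := map_integral e _
  homotopy e e' f f' x hx := by
    -- By Stokes, `d∫H + ∫Hd` is the difference of the two ends of the deformation, which on the
    -- kernel is the identity minus zero.
    rw [LinearMap.comp_apply, LinearMap.comp_apply, H.comm, diff_integral, h₁, h₀ _ _ hx, sub_zero]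

end pathObj

/-- The fibre product `A ×_B A`. -/
def fiberSub (q : Hom A B) (k : ℤ) : Submodule ℚ ((A.prod A) k) :=
  LinearMap.eqLocus ((q.app k).comp (LinearMap.fst ℚ (A k) (A k)))
    ((q.app k).comp (LinearMap.snd ℚ (A k) (A k)))

lemma fiberSub_closed (q : Hom A B) : (A.prod A).lie.IsClosedSubalgebra (fiberSub q) where
  bracket_mem {i j k} h x y hx hy := by
    change q.app k (A.lie.bracket h x.1 y.1) = q.app k (A.lie.bracket h x.2 y.2)
    rw [q.map_bracket, q.map_bracket, show q.app i x.1 = q.app i x.2 from hx,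
      show q.app j y.1 = q.app j y.2 from hy]
  closed {k} x hx := by
    change q.app k x.1 = q.app k x.2
    refine eq_of_sub_mem fun n => ?_
    obtain ⟨y, hy, hxy⟩ := hx n
    have h1 := q.map_fil n _ hxy.1
    have h2 := q.map_fil n _ hxy.2
    change q.app k (x.1 - y.1) ∈ _ at h1
    change q.app k (x.2 - y.2) ∈ _ at h2
    rw [map_sub, show q.app k y.1 = q.app k y.2 from hy] at h1
    rw [map_sub] at h2
    simpa using sub_mem h1 h2

/-- The fibre product `A ×_B A`. -/
def fiberProd (q : Hom A B) : CDGL.{u} := (A.prod A).sub (fiberSub q) (fiberSub_closed q)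
  (fun {i j} h x hx => by
    change q.app j (A.diff.app h x.1) = q.app j (A.diff.app h x.2)
    rw [q.comm, q.comm, show q.app i x.1 = q.app i x.2 from hx])

namespace fiberProd

/-- The first projection. -/
def pr₀ : Hom (fiberProd q) A where
  app k := (LinearMap.fst ℚ (A k) (A k)).comp (fiberSub q k).subtype
  map_bracket _ _ _ := rfl
  map_fil _ _ _ hx := hx.1
  comm _ _ := rfl

/-- The second projection. -/
def pr₁ : Hom (fiberProd q) A where
  app k := (LinearMap.snd ℚ (A k) (A k)).comp (fiberSub q k).subtype
  map_bracket _ _ _ := rfl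
  map_fil _ _ _ hx := hx.2
  comm _ _ := rfl

/-- Pairs of elements with the same image. -/
def mk {k : ℤ} (x y : A k) (h : q.app k x = q.app k y) : fiberProd q k := ⟨(x, y), h⟩

@[simp] lemma pr₀_mk {k : ℤ} (x y : A k) (h : q.app k x = q.app k y) :
    pr₀.app k (mk x y h) = x := rfl

@[simp] lemma pr₁_mk {k : ℤ} (x y : A k) (h : q.app k x = q.app k y) :
    pr₁.app k (mk x y h) = y := rfl

lemma map_pr {k : ℤ} (x : fiberProd q k) : q.app k (pr₀.app k x) = q.app k (pr₁.app k x) := x.2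

lemma ext {k : ℤ} {x y : fiberProd q k} (h₀ : pr₀.app k x = pr₀.app k y)
    (h₁ : pr₁.app k x = pr₁.app k y) : x = y := Subtype.ext (Prod.ext h₀ h₁)

/-- The morphism with given components. -/
def pair {L : CDGL.{u}} (f g : Hom L A) (h : ∀ k x, q.app k (f.app k x) = q.app k (g.app k x)) :
    Hom L (fiberProd q) where
  app k := ((f.app k).prod (g.app k)).codRestrict (fiberSub q k) (h k)
  map_bracket e x y := ext (f.map_bracket e x y) (g.map_bracket e x y)
  map_fil n _ x hx := ⟨f.map_fil n x hx, g.map_fil n x hx⟩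
  comm e x := ext (f.comm e x) (g.comm e x)

lemma isMC_iff {a : fiberProd q (-1)} :
    (fiberProd q).IsMC a ↔ A.IsMC (pr₀.app _ a) ∧ A.IsMC (pr₁.app _ a) :=
  ⟨fun h => ⟨isMC_map pr₀ h, isMC_map pr₁ h⟩, fun h => ext (by
    rw [pr₀.comm, h.1, map_smul, pr₀.map_bracket]) (by
    rw [pr₁.comm, h.2, map_smul, pr₁.map_bracket])⟩

end fiberProd

/-- Both evaluations. -/
noncomputable def pathObj.ends : Hom (pathObj q) (fiberProd q) :=
  fiberProd.pair ev₀ ev₁ fun _ x => (map_ev₁ x).symm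

end CDGL

lemma CGL.Der.castDeg_app {M : CGL.{u}} {r : ℤ} (D : Der M r) {i j j' : ℤ} (e : i + r = j)
    (h : j = j') (x : M i) : M.castDeg h (D.app e x) = D.app (e.trans h) x := by
  subst h; rfl

lemma CGL.free.castDeg_gen {X : Type u} {deg : X → ℤ} (x : X) {k l : ℤ} (h : deg x = k)
    (h' : k = l) : (free deg).castDeg h' (gen x h) = gen x (h.trans h') := by
  subst h'; rfl

/-! ### The model `𝕃̂(V ⊕ V' ⊕ sV')` and the contraction of its projection -/

namespace Cylinder

variable {X : Type u} {δ : X → ℤ}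

/-- The generator `x` of `𝕃̂(V ⊕ V' ⊕ sV')`. -/
noncomputable def gB (x : X) : free (deg δ) (δ x) := free.gen (Idx.base x) rfl

/-- The generator `x'` of `𝕃̂(V ⊕ V' ⊕ sV')`. -/
noncomputable def gH (x : X) : free (deg δ) (δ x) := free.gen (Idx.hat x) rfl

/-- The generator `sx'` of `𝕃̂(V ⊕ V' ⊕ sV')`. -/
noncomputable def gS (x : X) : free (deg δ) (δ x + 1) := free.gen (Idx.bar x) rfl

/-- The closed Lie subalgebra generated by the generators is everything. -/
lemma closed_induction (P : ∀ k, Submodule ℚ (free (deg δ) k)) (hB : ∀ x, gB x ∈ P (δ x))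
    (hH : ∀ x, gH x ∈ P (δ x)) (hS : ∀ x, gS x ∈ P (δ x + 1))
    (hbr : ∀ {i j k : ℤ} (h : i + j = k) (x : free (deg δ) i) (y : free (deg δ) j), x ∈ P i →
      y ∈ P j → (free (deg δ)).bracket h x y ∈ P k)
    (hcl : ∀ {k : ℤ} (x : free (deg δ) k),
      (∀ n, ∃ y ∈ P k, x - y ∈ (free (deg δ)).fil n k) → x ∈ P k)
    {k : ℤ} (x : free (deg δ) k) : x ∈ P k :=
  free.closed_induction P (fun y => by cases y; exacts [hB _, hH _, hS _]) hbr hcl x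

lemma hom_ext {M : CGL.{u}} (f g : Hom (free (deg δ)) M)
    (hB : ∀ x, f.app _ (gB x) = g.app _ (gB x)) (hH : ∀ x, f.app _ (gH x) = g.app _ (gH x))
    (hS : ∀ x, f.app _ (gS x) = g.app _ (gS x)) {k : ℤ} (x : free (deg δ) k) :
    f.app k x = g.app k x :=
  free.hom_ext f g (fun y => by cases y; exacts [hB _, hH _, hS _]) x

lemma exists_iso (f : Hom (free (deg δ)) (free (deg δ)))
    (hB : ∀ x, f.app _ (gB x) - gB x ∈ (free (deg δ)).fil 2 (δ x))
    (hH : ∀ x, f.app _ (gH x) - gH x ∈ (free (deg δ)).fil 2 (δ x))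
    (hS : ∀ x, f.app _ (gS x) - gS x ∈ (free (deg δ)).fil 2 (δ x + 1)) :
    ∃ e : Iso (free (deg δ)) (free (deg δ)), e.hom = f :=
  free.exists_iso_of_gen f (fun y => by cases y; exacts [hB _, hH _, hS _])

section glue

variable {M : CGL.{u}} (mB mH : ∀ x, M (δ x)) (mS : ∀ x, M (δ x + 1))

/-- The values of `glue` on the basis. -/
def glueGen : ∀ y, M (deg δ y)
  | .base x => mB x
  | .hat x => mH x
  | .bar x => mS x

/-- The morphism with given values on the generators. -/
noncomputable def glue : Hom (free (deg δ)) M := free.lift (glueGen mB mH mS)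

lemma glue_gB (x : X) : (glue mB mH mS).app _ (gB x) = mB x :=
  free.lift_gen (glueGen mB mH mS) (.base x)

lemma glue_gH (x : X) : (glue mB mH mS).app _ (gH x) = mH x :=
  free.lift_gen (glueGen mB mH mS) (.hat x)

lemma glue_gS (x : X) : (glue mB mH mS).app _ (gS x) = mS x :=
  free.lift_gen (glueGen mB mH mS) (.bar x)

end glue

lemma comm_der {M : CGL.{u}} {r : ℤ} (f : Hom (free (deg δ)) M) (D : Der (free (deg δ)) r)
    (D' : Der M r)
    (hB : ∀ x, f.app _ (D.app rfl (gB x)) = D'.app rfl (f.app _ (gB x)))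
    (hH : ∀ x, f.app _ (D.app rfl (gH x)) = D'.app rfl (f.app _ (gH x)))
    (hS : ∀ x, f.app _ (D.app rfl (gS x)) = D'.app rfl (f.app _ (gS x)))
    {i j : ℤ} (h : i + r = j) (x : free (deg δ) i) : f.app j (D.app h x) = D'.app h (f.app i x) :=
  free.comm_der f D D' (fun y => by cases y; exacts [hB _, hH _, hS _]) h x

/-- The algebra `(𝕃̂(V), d)`. -/
noncomputable abbrev baseAlg (d : Differential (free δ)) : CDGL.{u} := ⟨free δ, d⟩

/-- The algebra `(𝕃̂(V ⊕ V' ⊕ sV'), d)`. -/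
noncomputable abbrev model (d : Differential (free δ)) : CDGL.{u} := ⟨free (deg δ), diff d⟩

variable (d : Differential (free δ))

lemma diff_incl {i j : ℤ} (h : i + -1 = j) (x : free δ i) :
    (diff d).app h (incl.app i x) = incl.app j (d.app h x) := der_incl d h x

lemma incl_gen (x : X) : (incl : Hom (free δ) _).app _ (free.gen x rfl) = gB x :=
  free.lift_gen _ x

lemma diff_gH (x : X) {j : ℤ} (h : δ x + -1 = j) : (diff d).app h (gH x) = 0 := der_hat d x rfl h

lemma diff_gS (x : X) {j : ℤ} (h : δ x + 1 + -1 = j) :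
    (diff d).app h (gS x) = (free (deg δ)).castDeg (by omega) (gH x) := by
  subst h
  refine (free.der_gen (-1) (dGen d) (.bar x)).trans ?_
  exact (free.castDeg_gen (deg := deg δ) (Idx.hat x) rfl (show δ x = δ x + 1 + -1 by omega)).symm

lemma diff_gS_eq (x : X) (h : δ x + 1 + -1 = δ x) : (diff d).app h (gS x) = gH x := diff_gS d x h

/-- The inclusion `(𝕃̂(V), d) → (𝕃̂(V ⊕ V' ⊕ sV'), d)`. -/
noncomputable def inclHom : CDGL.Hom (baseAlg d) (model d) :=
  ⟨incl, fun h x => (diff_incl d h x).symm⟩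

variable {d} {M : CDGL.{u}}

/-- The Lie algebra morphism underlying `desc`. -/
noncomputable def descLie (φ : CDGL.Hom (baseAlg d) M) (η : ∀ x, M (δ x + 1)) :
    CGL.Hom (free (deg δ)) M.lie :=
  glue (fun x => φ.app (δ x) (free.gen x rfl))
    (fun x => M.diff.app (show δ x + 1 + -1 = δ x by omega) (η x)) η

lemma descLie_incl (φ : CDGL.Hom (baseAlg d) M) (η : ∀ x, M (δ x + 1)) {k : ℤ} (x : free δ k) :
    (descLie φ η).app k (incl.app k x) = φ.app k x :=
  free.hom_ext ((descLie φ η).comp incl) φ.toHom (fun x => by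
    change (descLie φ η).app _ (incl.app _ (free.gen x rfl)) = _
    rw [incl_gen]; exact glue_gB _ _ _ x) x

/-- The morphism that extends `φ` and maps `sx'` to `η x`. -/
noncomputable def desc (φ : CDGL.Hom (baseAlg d) M) (η : ∀ x, M (δ x + 1)) :
    CDGL.Hom (model d) M where
  toHom := descLie φ η
  comm {i j} h x := by
    refine comm_der (descLie φ η) (diff d).toDer M.diff.toDer (fun x => ?_) (fun x => ?_)
      (fun x => ?_) h x
    · rw [← incl_gen, diff_incl, descLie_incl, descLie_incl]
      exact φ.comm rfl _
    · rw [diff_gH, map_zero, descLie, glue_gH, M.diff.sq_zero]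
    · rw [diff_gS, CDGL.app_castDeg, descLie, glue_gH, glue_gS]
      exact M.diff.castDeg_app _ _ _

lemma desc_incl (φ : CDGL.Hom (baseAlg d) M) (η : ∀ x, M (δ x + 1)) {k : ℤ} (x : free δ k) :
    (desc φ η).app k (incl.app k x) = φ.app k x := descLie_incl φ η x

lemma desc_gB (φ : CDGL.Hom (baseAlg d) M) (η : ∀ x, M (δ x + 1)) (x : X) :
    (desc φ η).app _ (gB x) = φ.app _ (free.gen x rfl) := glue_gB _ _ _ x

lemma desc_gS (φ : CDGL.Hom (baseAlg d) M) (η : ∀ x, M (δ x + 1)) (x : X) :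
    (desc φ η).app _ (gS x) = η x := glue_gS _ _ _ x

lemma desc_gH (φ : CDGL.Hom (baseAlg d) M) (η : ∀ x, M (δ x + 1)) (x : X) :
    (desc φ η).app _ (gH x) = M.diff.app (show δ x + 1 + -1 = δ x by omega) (η x) :=
  glue_gH _ _ _ x

/-- Morphisms from `𝕃̂(V ⊕ V' ⊕ sV')` are determined by their values on `V` and `sV'`. -/
lemma model_hom_ext {f g : CDGL.Hom (model d) M}
    (hb : ∀ x, f.app _ (gB x) = g.app _ (gB x)) (hs : ∀ x, f.app _ (gS x) = g.app _ (gS x))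
    {k : ℤ} (x : free (deg δ) k) : f.app k x = g.app k x := by
  refine hom_ext f.toHom g.toHom hb (fun x => ?_) hs x
  have e : δ x + 1 + -1 = δ x := by omega
  -- Since `x' = d(sx')`, its value is forced by compatibility with the differential.
  rw [← diff_gS_eq d x e]
  exact (f.comm e _).trans ((congrArg _ (hs x)).trans (g.comm e _).symm)

variable (d)

/-- The projection `𝕃̂(V ⊕ V' ⊕ sV') → 𝕃̂(V)`. -/
noncomputable def proj : CDGL.Hom (model d) (baseAlg d) := desc (CDGL.Hom.id _) fun _ => 0

lemma proj_incl {k : ℤ} (x : free δ k) : (proj d).app k (incl.app k x) = x := desc_incl _ _ x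

lemma proj_gB (x : X) : (proj d).app _ (gB x) = free.gen x rfl := desc_gB _ _ x

lemma proj_gS (x : X) : (proj d).app _ (gS x) = 0 := desc_gS _ _ x

open CDGL.pathObj in
/-- The deformation `v ↦ v`, `sv' ↦ t sv'`. -/
noncomputable def deformation : CDGL.Hom (model d) (CDGL.pathObj (proj d)) :=
  desc (const.comp (inclHom d)) fun x => line 0 (gS x) (proj_gS d x)

open CDGL.pathObj in
lemma deformation_gB (x : X) : (deformation d).app _ (gB x) = const.app _ (gB x) := by
  refine (desc_gB _ _ x).trans ?_
  exact congrArg ((const : CDGL.Hom (model d) (CDGL.pathObj (proj d))).app (δ x)) (incl_gen x)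

open CDGL.pathObj in
lemma deformation_gS (x : X) : (deformation d).app _ (gS x) = line 0 (gS x) (proj_gS d x) :=
  desc_gS _ _ x

open CDGL.pathObj in
lemma ev₁_deformation {k : ℤ} (x : model d k) : ev₁.app k ((deformation d).app k x) = x := by
  refine model_hom_ext (f := ev₁.comp (deformation d)) (g := CDGL.Hom.id _) (fun x => ?_)
    (fun x => ?_) x
  · change ev₁.app _ ((deformation d).app _ (gB x)) = gB x
    rw [deformation_gB, const_app, ev₁_line, add_zero]
  · change ev₁.app _ ((deformation d).app _ (gS x)) = gS x
    rw [deformation_gS, ev₁_line, zero_add]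

open CDGL.pathObj in
-- At `t = 0` the generators `sv'` die, and with them `v' = d(sv')`. The deformation therefore
-- starts at the retraction onto `𝕃̂(V)`, which factors through the projection and so vanishes on
-- its kernel.
lemma ev₀_deformation {k : ℤ} (x : model d k) :
    ev₀.app k ((deformation d).app k x) = incl.app k ((proj d).app k x) := by
  refine model_hom_ext (f := ev₀.comp (deformation d)) (g := (inclHom d).comp (proj d))
    (fun x => ?_) (fun x => ?_) x
  · change ev₀.app _ ((deformation d).app _ (gB x)) = incl.app _ ((proj d).app _ (gB x))
    rw [deformation_gB, const_app, ev₀_line, proj_gB, incl_gen]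
  · change ev₀.app _ ((deformation d).app _ (gS x)) = incl.app _ ((proj d).app _ (gS x))
    rw [deformation_gS, ev₀_line, proj_gS, map_zero]

/-- The kernel of the projection is contractible. -/
noncomputable def projContraction : CDGL.Contraction (proj d) :=
  CDGL.pathObj.contractionOfDeformation (deformation d) (fun _ x => ev₁_deformation d x)
    fun _ x hx => by rw [ev₀_deformation, hx, map_zero]

end Cylinder

namespace CGL

/-- The sum of two isomorphism statements: a morphism with a left and a right inverse up to
isomorphism is an isomorphism. -/
lemma exists_iso_of_comp {L M : CGL.{u}} (f : Hom L M) (g : Hom M L)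
    (h₁ : ∃ e : Iso M M, e.hom = f.comp g) (h₂ : ∃ e : Iso L L, e.hom = g.comp f) :
    ∃ e : Iso L M, e.hom = f := by
  obtain ⟨e₁, h₁⟩ := h₁
  obtain ⟨e₂, h₂⟩ := h₂
  have hr : ∀ k x, f.app k (g.app k (e₁.inv.app k x)) = x := fun k x => by
    have := e₁.hom_inv k x
    rw [h₁] at this
    exact this
  have hl : ∀ k x, e₂.inv.app k (g.app k (f.app k x)) = x := fun k x => by
    have := e₂.inv_hom k x
    rw [h₂] at this
    exact this
  refine ⟨⟨f, g.comp e₁.inv, hr, fun k x => ?_⟩, rfl⟩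
  change g.app k (e₁.inv.app k (f.app k x)) = x
  rw [← hl k (g.app k (e₁.inv.app k (f.app k x))), hr, hl]

end CGL

/-! ### The exponential of `θ` and the invertibility of `ψ` -/

namespace Cylinder

variable {X : Type u} {δ : X → ℤ}

lemma homotopy_gB (x : X) {j : ℤ} (h : δ x + 1 = j) :
    (homotopy : Der (free (deg δ)) 1).app h (gB x) = (free (deg δ)).castDeg h (gS x) := by
  subst h; exact free.der_gen 1 _ (Idx.base x)

lemma homotopy_gH (x : X) {j : ℤ} (h : δ x + 1 = j) :
    (homotopy : Der (free (deg δ)) 1).app h (gH x) = 0 := by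
  subst h; exact free.der_gen 1 _ (Idx.hat x)

lemma homotopy_gS (x : X) {j : ℤ} (h : δ x + 1 + 1 = j) :
    (homotopy : Der (free (deg δ)) 1).app h (gS x) = 0 := by
  subst h; exact free.der_gen 1 _ (Idx.bar x)

/-- Modulo brackets, `i` maps `𝕃̂(V)` to `sV'`: a subspace that contains `sV'`, all brackets and
some `Fᴺ` contains `i(𝕃̂(V))`. -/
lemma homotopy_incl_mem (N : ℕ) (P : ∀ k, Submodule ℚ (free (deg δ) k))
    (hS : ∀ x, gS x ∈ P (δ x + 1))
    (hbr : ∀ {i j k : ℤ} (h : i + j = k) (x : free (deg δ) i) (y : free (deg δ) j),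
      (free (deg δ)).bracket h x y ∈ P k)
    (hN : ∀ k, (free (deg δ)).fil N k ≤ P k) {k l : ℤ} (h : k + 1 = l) (z : free δ k) :
    homotopy.app h (incl.app k z) ∈ P l := by
  subst h
  refine free.closed_induction' (fun k => (P (k + 1)).comap ((homotopy.app rfl).comp (incl.app k)))
    (fun x => ?_) ?_ N ?_ z
  · rw [Submodule.mem_comap, LinearMap.comp_apply, incl_gen, homotopy_gB]
    exact hS x
  · intro i j k h x y
    rw [Submodule.mem_comap, LinearMap.comp_apply, incl.map_bracket,
      homotopy.leibniz h rfl rfl rfl (by omega) (by omega)]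
    exact add_mem (hbr _ _ _) (Submodule.smul_mem _ _ (hbr _ _ _))
  · intro k x hx
    exact hN _ (homotopy.map_fil N (show k + 1 = k + 1 from rfl) _ (incl.map_fil N _ hx))

variable (d : Differential (free δ))

/-- The intermediate degrees are free variables here, so that `θ` can be expanded on elements whose
neighbouring degrees are written in different ways. -/
lemma theta_apply {k l m : ℤ} (h₁ : k + -1 = l) (h₂ : l + 1 = k) (h₃ : k + 1 = m) (h₄ : m + -1 = k)
    (x : free (deg δ) k) : theta d k x =
      homotopy.app h₂ ((diff d).app h₁ x) + (diff d).app h₄ (homotopy.app h₃ x) := by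
  obtain rfl : l = k - 1 := by omega
  subst h₃
  rfl

lemma theta_mem {n : ℕ} {k : ℤ} {x : free (deg δ) k} (hx : x ∈ (free (deg δ)).fil n k) :
    theta d k x ∈ (free (deg δ)).fil n k :=
  add_mem (homotopy.map_fil n _ _ ((diff d).map_fil n _ _ hx))
    ((diff d).map_fil n _ _ (homotopy.map_fil n _ _ hx))

lemma theta_pow_mem {n : ℕ} {k : ℤ} {x : free (deg δ) k} (hx : x ∈ (free (deg δ)).fil n k) (m : ℕ) :
    (theta d k ^ m) x ∈ (free (deg δ)).fil n k := by
  induction m with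
  | zero => exact hx
  | succ m ih => rw [pow_succ', Module.End.mul_apply]; exact theta_mem d ih

lemma theta_pow_mem_of_le {n : ℕ} {k : ℤ} {x : free (deg δ) k} {m m' : ℕ} (hm : m ≤ m')
    (hx : (theta d k ^ m) x ∈ (free (deg δ)).fil n k) :
    (theta d k ^ m') x ∈ (free (deg δ)).fil n k := by
  obtain ⟨r, rfl⟩ := Nat.exists_eq_add_of_le' hm
  rw [pow_add, Module.End.mul_apply]
  exact theta_pow_mem d hx r

/-- Because `d² = 0`, both composites reduce to `d i d`. -/
lemma theta_diff {i j : ℤ} (h : i + -1 = j) (x : free (deg δ) i) :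
    theta d j ((diff d).app h x) = (diff d).app h (theta d i x) := by
  rw [theta_apply d (show j + -1 = j - 1 by omega) (by omega) (show j + 1 = i by omega) h,
    theta_apply d h (show j + 1 = i by omega) rfl (by omega), map_add, (diff d).sq_zero,
    (diff d).sq_zero, map_zero, zero_add, add_zero]

lemma theta_gH (x : X) : theta d (δ x) (gH x) = 0 := by
  rw [theta_apply d rfl (by omega) rfl (by omega), diff_gH, homotopy_gH, map_zero, map_zero, add_zero]

lemma theta_gS (x : X) : theta d (δ x + 1) (gS x) = 0 := by
  rw [theta_apply d (show δ x + 1 + -1 = δ x by omega) rfl rfl (by omega), diff_gS_eq, homotopy_gH,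
    homotopy_gS, map_zero, add_zero]

lemma theta_gB (x : X) : theta d (δ x) (gB x) =
    homotopy.app (show δ x + -1 + 1 = δ x by omega) (incl.app _ (d.app rfl (free.gen x rfl))) +
      gH x := by
  rw [theta_apply d rfl (show δ x + -1 + 1 = δ x by omega) rfl (show δ x + 1 + -1 = δ x by omega),
    homotopy_gB, castDeg_rfl, diff_gS_eq, ← diff_incl, incl_gen]

/-- `θ` is the graded commutator of the odd derivations `i` and `d`, so the mixed terms cancel and a
derivation of degree `0` remains. -/
lemma theta_bracket {i j k : ℤ} (h : i + j = k) (x : free (deg δ) i) (y : free (deg δ) j) :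
    theta d k ((free (deg δ)).bracket h x y) = (free (deg δ)).bracket h (theta d i x) y +
      (free (deg δ)).bracket h x (theta d j y) := by
  rw [theta_apply d (l := k - 1) (m := k + 1) (by omega) (by omega) rfl (by omega),
    theta_apply d (l := i - 1) (m := i + 1) (by omega) (by omega) rfl (by omega),
    theta_apply d (l := j - 1) (m := j + 1) (by omega) (by omega) rfl (by omega),
    (diff d).leibniz h (i' := i - 1) (j' := j - 1) (by omega) (by omega) _ (by omega) (by omega),
    homotopy.leibniz h (i' := i + 1) (j' := j + 1) (by omega) (by omega) _ (by omega) (by omega)]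
  simp only [map_add, map_smul]
  rw [homotopy.leibniz (i' := i) (j' := j + 1) (k' := k) _ (by omega) (by omega) _ h (by omega),
    homotopy.leibniz (i' := i + 1) (j' := j) (k' := k) _ (by omega) (by omega) _ (by omega) h,
    (diff d).leibniz (i' := i) (j' := j - 1) (k' := k) _ (by omega) (by omega) _ h (by omega),
    (diff d).leibniz (i' := i - 1) (j' := j) (k' := k) _ (by omega) (by omega) _ (by omega) h]
  have s1 : ((-1 : ℚ) ^ (1 * i)) = (-1 : ℚ) ^ i := by rw [one_mul]
  have s2 : ((-1 : ℚ) ^ (-1 * i)) = (-1 : ℚ) ^ i := by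
    rw [neg_one_mul, zpow_neg, inv_eq_of_mul_eq_one_left (sgn_sq i)]
  have s3 : ((-1 : ℚ) ^ (1 * (i - 1))) = -(-1 : ℚ) ^ i := by
    rw [one_mul, sub_eq_add_neg, sgn_add]; norm_num
  have s4 : ((-1 : ℚ) ^ (-1 * (i + 1))) = -(-1 : ℚ) ^ i := by
    rw [mul_add, sgn_add, s2]; norm_num
  rw [s1, s2, s3, s4]
  simp only [LinearMap.add_apply, smul_add, smul_smul, neg_smul, sgn_sq, one_smul]
  abel

/-- The terms of the exponential series. -/
noncomputable def expTerm {k : ℤ} (n : ℕ) (x : free (deg δ) k) : free (deg δ) k :=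
  (1 / (n.factorial : ℚ)) • (theta d k ^ n) x

lemma expTerm_succ {k : ℤ} (n : ℕ) (x : free (deg δ) k) :
    ((n : ℚ) + 1) • expTerm d (n + 1) x = theta d k (expTerm d n x) := by
  rw [expTerm, expTerm, map_smul, pow_succ', Module.End.mul_apply, smul_smul, Nat.factorial_succ]
  congr 1
  have : (n.factorial : ℚ) ≠ 0 := by positivity
  push_cast
  field_simp

lemma expTerm_zero {k : ℤ} (x : free (deg δ) k) : expTerm d 0 x = x := by simp [expTerm]

/-- The exponential series, as a sequence. -/
noncomputable def expSeq {k : ℤ} (x : free (deg δ) k) : (free (deg δ)).seq k :=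
  seq.mk fun n => expTerm d n x

lemma coeff_expSeq {k : ℤ} (x : free (deg δ) k) (n : ℕ) :
    seq.coeff n (expSeq d x) = expTerm d n x := rfl

lemma coeff_seqDeriv_expSeq {k : ℤ} (x : free (deg δ) k) (n : ℕ) :
    seq.coeff n ((free (deg δ)).seqDeriv.app (add_zero k) (expSeq d x)) =
      theta d k (expTerm d n x) := by
  rw [coeff_seqDeriv, castDeg_rfl]
  exact expTerm_succ d n x

/-- Leibniz rule for the divided powers `θⁿ / n!`. As power series in `t`, both sides satisfy `f' =
θ f` with the same initial value, so their coefficients agree by induction. -/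
lemma expTerm_bracket {i j k : ℤ} (h : i + j = k) (x : free (deg δ) i) (y : free (deg δ) j) (n : ℕ) :
    expTerm d n ((free (deg δ)).bracket h x y) = ∑ p ∈ Finset.HasAntidiagonal.antidiagonal n,
      (free (deg δ)).bracket h (expTerm d p.1 x) (expTerm d p.2 y) := by
  have key : expTerm d n ((free (deg δ)).bracket h x y) =
      seq.coeff n ((free (deg δ)).seq.bracket h (expSeq d x) (expSeq d y)) := by
    induction n with
    | zero => simp [seq.coeff_bracket, coeff_expSeq, expTerm_zero]
    | succ n ih =>
      have hn : ((n : ℚ) + 1) ≠ 0 := by positivity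
      have h1 := coeff_seqDeriv _ (add_zero k)
        ((free (deg δ)).seq.bracket h (expSeq d x) (expSeq d y)) n
      rw [(free (deg δ)).seqDeriv.leibniz h (add_zero i) (add_zero j) (add_zero k) h h, zero_mul,
        zpow_zero, one_smul, castDeg_rfl, map_add, seq.coeff_bracket, seq.coeff_bracket] at h1
      simp only [coeff_seqDeriv_expSeq, coeff_expSeq] at h1
      rw [← Finset.sum_add_distrib] at h1
      refine smul_right_injective _ hn ?_
      change ((n : ℚ) + 1) • _ = ((n : ℚ) + 1) • _
      rw [← h1, expTerm_succ, ih, seq.coeff_bracket, map_sum]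
      exact Finset.sum_congr rfl fun p _ => theta_bracket d h _ _
  rw [key, seq.coeff_bracket]
  rfl

lemma expTerm_mem {k : ℤ} {x : free (deg δ) k} {N m n : ℕ} (hmn : m ≤ n)
    (hx : (theta d k ^ m) x ∈ (free (deg δ)).fil N k) : expTerm d n x ∈ (free (deg δ)).fil N k :=
  Submodule.smul_mem _ _ (theta_pow_mem_of_le d hmn hx)

/-- `θ` is topologically nilpotent. -/
lemma exists_theta_pow_mem (N : ℕ) {k : ℤ} (x : free (deg δ) k) :
    ∃ m, (theta d k ^ m) x ∈ (free (deg δ)).fil N k := by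
  induction N generalizing k with
  | zero => exact ⟨0, mem_fil_zero _⟩
  | succ N ih =>
    let P : ∀ k, Submodule ℚ (free (deg δ) k) := fun k =>
      { carrier := {x | ∃ m, (theta d k ^ m) x ∈ (free (deg δ)).fil (N + 1) k}
        add_mem' := by
          rintro x y ⟨m, hm⟩ ⟨n, hn⟩
          refine ⟨max m n, ?_⟩
          rw [map_add]
          exact add_mem (theta_pow_mem_of_le d (le_max_left m n) hm)
            (theta_pow_mem_of_le d (le_max_right m n) hn)
        zero_mem' := ⟨0, zero_mem _⟩
        smul_mem' := by
          rintro c x ⟨m, hm⟩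
          exact ⟨m, by rw [map_smul]; exact Submodule.smul_mem _ _ hm⟩ }
    -- If `θᵐ x` and `θⁿ y` lie in `F^N`, every term of the Leibniz formula for `θ^{m+n}[x, y]` has
    -- a factor in `F^N`, and the bracket supplies the missing step.
    have hbr : ∀ {i j k : ℤ} (h : i + j = k) (x : free (deg δ) i) (y : free (deg δ) j),
        (free (deg δ)).bracket h x y ∈ P k := by
      intro i j k h x y
      obtain ⟨m, hm⟩ := ih x
      obtain ⟨n, hn⟩ := ih y
      refine ⟨m + n, ?_⟩
      have h0 : (((m + n).factorial : ℕ) : ℚ) ≠ 0 := by positivity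
      have h1 : expTerm d (m + n) ((free (deg δ)).bracket h x y) ∈ (free (deg δ)).fil (N + 1) k := by
        rw [expTerm_bracket]
        refine Submodule.sum_mem _ fun p hp => ?_
        have := Finset.HasAntidiagonal.mem_antidiagonal.1 hp
        rcases le_or_gt m p.1 with hp | hp
        · exact bracket_mem_left h _ (expTerm_mem d hp hm)
        · exact bracket_mem_right h _ (expTerm_mem d (show n ≤ p.2 by omega) hn)
      have h2 := Submodule.smul_mem _ (((m + n).factorial : ℕ) : ℚ) h1
      rwa [expTerm, smul_smul, mul_one_div_cancel h0, one_smul] at h2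
    have hfil : ∀ k, (free (deg δ)).fil (N + 1) k ≤ P k := fun k x hx => ⟨0, hx⟩
    have hS : ∀ x, gS x ∈ P (δ x + 1) := fun x => ⟨1, by
      rw [pow_one, theta_gS]; exact zero_mem _⟩
    have hH : ∀ x, gH x ∈ P (δ x) := fun x => ⟨1, by
      rw [pow_one, theta_gH]; exact zero_mem _⟩
    refine closed_induction P (fun x => ?_) hH hS (fun h x y _ _ => hbr h x y) (fun x hx => ?_) x
    -- It suffices to treat `θ(v) = i(dv) + v'`, where `i(dv)` is modulo brackets a combination of
    -- elements of `sV'`, on which `θ` vanishes.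
    · have : theta d (δ x) (gB x) ∈ P (δ x) := by
        rw [theta_gB]
        exact add_mem (homotopy_incl_mem (N + 1) P hS hbr hfil _ _) (hH x)
      obtain ⟨m, hm⟩ := this
      exact ⟨m + 1, by rw [pow_succ]; exact hm⟩
    · obtain ⟨y, hy, hxy⟩ := hx (N + 1)
      simpa using add_mem (hfil _ hxy) hy

lemma expTheta_isSum {k : ℤ} (x : free (deg δ) k) :
    (free (deg δ)).IsSum (fun n => expTerm d n x) (expTheta d x) :=
  sum_spec (exists_isSum fun N => by
    obtain ⟨m, hm⟩ := exists_theta_pow_mem d N x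
    exact ⟨m, fun n hn => expTerm_mem d hn hm⟩)

lemma expTheta_bracket {i j k : ℤ} (h : i + j = k) (x : free (deg δ) i) (y : free (deg δ) j) :
    expTheta d ((free (deg δ)).bracket h x y) =
      (free (deg δ)).bracket h (expTheta d x) (expTheta d y) := by
  refine IsSum.unique (expTheta_isSum d _) ?_
  have := (expTheta_isSum d x).bracket h (expTheta_isSum d y)
  simp only [← expTerm_bracket] at this
  exact this

lemma expTerm_diff {i j : ℤ} (h : i + -1 = j) (x : free (deg δ) i) (n : ℕ) :
    expTerm d n ((diff d).app h x) = (diff d).app h (expTerm d n x) := by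
  have : (theta d j ^ n) ((diff d).app h x) = (diff d).app h ((theta d i ^ n) x) := by
    induction n with
    | zero => rfl
    | succ n ih => rw [pow_succ', pow_succ', Module.End.mul_apply, Module.End.mul_apply, ih, theta_diff]
  rw [expTerm, this, expTerm, map_smul]

lemma expTheta_diff {i j : ℤ} (h : i + -1 = j) (x : free (deg δ) i) :
    expTheta d ((diff d).app h x) = (diff d).app h (expTheta d x) := by
  refine IsSum.unique (expTheta_isSum d _) ?_
  have := (expTheta_isSum d x).map ((diff d).app h) (fun n y hy => (diff d).map_fil n h y hy)
  simp only [← expTerm_diff] at this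
  exact this

/-- The morphism `e^θ`. -/
noncomputable def expHom : CDGL.Hom (model d) (model d) where
  app k :=
    { toFun := expTheta d
      map_add' := fun x y => IsSum.unique (expTheta_isSum d (x + y)) (by
        convert (expTheta_isSum d x).add (expTheta_isSum d y) using 2
        rw [expTerm, map_add, smul_add]; rfl)
      map_smul' := fun c x => IsSum.unique (expTheta_isSum d (c • x)) (by
        convert (expTheta_isSum d x).map (c • LinearMap.id) (fun n y hy => Submodule.smul_mem _ _ hy)
          using 2
        · rw [expTerm, map_smul, smul_comm]; rfl
        · rfl) }
  map_bracket h x y := expTheta_bracket d h x y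
  map_fil n k x hx := (expTheta_isSum d x).mem fun m =>
    expTerm_mem (m := 0) d (Nat.zero_le m) hx
  comm h x := expTheta_diff d h x

lemma expHom_app {k : ℤ} (x : free (deg δ) k) : (expHom d).app k x = expTheta d x := rfl

lemma expTheta_of_theta_eq_zero {k : ℤ} {x : free (deg δ) k} (hx : theta d k x = 0) :
    expTheta d x = x := by
  refine IsSum.unique (expTheta_isSum d x) ?_
  have := isSum_of_eventually_zero (L := free (deg δ)) (x := fun n => expTerm d n x) 1 fun n hn => by
    obtain ⟨n, rfl⟩ : ∃ m, n = m + 1 := ⟨n - 1, by omega⟩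
    rw [expTerm, pow_succ, Module.End.mul_apply, hx, map_zero, smul_zero]
  simpa [expTerm_zero] using this

lemma expHom_gH (x : X) : (expHom d).app _ (gH x) = gH x :=
  expTheta_of_theta_eq_zero d (theta_gH d x)

lemma expHom_gS (x : X) : (expHom d).app _ (gS x) = gS x :=
  expTheta_of_theta_eq_zero d (theta_gS d x)

/-- The element `i(dx)` of `𝕃̂(V ⊕ V' ⊕ sV')`. -/
noncomputable def hd (x : X) : free (deg δ) (δ x) :=
  homotopy.app (show δ x + -1 + 1 = δ x by omega) (incl.app _ (d.app rfl (free.gen x rfl)))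

lemma bracket_mem_fil_two {i j k : ℤ} (h : i + j = k) (x : free (deg δ) i) (y : free (deg δ) j) :
    (free (deg δ)).bracket h x y ∈ (free (deg δ)).fil 2 k :=
  bracket_mem_left h y (mem_fil_one x)

/-- Modulo brackets `θ(v) = v' + i(dv)` is a combination of generators killed by `θ`, so `θ²(v)`
lies in `F²` and the exponential series stops after its linear term. -/
lemma expHom_gB_mem (x : X) :
    (expHom d).app _ (gB x) - (gB x + gH x + hd d x) ∈ (free (deg δ)).fil 2 (δ x) := by
  have h2 : (theta d _ ^ 2) (gB x) ∈ (free (deg δ)).fil 2 (δ x) := by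
    rw [pow_two, Module.End.mul_apply, theta_gB, map_add, theta_gH, add_zero]
    refine homotopy_incl_mem 2 (fun k => ((free (deg δ)).fil 2 k).comap (theta d k)) (fun x => ?_)
      (fun h x y => ?_) (fun k x hx => theta_mem d hx) _ _
    · rw [Submodule.mem_comap, theta_gS]; exact zero_mem _
    · exact theta_mem d (bracket_mem_fil_two h x y)
  have h := (expTheta_isSum d (gB x)).sub_mem (N := 2) (n₀ := 2) fun n hn => expTerm_mem d hn h2
  rw [expHom_app]
  convert h using 2
  have h1 := expTerm_succ d 0 (gB x)
  rw [expTerm_zero, theta_gB] at h1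
  simp only [Nat.cast_zero, zero_add, one_smul] at h1
  rw [Finset.sum_range_succ, Finset.sum_range_one, expTerm_zero, h1, hd]
  abel

/-- `i(dx)` is a combination of elements of `sV'` modulo brackets, and morphisms preserve `F²`. -/
lemma map_hd_mem (f : Hom (free (deg δ)) (free (deg δ))) (hf : ∀ x, f.app _ (gS x) = gS x) (x : X) :
    f.app _ (hd d x) - hd d x ∈ (free (deg δ)).fil 2 (δ x) := by
  refine homotopy_incl_mem 2 (fun k => ((free (deg δ)).fil 2 k).comap (f.app k - LinearMap.id))
    (fun x => ?_) (fun h x y => ?_) (fun k x hx => ?_) _ _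
  · rw [Submodule.mem_comap, LinearMap.sub_apply, hf]; simp
  · exact sub_mem (f.map_fil 2 _ (bracket_mem_fil_two h x y)) (bracket_mem_fil_two h x y)
  · exact sub_mem (f.map_fil 2 _ hx) hx

/-- `e^θ` is an automorphism. -/
lemma exists_expIso : ∃ e : Iso (free (deg δ)) (free (deg δ)), e.hom = (expHom d).toHom := by
  -- The linear part of `e^θ` is `x ↦ x + x' + i(dx)` and the identity on `x'`, `sx'`; `g` inverts
  -- it modulo brackets, so both composites are isomorphisms.
  let g : Hom (free (deg δ)) (free (deg δ)) := glue (fun x => gB x - gH x - hd d x) gH gS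
  have gB' : ∀ x, g.app _ (gB x) = gB x - gH x - hd d x := glue_gB _ _ _
  have gH' : ∀ x, g.app _ (gH x) = gH x := glue_gH _ _ _
  have gS' : ∀ x, g.app _ (gS x) = gS x := glue_gS _ _ _
  have z : ∀ {k : ℤ}, (0 : free (deg δ) k) ∈ (free (deg δ)).fil 2 k := zero_mem _
  refine exists_iso_of_comp (expHom d).toHom g ?_ ?_
  · refine exists_iso _ (fun x => ?_) (fun x => ?_) (fun x => ?_)
    · change (expHom d).app _ (g.app _ (gB x)) - gB x ∈ _
      rw [gB', map_sub, map_sub, expHom_gH]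
      convert sub_mem (expHom_gB_mem d x) (map_hd_mem d (expHom d).toHom (expHom_gS d) x) using 1
      abel
    · change (expHom d).app _ (g.app _ (gH x)) - gH x ∈ _
      rw [gH', expHom_gH, sub_self]; exact z
    · change (expHom d).app _ (g.app _ (gS x)) - gS x ∈ _
      rw [gS', expHom_gS, sub_self]; exact z
  · refine exists_iso _ (fun x => ?_) (fun x => ?_) (fun x => ?_)
    · change g.app _ ((expHom d).app _ (gB x)) - gB x ∈ _
      have h := g.map_fil 2 _ (expHom_gB_mem d x)
      rw [map_sub, map_add, map_add, gB', gH'] at h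
      convert add_mem h (map_hd_mem d g gS' x) using 1
      abel
    · change g.app _ ((expHom d).app _ (gH x)) - gH x ∈ _
      rw [expHom_gH, gH', sub_self]; exact z
    · change g.app _ ((expHom d).app _ (gS x)) - gS x ∈ _
      rw [expHom_gS, gS', sub_self]; exact z

lemma psi_gB (x : X) : (psi d).app _ (gB x) = gB x := free.lift_gen _ (Idx.base x)

lemma psi_gH (x : X) : (psi d).app _ (gH x) = expTheta d (gB x) := free.lift_gen _ (Idx.hat x)

lemma psi_gS (x : X) : (psi d).app _ (gS x) = gS x := free.lift_gen _ (Idx.bar x)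

/-- `ψ` is an isomorphism. -/
lemma exists_psiIso : ∃ e : Iso (free (deg δ)) (free (deg δ)), e.hom = psi d := by
  -- Modulo brackets `ψ(x̂) = x + x' + i(dx)`, so `x'` has to go to `x̂ - x - i(dx)`.
  let g : Hom (free (deg δ)) (free (deg δ)) := glue gB (fun x => gH x - gB x - hd d x) gS
  have gB' : ∀ x, g.app _ (gB x) = gB x := glue_gB _ _ _
  have gH' : ∀ x, g.app _ (gH x) = gH x - gB x - hd d x := glue_gH _ _ _
  have gS' : ∀ x, g.app _ (gS x) = gS x := glue_gS _ _ _
  have z : ∀ {k : ℤ}, (0 : free (deg δ) k) ∈ (free (deg δ)).fil 2 k := zero_mem _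
  refine exists_iso_of_comp (psi d) g ?_ ?_
  · refine exists_iso _ (fun x => ?_) (fun x => ?_) (fun x => ?_)
    · change (psi d).app _ (g.app _ (gB x)) - gB x ∈ _
      rw [gB', psi_gB, sub_self]; exact z
    · change (psi d).app _ (g.app _ (gH x)) - gH x ∈ _
      rw [gH', map_sub, map_sub, psi_gB, psi_gH]
      convert sub_mem (expHom_gB_mem d x) (map_hd_mem d (psi d) (psi_gS d) x) using 1
      rw [expHom_app]
      abel
    · change (psi d).app _ (g.app _ (gS x)) - gS x ∈ _
      rw [gS', psi_gS, sub_self]; exact z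
  · refine exists_iso _ (fun x => ?_) (fun x => ?_) (fun x => ?_)
    · change g.app _ ((psi d).app _ (gB x)) - gB x ∈ _
      rw [psi_gB, gB', sub_self]; exact z
    · change g.app _ ((psi d).app _ (gH x)) - gH x ∈ _
      have h := g.map_fil 2 _ (expHom_gB_mem d x)
      rw [map_sub, map_add, map_add, gB', gH', expHom_app] at h
      rw [psi_gH]
      convert add_mem h (map_hd_mem d g gS' x) using 1
      abel
    · change g.app _ ((psi d).app _ (gS x)) - gS x ∈ _
      rw [psi_gS, gS', sub_self]; exact z

/-- `i` maps every generator into `sV'` or to zero, so its values lie in the closed ideal generated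
by `sV'`, which the projection kills. -/
lemma proj_homotopy {k l : ℤ} (h : k + 1 = l) (x : free (deg δ) k) :
    (proj d).app l (homotopy.app h x) = 0 := by
  subst h
  refine LinearMap.mem_ker.1 (closed_induction
    (fun k => LinearMap.ker (((proj d).app (k + 1)).comp (homotopy.app rfl)))
    (fun x => ?_) (fun x => ?_) (fun x => ?_) ?_ ?_ x)
  · rw [LinearMap.mem_ker, LinearMap.comp_apply, homotopy_gB, castDeg_rfl, proj_gS]
  · rw [LinearMap.mem_ker, LinearMap.comp_apply, homotopy_gH, map_zero]
  · rw [LinearMap.mem_ker, LinearMap.comp_apply, homotopy_gS, map_zero]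
  · intro i j k h x y hx hy
    rw [LinearMap.mem_ker, LinearMap.comp_apply] at *
    rw [homotopy.leibniz h rfl rfl rfl (by omega) (by omega), map_add, map_smul,
      (proj d).map_bracket, (proj d).map_bracket, hx, hy]
    simp
  · intro k x hx
    rw [LinearMap.mem_ker]
    refine (free δ).separated _ fun n => ?_
    obtain ⟨y, hy, hxy⟩ := hx n
    have := (proj d).map_fil n _ (homotopy.map_fil n rfl _ hxy)
    rw [LinearMap.mem_ker, LinearMap.comp_apply] at hy
    rwa [map_sub, map_sub, hy, sub_zero] at this

lemma proj_theta {k : ℤ} (x : free (deg δ) k) : (proj d).app k (theta d k x) = 0 := by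
  have e : k + 1 + -1 = k := by omega
  rw [theta_apply d (l := k + -1) (m := k + 1) rfl (by omega) rfl e, map_add, proj_homotopy, zero_add]
  refine ((proj d).comm e _).trans ?_
  rw [proj_homotopy, map_zero]

/-- The projection kills `i` and commutes with `d`, hence kills `θ`; only the constant term of the
exponential survives. This gives `p ι₁ = id`. -/
lemma proj_expHom {k : ℤ} (x : free (deg δ) k) :
    (proj d).app k ((expHom d).app k x) = (proj d).app k x := by
  refine IsSum.unique ((expTheta_isSum d x).map ((proj d).app k)
    fun n y hy => (proj d).map_fil n y hy) ?_
  have := isSum_of_eventually_zero (L := free δ) (x := fun n => (proj d).app k (expTerm d n x)) 1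
    fun n hn => by
      obtain ⟨n, rfl⟩ : ∃ m, n = m + 1 := ⟨n - 1, by omega⟩
      rw [expTerm, pow_succ', Module.End.mul_apply, map_smul, proj_theta, smul_zero]
  simpa [expTerm_zero] using this

end Cylinder

/-! ### Homotopy extension for the pair `(incl, e^θ ∘ incl)` -/

namespace Cylinder

variable {X : Type u} {δ : X → ℤ} {d : Differential (free δ)} {Q A : CDGL.{u}}

section variation

variable (φ : CDGL.Hom (baseAlg d) Q) (η η' : ∀ x, Q (δ x + 1)) {n : ℕ}

lemma desc_sub_mem_of_gen (hη : ∀ x, η' x - η x ∈ Q.lie.fil n (δ x + 1)) (y : Idx X) :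
    (desc φ η').app _ (free.gen y rfl) - (desc φ η).app _ (free.gen y rfl) ∈
      Q.lie.fil n (deg δ y) := by
  cases y with
  | base x =>
    change (desc φ η').app _ (gB x) - (desc φ η).app _ (gB x) ∈ Q.lie.fil n (δ x)
    rw [desc_gB, desc_gB, sub_self]; exact zero_mem _
  | hat x =>
    change (desc φ η').app _ (gH x) - (desc φ η).app _ (gH x) ∈ Q.lie.fil n (δ x)
    rw [desc_gH, desc_gH, ← map_sub]; exact Q.diff.map_fil n _ _ (hη x)
  | bar x =>
    change (desc φ η').app _ (gS x) - (desc φ η).app _ (gS x) ∈ Q.lie.fil n (δ x + 1)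
    rw [desc_gS, desc_gS]; exact hη x

lemma desc_sub_mem (hη : ∀ x, η' x - η x ∈ Q.lie.fil n (δ x + 1)) {k : ℤ} (y : free (deg δ) k) :
    (desc φ η').app k y - (desc φ η).app k y ∈ Q.lie.fil n k :=
  free.sub_mem_of_gen _ _ n (desc_sub_mem_of_gen φ η η' hη) y

lemma desc_sub_bracket_mem (hη : ∀ x, η' x - η x ∈ Q.lie.fil n (δ x + 1)) {i j k : ℤ}
    (h : i + j = k) (x : free (deg δ) i) (y : free (deg δ) j) :
    (desc φ η').app k ((free (deg δ)).bracket h x y) -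
      (desc φ η).app k ((free (deg δ)).bracket h x y) ∈ Q.lie.fil (n + 1) k :=
  free.sub_bracket_mem_of_gen _ _ n (desc_sub_mem_of_gen φ η η' hη) h x y

/-- Up to `Fⁿ⁺¹`, elements of `F²` are finite combinations of brackets, where the change is one step
deeper. -/
lemma desc_sub_mem_of_fil_two (hη : ∀ x, η' x - η x ∈ Q.lie.fil n (δ x + 1)) {k : ℤ}
    {y : free (deg δ) k} (hy : y ∈ (free (deg δ)).fil 2 k) :
    (desc φ η').app k y - (desc φ η).app k y ∈ Q.lie.fil (n + 1) k :=
  free.fil_two_le (n + 1)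
    ((Q.lie.fil (n + 1) k).comap ((desc φ η').app k - (desc φ η).app k))
    (fun h x y => desc_sub_bracket_mem φ η η' hη h x y)
    (fun _ hy => sub_mem ((desc φ η').map_fil _ _ hy) ((desc φ η).map_fil _ _ hy)) hy

end variation

/-- The first order change of the value on `e^θ(x)` of a morphism, in terms of the change on `sV'`. -/
lemma correction {r : CDGL.Hom Q A} (c : CDGL.Contraction r) (φ : CDGL.Hom (baseAlg d) Q)
    (η : ∀ x, Q (δ x + 1)) (f : CDGL.Hom (baseAlg d) Q) {n : ℕ}
    (hR : ∀ x, f.app _ (free.gen x rfl) - (desc φ η).app _ ((expHom d).app _ (gB x)) ∈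
      Q.lie.fil n (δ x))
    (hr : ∀ k (z : free δ k),
      r.app k (f.app k z) = r.app k ((desc φ η).app k ((expHom d).app k (incl.app k z)))) (x : X) :
    f.app _ (free.gen x rfl) - (desc φ (η + fun x => c.h (show δ x + 1 = δ x + 1 from rfl)
      (f.app _ (free.gen x rfl) - (desc φ η).app _ ((expHom d).app _ (gB x))))).app _
        ((expHom d).app _ (gB x)) ∈ Q.lie.fil (n + 1) (δ x) := by
  set g : CDGL.Hom (baseAlg d) Q := (desc φ η).comp ((expHom d).comp (inclHom d)) with hg
  have hgen : ∀ x, g.app _ (free.gen x rfl) = (desc φ η).app _ ((expHom d).app _ (gB x)) := by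
    intro x
    rw [← incl_gen]; rfl
  have hker : ∀ k (z : free δ k), r.app k (f.app k z - g.app k z) = 0 := fun k z => by
    rw [map_sub, hr]; exact sub_self _
  simp only [← hgen] at hR ⊢
  set κ : ∀ x, Q (δ x + 1) := fun x => c.h (show δ x + 1 = δ x + 1 from rfl)
      (f.app _ (free.gen x rfl) - g.app _ (free.gen x rfl)) with hκ
  have hη : ∀ x, (η + κ) x - η x ∈ Q.lie.fil n (δ x + 1) := fun x => by
    rw [Pi.add_apply, add_sub_cancel_left]
    exact c.map_fil n _ _ (hR x)
  -- On all of `𝕃̂(V)` the change on `i(z)` is `h(f z - g z)` modulo `Fⁿ⁺¹`: on generators this is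
  -- the definition of `κ`, and on brackets both sides are negligible.
  have key : ∀ {k l : ℤ} (h : k + 1 = l) (z : free δ k),
      ((desc φ (η + κ)).app l (homotopy.app h (incl.app k z)) -
        (desc φ η).app l (homotopy.app h (incl.app k z))) - c.h h (f.app k z - g.app k z) ∈
          Q.lie.fil (n + 1) l := by
    intro k l h z
    subst h
    refine free.closed_induction' (fun k => (Q.lie.fil (n + 1) (k + 1)).comap
      (((desc φ (η + κ)).app (k + 1) - (desc φ η).app (k + 1)) ∘ₗ (homotopy.app rfl) ∘ₗ (incl.app k) -
        (c.h rfl) ∘ₗ (f.app k - g.app k))) (fun x => ?_) (fun {i j k} h x y => ?_) (n + 1)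
        (fun k z hz => ?_) z
    · change ((desc φ (η + κ)).app _ (homotopy.app rfl (incl.app _ (free.gen x rfl))) -
        (desc φ η).app _ (homotopy.app rfl (incl.app _ (free.gen x rfl)))) -
          c.h rfl (f.app _ (free.gen x rfl) - g.app _ (free.gen x rfl)) ∈
            Q.lie.fil (n + 1) (δ x + 1)
      rw [incl_gen, homotopy_gB, castDeg_rfl, desc_gS, desc_gS, Pi.add_apply, add_sub_cancel_left,
        sub_self]
      exact zero_mem _
    · change ((desc φ (η + κ)).app _ (homotopy.app rfl (incl.app _ ((free δ).bracket h x y))) -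
        (desc φ η).app _ (homotopy.app rfl (incl.app _ ((free δ).bracket h x y)))) -
          c.h rfl (f.app _ ((free δ).bracket h x y) - g.app _ ((free δ).bracket h x y)) ∈
            Q.lie.fil (n + 1) (k + 1)
      refine sub_mem ?_ (c.map_fil _ _ _ (free.sub_bracket_mem_of_gen f.toHom g.toHom n hR h x y))
      rw [incl.map_bracket, homotopy.leibniz h rfl rfl rfl (by omega) (by omega), map_add, map_add,
        map_smul, map_smul, add_sub_add_comm, ← smul_sub]
      exact add_mem (desc_sub_bracket_mem φ η _ hη _ _ _)
        (Submodule.smul_mem _ _ (desc_sub_bracket_mem φ η _ hη _ _ _))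
    · have h1 := homotopy.map_fil (n + 1) (show k + 1 = k + 1 from rfl) _
        (incl.map_fil (n + 1) _ hz)
      exact sub_mem (sub_mem ((desc φ (η + κ)).map_fil _ _ h1) ((desc φ η).map_fil _ _ h1))
        (c.map_fil _ _ _ (sub_mem (f.map_fil _ _ hz) (g.map_fil _ _ hz)))
  have e1 : δ x + 1 + -1 = δ x := by omega
  have e2 : δ x + -1 + 1 = δ x := by omega
  -- Up to an element of `F²`, `e^θ(x)` is `x + x' + i(dx)`. With `r = f x - g x`, the changes on
  -- these three terms are `0`, `d(h r)` and, by `key`, `h(dr)`; the contraction identity makes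
  -- their sum equal to `r`.
  have h1 := desc_sub_mem_of_fil_two φ η _ hη (expHom_gB_mem d x)
  have h2 := key e2 (d.app rfl (free.gen x rfl))
  have h3 := c.homotopy rfl e2 e1 rfl _ (hker _ (free.gen x rfl))
  have h4 : Q.diff.app (show δ x + -1 = δ x + -1 from rfl)
      (f.app _ (free.gen x rfl) - g.app _ (free.gen x rfl)) =
      f.app _ (d.app rfl (free.gen x rfl)) - g.app _ (d.app rfl (free.gen x rfl)) := by
    rw [map_sub]
    exact (congrArg₂ _ (f.comm rfl _) (g.comm rfl _)).symm
  rw [h4] at h3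
  simp only [map_sub, map_add] at h1
  rw [desc_gB, desc_gB, desc_gH, desc_gH, Pi.add_apply, map_add, ← hgen] at h1
  have h5 := neg_mem (add_mem h1 h2)
  refine (congrArg (· ∈ Q.lie.fil (n + 1) (δ x)) ?_).mpr h5
  change _ - (desc φ (η + κ)).app _ ((expHom d).app _ (gB x)) = _
  have h6 : f.app _ (free.gen x rfl) = g.app _ (free.gen x rfl) +
    (Q.diff.app e1 (κ x) + c.h e2 (f.app _ (d.app rfl (free.gen x rfl)) -
      g.app _ (d.app rfl (free.gen x rfl)))) := by
    rw [hκ, h3]; abel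
  rw [h6, hd]
  abel

/-- The homotopy extension property: the pair `(incl, e^θ ∘ incl)` has the left lifting property with
respect to surjections with a contraction. -/
lemma homotopy_extension {r : CDGL.Hom Q A} (hr : r.IsFibration) (c : CDGL.Contraction r)
    (Φ₀ : CDGL.Hom (model d) A) (φ₀ φ₁ : CDGL.Hom (baseAlg d) Q)
    (h₀ : ∀ k (z : free δ k), r.app k (φ₀.app k z) = Φ₀.app k (incl.app k z))
    (h₁ : ∀ k (z : free δ k), r.app k (φ₁.app k z) = Φ₀.app k ((expHom d).app k (incl.app k z))) :
    ∃ Φ : CDGL.Hom (model d) Q, (∀ k (z : free δ k), Φ.app k (incl.app k z) = φ₀.app k z) ∧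
      (∀ k (z : free δ k), Φ.app k ((expHom d).app k (incl.app k z)) = φ₁.app k z) ∧
      ∀ k (z : free (deg δ) k), r.app k (Φ.app k z) = Φ₀.app k z := by
  -- Any lift of the values on `sV'` will do as a start; corrections `κ` in the kernel of `r` keep
  -- the morphism over `Φ₀`.
  choose η₀ hη₀ using fun x => hr (δ x + 1) (Φ₀.app _ (gS x))
  have hrd : ∀ κ : ∀ x, Q (δ x + 1), (∀ x, κ x ∈ LinearMap.ker (r.app (δ x + 1))) →
      ∀ k (z : free (deg δ) k), r.app k ((desc φ₀ (η₀ + κ)).app k z) = Φ₀.app k z := by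
    intro κ hκ k z
    refine model_hom_ext (f := r.comp (desc φ₀ (η₀ + κ))) (g := Φ₀) (fun x => ?_) (fun x => ?_) z
    · change r.app _ ((desc φ₀ (η₀ + κ)).app _ (gB x)) = _
      rw [desc_gB, ← incl_gen]; exact h₀ _ _
    · change r.app _ ((desc φ₀ (η₀ + κ)).app _ (gS x)) = _
      rw [desc_gS, Pi.add_apply, map_add, hη₀, LinearMap.mem_ker.1 (hκ x), add_zero]
  obtain ⟨κ, hκ, hR⟩ := successive_approximation (L := Q.lie) (deg := fun x => δ x + 1)
    (fun x => LinearMap.ker (r.app (δ x + 1))) (fun x y hy => r.ker_closed y hy)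
    (fun n κ => ∀ x, φ₁.app _ (free.gen x rfl) -
      (desc φ₀ (η₀ + κ)).app _ ((expHom d).app _ (gB x)) ∈ Q.lie.fil n (δ x))
    (fun x => mem_fil_zero _)
    (fun n κ hκ hR => by
      have hr' : ∀ k (z : free δ k), r.app k (φ₁.app k z) =
          r.app k ((desc φ₀ (η₀ + κ)).app k ((expHom d).app k (incl.app k z))) := fun k z => by
        rw [hrd κ hκ, h₁]
      refine ⟨fun x => c.h (show δ x + 1 = δ x + 1 from rfl) (φ₁.app _ (free.gen x rfl) -
        (desc φ₀ (η₀ + κ)).app _ ((expHom d).app _ (gB x))), fun x => c.map_ker _ _ ?_,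
        fun x => c.map_fil n _ _ (hR x), fun x => ?_⟩
      · rw [map_sub, hr', incl_gen, sub_self]
      · rw [← add_assoc]
        exact correction c φ₀ (η₀ + κ) φ₁ hR hr' x)
    (fun n κ κ' _ _ hR h x => by
      have := sub_mem (hR x) (desc_sub_mem φ₀ (η₀ + κ) (η₀ + κ') (n := n) (fun x => by
        simpa using h x) ((expHom d).app _ (gB x)))
      convert this using 1
      abel)
  refine ⟨desc φ₀ (η₀ + κ), fun k z => desc_incl _ _ z, fun k z => ?_, hrd κ hκ⟩
  refine free.hom_ext ((desc φ₀ (η₀ + κ)).comp ((expHom d).comp (inclHom d))).toHom φ₁.toHom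
    (fun x => ?_) z
  change (desc φ₀ (η₀ + κ)).app _ ((expHom d).app _ (incl.app _ (free.gen x rfl))) = _
  rw [incl_gen]
  exact (eq_of_sub_mem fun n => hR n x).symm

end Cylinder

/-! ### Lifting Maurer-Cartan elements, paths and cells along trivial fibrations -/

namespace CGL

/-- For three copies of an odd element the Jacobi identity reads `3[a, [a, a]] = 0`. It is needed
for `d² = 0` on a generator with `da = -½[a, a]`. -/
lemma bracket_bracket_self {L : CGL.{u}} (a : L (-1)) :
    L.bracket (show (-1 : ℤ) + -2 = -3 by norm_num) a
      (L.bracket (show (-1 : ℤ) + -1 = -2 by norm_num) a a) = 0 := by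
  have h₂ : (-1 : ℤ) + -1 = -2 := by norm_num
  have h₃ : (-1 : ℤ) + -2 = -3 := by norm_num
  have h₃' : (-2 : ℤ) + -1 = -3 := by norm_num
  have e₁ := L.jacobi h₂ h₂ h₂ h₃ h₃' h₃ a a a
  have e₂ := L.skew h₃ h₃' a (L.bracket h₂ a a)
  norm_num at e₁ e₂
  rw [e₂] at e₁ ⊢
  set w := L.bracket h₃' (L.bracket h₂ a a) a
  have e₃ : (3 : ℚ) • w = 0 := by
    have : (3 : ℚ) • w = w + w + w := by module
    rw [this]; nth_rewrite 1 [show w = -(-w) by abel]; rw [e₁]; abel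
  rw [(smul_eq_zero.1 e₃).resolve_left (by norm_num), neg_zero]

lemma Der.app_self_bracket {L : CGL.{u}} (D : Der L (-1)) {a : L (-1)}
    (h : D.app (show (-1 : ℤ) + -1 = -2 by norm_num) a =
      -(1 / 2 : ℚ) • L.bracket (show (-1 : ℤ) + -1 = -2 by norm_num) a a) :
    D.app (show (-2 : ℤ) + -1 = -3 by norm_num)
      (L.bracket (show (-1 : ℤ) + -1 = -2 by norm_num) a a) = 0 := by
  have h₂ : (-1 : ℤ) + -1 = -2 := by norm_num
  have h₃ : (-1 : ℤ) + -2 = -3 := by norm_num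
  have h₃' : (-2 : ℤ) + -1 = -3 := by norm_num
  rw [D.leibniz h₂ h₂ h₂ h₃' h₃' h₃, h, map_smul, map_smul, LinearMap.smul_apply,
    bracket_bracket_self, L.skew h₃' h₃, bracket_bracket_self]
  simp

end CGL

namespace CDGL

/-! ### A universal Maurer-Cartan element with an element of degree zero -/

/-- The differential `da = -½[a, a]`, `dx = b`, on the generators. -/
noncomputable def universalDiffGen : ∀ y : LSGen.{u}, free lsDeg.{u} (lsDeg y + -1)
  | .a => -(1 / 2 : ℚ) • (free lsDeg.{u}).bracket rfl (free.gen LSGen.a rfl) (free.gen LSGen.a rfl)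
  | .b => 0
  | .x => free.gen LSGen.b rfl

lemma universalDiff_a : (free.der (-1) universalDiffGen.{u}).app
    (show (-1 : ℤ) + -1 = -2 by norm_num) (free.gen LSGen.a rfl) =
      -(1 / 2 : ℚ) • (free lsDeg.{u}).bracket (show (-1 : ℤ) + -1 = -2 by norm_num)
        (free.gen LSGen.a rfl) (free.gen LSGen.a rfl) :=
  free.der_gen (-1) universalDiffGen.{u} .a

/-- The differential `da = -½[a, a]`, `dx = b`, `db = 0` of `𝕃̂(a, b, x)`. -/
noncomputable def universalDiff : Differential (free lsDeg.{u}) :=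
  free.differential universalDiffGen fun
    | .a => by
      change (free.der (-1) universalDiffGen.{u}).app (show (-2 : ℤ) + -1 = -3 by norm_num)
        (-(1 / 2 : ℚ) • (free lsDeg.{u}).bracket (show (-1 : ℤ) + -1 = -2 by norm_num)
          (free.gen LSGen.a rfl) (free.gen LSGen.a rfl)) = 0
      rw [map_smul, (free.der (-1) universalDiffGen.{u}).app_self_bracket universalDiff_a, smul_zero]
    | .b => map_zero _
    | .x => free.der_gen (-1) universalDiffGen.{u} .b

variable {A B : CDGL.{u}}

/-- The values of `universalMap` on the generators. -/
def universalMapGen (c : A (-1)) (z : A 0) : ∀ y : LSGen.{u}, A (lsDeg y)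
  | .a => c
  | .b => A.diff.app (show (0 : ℤ) + -1 = -1 by norm_num) z
  | .x => z

/-- The Lie algebra morphism underlying `universalMap`. -/
noncomputable def universalMapLie (c : A (-1)) (z : A 0) : CGL.Hom (free lsDeg.{u}) A.lie :=
  free.lift (universalMapGen c z)

lemma universalMapLie_a (c : A (-1)) (z : A 0) :
    (universalMapLie c z).app (-1) (free.gen LSGen.a rfl) = c :=
  free.lift_gen (universalMapGen c z) .a

lemma universalMapLie_b (c : A (-1)) (z : A 0) :
    (universalMapLie c z).app (-1) (free.gen LSGen.b rfl) =
      A.diff.app (show (0 : ℤ) + -1 = -1 by norm_num) z :=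
  free.lift_gen (universalMapGen c z) .b

lemma universalMapLie_x (c : A (-1)) (z : A 0) :
    (universalMapLie c z).app 0 (free.gen LSGen.x rfl) = z :=
  free.lift_gen (universalMapGen c z) .x

lemma universalMapLie_comm_a {c : A (-1)} (hc : A.IsMC c) (z : A 0) :
    (universalMapLie c z).app (-2) (-(1 / 2 : ℚ) • (free lsDeg.{u}).bracket
      (show (-1 : ℤ) + -1 = -2 by norm_num) (free.gen LSGen.a rfl) (free.gen LSGen.a rfl)) =
        A.diff.app (show (-1 : ℤ) + -1 = -2 by norm_num)
          ((universalMapLie c z).app (-1) (free.gen LSGen.a rfl)) := by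
  rw [map_smul, (universalMapLie c z).map_bracket, universalMapLie_a, hc]

lemma universalMapLie_comm_b (c : A (-1)) (z : A 0) :
    (universalMapLie c z).app (-2) 0 =
        A.diff.app (show (-1 : ℤ) + -1 = -2 by norm_num)
          ((universalMapLie c z).app (-1) (free.gen LSGen.b rfl)) := by
  rw [universalMapLie_b, map_zero, A.diff.sq_zero]

lemma universalMapLie_comm_x (c : A (-1)) (z : A 0) :
    (universalMapLie c z).app (-1) (free.gen LSGen.b rfl) =
        A.diff.app (show (0 : ℤ) + -1 = -1 by norm_num)
          ((universalMapLie c z).app 0 (free.gen LSGen.x rfl)) := by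
  rw [universalMapLie_b, universalMapLie_x]

/-- The morphism `a ↦ c`, `x ↦ z`. -/
noncomputable def universalMap {c : A (-1)} (hc : A.IsMC c) (z : A 0) :
    Hom (Cylinder.baseAlg universalDiff.{u}) A where
  toHom := universalMapLie c z
  comm {i j} h x := by
    refine free.comm_der (universalMapLie c z) universalDiff.toDer A.diff.toDer
      (fun y => ?_) h x
    refine (congrArg ((universalMapLie c z).app _)
      (free.der_gen (-1) universalDiffGen.{u} y)).trans ?_
    cases y with
    | a => exact universalMapLie_comm_a hc z
    | b => exact universalMapLie_comm_b c z
    | x => exact universalMapLie_comm_x c z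

open Cylinder

/-- The universal example for `exists_universal`. -/
noncomputable abbrev universal : CDGL.{u} := model universalDiff.{u}

/-- The universal Maurer-Cartan element. -/
noncomputable def univC : universal.{u} (-1) := gB LSGen.a
/-- The universal element of degree `0`. -/
noncomputable def univZ : universal.{u} 0 := gB LSGen.x
/-- The universal element of degree `0` that vanishes under the projection. -/
noncomputable def univK : universal.{u} 0 := gS LSGen.a

lemma proj_univK : (proj universalDiff.{u}).app 0 univK = 0 := proj_gS _ LSGen.a

lemma isMC_univC : universal.{u}.IsMC univC := by
  have : (baseAlg universalDiff.{u}).IsMC (free.gen LSGen.a rfl) := universalDiff_a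
  have := isMC_map (inclHom universalDiff.{u}) this
  refine (congrArg universal.{u}.IsMC ?_).mp this
  exact incl_gen LSGen.a

/-- Problems about `c`, `z` and `k` can be solved once in the universal example, where the
projection has a contraction, and then mapped to `A`. The last clause says that `q ∘ Ψ` depends only
on the projection, which controls the image in `B` of the solution. -/
lemma exists_universal (q : Hom A B) {c : A (-1)} (hc : A.IsMC c) (z k : A 0) (hk : q.app 0 k = 0) :
    ∃ Ψ : Hom universal.{u} A, Ψ.app _ univC = c ∧ Ψ.app _ univZ = z ∧ Ψ.app _ univK = k ∧
      ∀ j (y y' : universal.{u} j), (proj universalDiff).app j y = (proj universalDiff).app j y' →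
        q.app j (Ψ.app j y) = q.app j (Ψ.app j y') := by
  -- Of `sV'` only `sa'`, of degree `0`, plays the role of `k`; the other generators are sent to
  -- zero.
  let η : ∀ y : LSGen.{u}, A (lsDeg y + 1)
    | .a => k
    | .b => 0
    | .x => 0
  have hη : ∀ y, q.app _ (η y) = 0 := by
    rintro (_ | _ | _)
    exacts [hk, map_zero _, map_zero _]
  refine ⟨desc (universalMap hc z) η, (desc_gB _ _ LSGen.a).trans ?_,
    (desc_gB _ _ LSGen.x).trans ?_, desc_gS _ _ LSGen.a, ?_⟩
  · exact universalMapLie_a c z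
  · exact universalMapLie_x c z
  · have key : ∀ j (y : universal.{u} j), q.app j ((desc (universalMap hc z) η).app j y) =
        q.app j ((universalMap hc z).app j ((proj universalDiff).app j y)) := fun j y =>
      model_hom_ext (f := q.comp (desc (universalMap hc z) η))
        (g := (q.comp (universalMap hc z)).comp (proj universalDiff))
        (fun y => by
          refine (congrArg (q.app _) (desc_gB _ _ y)).trans ?_
          exact congrArg (fun w => q.app _ ((universalMap hc z).app _ w)) (proj_gB _ y).symm)
        (fun y => by
          refine ((congrArg (q.app _) (desc_gS _ _ y)).trans (hη y)).trans ?_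
          refine ((congrArg (fun w => q.app _ ((universalMap hc z).app _ w)) (proj_gS _ y)).trans
            ?_).symm
          rw [map_zero, map_zero]) y
    intro j y y' h
    rw [key, key, h]

lemma proj_fibration {X : Type u} {δ : X → ℤ} (d : Differential (free δ)) : (proj d).IsFibration :=
  fun k x => ⟨incl.app k x, proj_incl d x⟩

/-- The concatenation of a path that vanishes in `B` with a path. -/
lemma exists_isPath_comp (q : Hom A B) {b : A (-1)} (hb : A.IsMC b) (z k : A 0)
    (hk : q.app 0 k = 0) : ∃ y, A.IsPath (A.gauge k (A.gauge z b)) b y ∧ q.app 0 y = q.app 0 z := by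
  obtain ⟨Ψ, hc, hz, hk, hΨ⟩ := exists_universal q hb z k hk
  have hm : universal.{u}.IsMC (universal.gauge univK (universal.gauge univZ univC)) :=
    isMC_gauge _ (isMC_gauge _ isMC_univC)
  -- The projection kills `univK`, so downstairs `univZ` itself is a path between the projected
  -- ends; its lift is the concatenation.
  obtain ⟨y, hy, hpy⟩ := (projContraction universalDiff.{u}).exists_isPath (proj_fibration _) hm
    isMC_univC (x := (proj universalDiff).app 0 univZ) (by
      rw [isPath_iff, map_gauge, proj_univK, gauge_zero, map_gauge])
  refine ⟨Ψ.app 0 y, ?_, ?_⟩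
  · have := isPath_map Ψ hy
    rwa [map_gauge, map_gauge, hc, hz, hk] at this
  · rw [hΨ 0 y univZ hpy, hz]

/-- Two paths that agree in `B` differ by a path that vanishes in `B`. -/
lemma exists_isPath_div (q : Hom A B) {b : A (-1)} (hb : A.IsMC b) (z k : A 0)
    (hk : q.app 0 k = 0) : ∃ y, A.IsPath (A.gauge (z + k) b) (A.gauge z b) y ∧ q.app 0 y = 0 := by
  obtain ⟨Ψ, hc, hz, hk, hΨ⟩ := exists_universal q hb z k hk
  -- Both ends have the same projection, so the path to be lifted is zero.
  obtain ⟨y, hy, hpy⟩ := (projContraction universalDiff.{u}).exists_isPath (proj_fibration _)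
    (isMC_gauge (univZ + univK) isMC_univC) (isMC_gauge univZ isMC_univC) (x := 0) (by
      rw [isPath_iff, map_gauge, map_gauge, map_add, proj_univK, add_zero, gauge_zero])
  refine ⟨Ψ.app 0 y, ?_, ?_⟩
  · have := isPath_map Ψ hy
    rwa [map_gauge, map_gauge, map_add, hc, hz, hk] at this
  · rw [hΨ 0 y 0 (by rw [hpy, map_zero]), map_zero, map_zero]

/-! ### Lifting properties of trivial fibrations -/

namespace Hom.IsWeakEquiv

variable {q : Hom A B}

/-- Maurer-Cartan elements can be lifted. -/
lemma exists_isMC (hw : q.IsWeakEquiv) (hq : q.IsFibration) {c : B (-1)} (hc : B.IsMC c) :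
    ∃ a, A.IsMC a ∧ q.app _ a = c := by
  obtain ⟨a, ha, x, hx⟩ := hw.mc_surjective c hc
  obtain ⟨x, rfl⟩ := hq 0 x
  rw [isPath_iff] at hx
  -- `q a` is the gauge transform of `c` by `x`, so transforming `a` by the negative of a lift of
  -- `x` corrects the image to `c`.
  exact ⟨A.gauge (-x) a, isMC_gauge _ ha, by rw [map_gauge, map_neg, hx, gauge_neg]⟩

/-- Solutions of `d_a x = w` can be lifted. -/
lemma exists_dPert_eq (hw : q.IsWeakEquiv) (hq : q.IsFibration) {a : A (-1)} (ha : A.IsMC a)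
    {i j k : ℤ} (h : i + -1 = j) (h' : j + -1 = k) {w : A j} (hdw : A.dPert a h' w = 0) {x : B i}
    (hx : B.dPert (q.app _ a) h x = q.app j w) :
    ∃ v, q.app i v = x ∧ A.dPert a h v = w := by
  obtain ⟨v, rfl⟩ := hq i x
  obtain ⟨k, hk, hk'⟩ := Hom.IsQuasiIsoAt.acyclicAt hq ha (hw.quasiIso a ha) h h'
    (w - A.dPert a h v) (by rw [map_sub, dPert_map, hx, sub_self])
    (by rw [map_sub, hdw, dPert_sq ha, sub_zero])
  exact ⟨v + k, by rw [map_add, hk, add_zero], by rw [map_add, hk', add_sub_cancel]⟩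

/-- Paths with given end points can be lifted. -/
lemma exists_isPath (hw : q.IsWeakEquiv) (hq : q.IsFibration) {a b : A (-1)} (ha : A.IsMC a)
    (hb : A.IsMC b) {x : B 0} (hx : B.IsPath (q.app _ a) (q.app _ b) x) :
    ∃ y, A.IsPath a b y ∧ q.app 0 y = x := by
  obtain ⟨x, rfl⟩ := hq 0 x
  have hd : (0 : ℤ) + -1 = -1 := by norm_num
  have h2 : (-1 : ℤ) + -1 = -2 := by norm_num
  rw [isPath_iff, ← map_gauge] at hx
  have hc := isMC_gauge x hb
  -- `a` and `gauge x b` have the same image, so they are joined by some `x'` in `A`; its image in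
  -- `B` is only a loop.
  obtain ⟨x', hx'⟩ := hw.mc_injective a (A.gauge x b) ha hc
    ⟨0, by rw [isPath_iff, gauge_zero, hx]⟩
  have hloop := isPath_map q hx'
  rw [hx] at hloop
  -- The loop is a cycle of the perturbed differential and lifts to a cycle `z`, which fixes `gauge
  -- x b`. Dividing `x'` by `z` gives a path from `a` to `gauge x b` that vanishes in `B`, to be
  -- concatenated with `x`.
  obtain ⟨z, hz, hdz⟩ := hw.exists_dPert_eq hq hc hd h2 (w := 0) (x := q.app 0 x') (map_zero _)
    (by rw [dPert_eq_zero_of_isPath hloop, map_zero])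
  obtain ⟨k, hk, hqk⟩ := exists_isPath_div q hc z (x' - z) (by rw [map_sub, hz, sub_self])
  rw [add_sub_cancel, gauge_of_dPert_eq_zero hdz, ← isPath_iff.1 hx', isPath_iff] at hk
  obtain ⟨y, hy, hqy⟩ := exists_isPath_comp q hb x k hqk
  rw [← hk] at hy
  exact ⟨y, hy, hqy⟩

end Hom.IsWeakEquiv

end CDGL

/-! ### Free maps are cofibrations -/

namespace CGL

/-- The inclusion of a closed subalgebra. -/
def subIncl (L : CGL.{u}) (P : ∀ k, Submodule ℚ (L k)) (hP : L.IsClosedSubalgebra P) :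
    Hom (L.sub P hP) L where
  app k := (P k).subtype
  map_bracket _ _ _ := rfl
  map_fil _ _ _ h := h

/-- The corestriction of a morphism to a closed subalgebra that contains its image. -/
def subCorestrict {M L : CGL.{u}} (f : Hom M L) (P : ∀ k, Submodule ℚ (L k))
    (hP : L.IsClosedSubalgebra P) (h : ∀ k x, f.app k x ∈ P k) : Hom M (L.sub P hP) where
  app k := (f.app k).codRestrict (P k) (h k)
  map_bracket e x y := Subtype.ext (f.map_bracket e x y)
  map_fil n _ x hx := f.map_fil n x hx

/-- The completed coproduct `L' ⨿̂ 𝕃̂(W)` is generated by `L'` and `W`. -/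
lemma IsFreeExtension.mem {L' L : CGL.{u}} {f : Hom L' L} {Y : Type u} {deg : Y → ℤ}
    {g : ∀ y, L (deg y)} (hf : IsFreeExtension f deg g) {P : ∀ k, Submodule ℚ (L k)}
    (hP : L.IsClosedSubalgebra P) (h₁ : ∀ k x, f.app k x ∈ P k) (h₂ : ∀ y, g y ∈ P (deg y))
    {k : ℤ} (x : L k) : x ∈ P k := by
  obtain ⟨r, ⟨hr, hr'⟩, -⟩ := hf (L.sub P hP) (subCorestrict f P hP h₁) fun y => ⟨g y, h₂ y⟩
  -- The retraction onto the subalgebra, followed by the inclusion, has the same values on `L'` and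
  -- `W` as the identity; uniqueness identifies them.
  have h : (L.subIncl P hP).comp r = Hom.id L :=
    (hf L f g).unique ⟨Hom.ext_app fun k x => by
      change (L.subIncl P hP).app k ((r.comp f).app k x) = _
      rw [hr]; rfl, fun y => by
      change (L.subIncl P hP).app _ (r.app _ (g y)) = _
      rw [hr']; rfl⟩ ⟨rfl, fun _ => rfl⟩
  have hx : (L.subIncl P hP).app k (r.app k x) = x := by
    change ((L.subIncl P hP).comp r).app k x = x
    rw [h]; rfl
  rw [← hx]
  exact (r.app k x).2

lemma eqLocus_closed {L M : CGL.{u}} (f g : Hom L M) :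
    L.IsClosedSubalgebra fun k => LinearMap.eqLocus (f.app k) (g.app k) where
  bracket_mem h x y hx hy := by
    rw [LinearMap.mem_eqLocus] at *
    rw [f.map_bracket, g.map_bracket, hx, hy]
  closed x hx := by
    rw [LinearMap.mem_eqLocus]
    refine eq_of_sub_mem fun n => ?_
    obtain ⟨y, hy, hxy⟩ := hx n
    have := sub_mem (f.map_fil n _ hxy) (g.map_fil n _ hxy)
    rw [map_sub, map_sub, LinearMap.mem_eqLocus.1 hy] at this
    simpa using this

end CGL

namespace CDGL

/-- The elements on which a morphism of Lie algebras commutes with the differentials. -/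
lemma commLocus_closed {L A : CDGL.{u}} (h : CGL.Hom L.lie A.lie) :
    L.lie.IsClosedSubalgebra fun k => LinearMap.eqLocus
      ((h.app (k + -1)).comp (L.diff.app rfl)) ((A.diff.app rfl).comp (h.app k)) where
  bracket_mem {i j k} e x y hx hy := by
    rw [LinearMap.mem_eqLocus, LinearMap.comp_apply, LinearMap.comp_apply] at *
    rw [L.diff.leibniz e rfl rfl rfl (by omega) (by omega), map_add, map_smul, h.map_bracket,
      h.map_bracket, h.map_bracket, hx, hy, A.diff.leibniz e rfl rfl rfl (by omega) (by omega)]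
  closed {k} x hx := by
    rw [LinearMap.mem_eqLocus]
    refine eq_of_sub_mem fun n => ?_
    obtain ⟨y, hy, hxy⟩ := hx n
    rw [LinearMap.mem_eqLocus, LinearMap.comp_apply, LinearMap.comp_apply] at hy
    have := sub_mem (h.map_fil n _ (L.diff.map_fil n (show k + -1 = k + -1 from rfl) _ hxy))
      (A.diff.map_fil n (show k + -1 = k + -1 from rfl) _ (h.map_fil n _ hxy))
    rw [map_sub, map_sub, map_sub, map_sub, hy] at this
    simpa using this

namespace Gens

variable {L' L A B : CDGL.{u}} {f : Hom L' L} {G : Gens L}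

lemma below_mono {m n : ℤ} (h : m ≤ n) {y : G.Idx} (hy : G.below m y) : G.below n y := by
  cases y with
  | u s => trivial
  | su s => trivial
  | mc a => exact lt_of_lt_of_le (b := m) hy h
  | cyc a => exact lt_of_lt_of_le (b := m) hy h
  | pth a => exact lt_of_lt_of_le (b := m) hy h
  | cell a => exact lt_of_lt_of_le (b := m) hy h

lemma exists_below (y : G.Idx) : ∃ n : ℕ, G.below n y := by
  have h : ∀ k : ℤ, k < (((k + 1).toNat : ℕ) : ℤ) := fun k => by omega
  cases y with
  | u s => exact ⟨0, trivial⟩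
  | su s => exact ⟨0, trivial⟩
  | mc a => exact ⟨_, h _⟩
  | cyc a => exact ⟨_, h _⟩
  | pth a => exact ⟨_, h _⟩
  | cell a => exact ⟨_, h _⟩

lemma InStage.app_eq {m : ℤ} {h h' : CGL.Hom L.lie A.lie} (hf : h.comp f.toHom = h'.comp f.toHom)
    (hy : ∀ y, G.below m y → h.app _ (G.elt y) = h'.app _ (G.elt y)) {k : ℤ} {x : L k}
    (hx : G.InStage f m x) : h.app k x = h'.app k x :=
  hx _ (eqLocus_closed h h') (fun k y => by
    change (h.comp f.toHom).app k y = (h'.comp f.toHom).app k y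
    rw [hf]) hy

/-- Commuting with the differentials holds on a closed subalgebra, so inside a stage it only has to
be tested on the generators of that stage. -/
lemma InStage.comm {m : ℤ} {h : CGL.Hom L.lie A.lie} {φ : Hom L' A} (hf : h.comp f.toHom = φ.toHom)
    (hy : ∀ y, G.below m y → h.app _ (L.diff.app rfl (G.elt y)) =
      A.diff.app rfl (h.app _ (G.elt y))) {k l : ℤ} (e : k + -1 = l) {x : L k}
    (hx : G.InStage f m x) : h.app l (L.diff.app e x) = A.diff.app e (h.app k x) := by
  subst e
  have hf' : ∀ k y, h.app k (f.app k y) = φ.app k y := fun k y => by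
    rw [← hf]; rfl
  refine hx _ (commLocus_closed h) (fun k y => ?_) hy
  rw [LinearMap.mem_eqLocus, LinearMap.comp_apply, LinearMap.comp_apply, ← f.comm, hf', hf', φ.comm]

end Gens

variable {L' L A : CDGL.{u}} {f : Hom L' L}

/-- The values `m` on the generators in `U ⊕ sU ⊕ V_{< n}` are compatible with the differential. -/
def Gens.Good (G : Gens L) (f : Hom L' L) (φ : Hom L' A) (n : ℤ) (m : ∀ y, A (G.deg y)) : Prop :=
  ∀ h : CGL.Hom L.lie A.lie, h.comp f.toHom = φ.toHom →
    (∀ y, G.below n y → h.app _ (G.elt y) = m y) →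
      ∀ y, G.below n y → h.app _ (L.diff.app rfl (G.elt y)) = A.diff.app rfl (m y)

lemma CGL.Hom.map_isSum {L M : CGL.{u}} (f : CGL.Hom L M) {k : ℤ} {x : ℕ → L k} {s : L k}
    (h : L.IsSum x s) : M.IsSum (fun n => f.app k (x n)) (f.app k s) :=
  h.map (f.app k) fun n y hy => f.map_fil n y hy

/-- A Lie algebra morphism that maps a path to a path between the images of the end points commutes
with the differential on it. -/
lemma comm_of_isPath {h : CGL.Hom L.lie A.lie} {a b : L (-1)} {x : L 0} (hx : L.IsPath a b x)
    (hx' : A.IsPath (h.app _ a) (h.app _ b) (h.app _ x)) :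
    h.app _ (L.diff.app (show (0 : ℤ) + -1 = -1 by norm_num) x) =
      A.diff.app (show (0 : ℤ) + -1 = -1 by norm_num) (h.app 0 x) := by
  have hpow : ∀ (n : ℕ) (y : L (-1)), h.app _ ((L.lie.ad x (-1) ^ n) y) =
      (A.lie.ad (h.app _ x) (-1) ^ n) (h.app _ y) := by
    intro n y
    induction n with
    | zero => rfl
    | succ n ih =>
      rw [pow_succ', pow_succ', Module.End.mul_apply, Module.End.mul_apply, ← ih, ad_apply, ad_apply,
        h.map_bracket]
  have h1 := CGL.Hom.map_isSum h hx
  simp only [map_smul, hpow, map_sub] at h1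
  rw [IsPath] at hx'
  simp only [map_sub] at hx'
  have := IsSum.unique h1 hx'
  rw [ad_apply, ad_apply, h.map_bracket] at this
  exact sub_left_injective this

/-- Free maps are cofibrations. -/
theorem Hom.IsFreeMap.isCofibration (hf : f.IsFreeMap) : f.IsCofibration := by
  obtain ⟨G, hG, hsu, hu, hmc, hcyc, hpth, hcell⟩ := hf
  intro A B _ _ q hq hw φ χ hφχ
  have hlift : ∀ m : ∀ y, A (G.deg y), ∃ h : CGL.Hom L.lie A.lie, h.comp f.toHom = φ.toHom ∧
      ∀ y, h.app _ (G.elt y) = m y := fun m => (hG A.lie φ.toHom m).exists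
  -- morphisms with values over `χ` on the generators lie over `χ`
  have hover : ∀ h : CGL.Hom L.lie A.lie, h.comp f.toHom = φ.toHom →
      (∀ y, q.app _ (h.app _ (G.elt y)) = χ.app _ (G.elt y)) →
      ∀ k x, q.app k (h.app k x) = χ.app k x := fun h hf hy k x =>
    hG.mem (eqLocus_closed (q.toHom.comp h) χ.toHom) (fun k x => by
      have h1 : h.app k (f.app k x) = φ.app k x := by
        change (h.comp f.toHom).app k x = _
        rw [hf]
      change q.app k (h.app k (f.app k x)) = χ.app k (f.app k x)
      rw [h1]
      exact Hom.congr_app hφχ k x) hy x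
  let Over : (∀ y, A (G.deg y)) → Prop := fun m => ∀ y, q.app _ (m y) = χ.app _ (G.elt y)
  -- On `sU` any lift is allowed and determines the value on `U`; generators of degree `-1` are
  -- lifted as Maurer-Cartan elements. Generators of `V` in degrees `≥ 0` receive provisional lifts,
  -- revised at their own stage.
  have hstart : ∃ m, Over m ∧ G.Good f φ 0 m := by
    choose σ hσ using fun s => hq _ (χ.app _ (G.su s))
    choose α hα hα' using fun a => hw.exists_isMC hq (isMC_map χ (hmc a))
    choose ζ hζ using fun z => hq _ (χ.app _ (G.cyc z))
    choose π hπ using fun p => hq _ (χ.app _ (G.pth p))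
    choose γ hγ using fun n => hq _ (χ.app _ (G.cell n))
    let m : ∀ y, A (G.deg y) := fun y => match y with
      | .u s => A.diff.app (show G.degS s + 1 + -1 = G.degS s by omega) (σ s)
      | .su s => σ s
      | .mc a => α a
      | .cyc z => ζ z
      | .pth p => π p
      | .cell n => γ n
    refine ⟨m, fun y => ?_, fun h hf hy y hyb => ?_⟩
    · cases y with
      | u s =>
        have h1 : q.app (G.degS s) (A.diff.app (show G.degS s + 1 + -1 = G.degS s by omega) (σ s)) =
            χ.app (G.degS s) (G.u s) := by rw [q.comm, hσ, ← χ.comm, hsu]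
        exact h1
      | su s => exact hσ s
      | mc a => exact hα' a
      | cyc z => exact hζ z
      | pth p => exact hπ p
      | cell n => exact hγ n
    · cases y with
      | u s =>
        refine (congrArg (h.app _) (hu s)).trans ((map_zero _).trans ?_)
        exact (A.diff.sq_zero (show G.degS s + 1 + -1 = G.degS s by omega) _ _).symm
      | su s =>
        have h1 : h.app (G.degS s) (G.u s) =
            A.diff.app (show G.degS s + 1 + -1 = G.degS s by omega) (σ s) := hy (.u s) trivial
        have h2 : ∀ {l : ℤ} (e : G.degS s + 1 + -1 = l), h.app l (L.diff.app e (G.su s)) =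
            A.diff.app e (σ s) := by
          intro l e
          obtain rfl : l = G.degS s := by omega
          rw [← h1, hsu]
        exact h2 rfl
      | mc a =>
        have h1 : h.app (-1) (G.mc a) = α a := hy (.mc a) hyb
        refine (congrArg (h.app _) (hmc a)).trans ?_
        refine Eq.trans ?_ (hα a).symm
        rw [map_smul, h.map_bracket, h1]
      | cyc z => exact absurd hyb (lt_irrefl _)
      | pth p => exact absurd hyb (lt_irrefl _)
      | cell n => exact absurd (lt_of_lt_of_le hyb (by norm_num)) (not_lt.2 (G.one_le n))
  have hstep : ∀ (n : ℕ) m, Over m → G.Good f φ n m → ∃ m', Over m' ∧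
      G.Good f φ ((n + 1 : ℕ) : ℤ) m' ∧ ∀ y, G.below n y → m' y = m y := by
    intro n m hm hgood
    obtain ⟨h, hhf, hhm⟩ := hlift m
    have hhq := hover h hhf fun y => by rw [hhm]; exact hm y
    have hcomm : ∀ {k l : ℤ} (e : k + -1 = l) {x : L k}, G.InStage f n x →
        h.app l (L.diff.app e x) = A.diff.app e (h.app k x) := fun {k l} e {x} hx =>
      Gens.InStage.comm hhf (fun y hy => by rw [hgood h hhf (fun y _ => hhm y) y hy, hhm]) e hx
    -- Values are changed only on generators of degree exactly `n`. Their boundary data lie in the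
    -- stage already built, where all morphisms with the chosen values agree with `h`.
    have hnew : ∀ y, ∃ v : A (G.deg y), q.app _ v = χ.app _ (G.elt y) ∧
        (¬ G.below n y → G.below ((n + 1 : ℕ) : ℤ) y → ∀ h' : CGL.Hom L.lie A.lie,
          h'.comp f.toHom = φ.toHom → (∀ y, G.below n y → h'.app _ (G.elt y) = m y) →
          h'.app _ (G.elt y) = v → h'.app _ (L.diff.app rfl (G.elt y)) = A.diff.app rfl v) := by
      have hagree : ∀ h' : CGL.Hom L.lie A.lie, h'.comp f.toHom = φ.toHom →
          (∀ y, G.below n y → h'.app _ (G.elt y) = m y) → ∀ {k : ℤ} {x : L k}, G.InStage f n x →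
          h'.app k x = h.app k x := fun h' hf' hy {k x} hx =>
        Gens.InStage.app_eq (hf'.trans hhf.symm) (fun y hyb => by rw [hy y hyb, hhm]) hx
      have hmcs : ∀ a, L.IsMC a → G.InStage f n a → A.IsMC (h.app _ a) := fun a ha hs => by
        rw [IsMC, ← hcomm _ hs, ha, map_smul, h.map_bracket]
      intro y
      cases y with
      | u s => exact ⟨m (.u s), hm _, fun hn => absurd trivial hn⟩
      | su s => exact ⟨m (.su s), hm _, fun hn => absurd trivial hn⟩
      | mc a =>
        refine ⟨m (.mc a), hm _, fun hn => absurd ?_ hn⟩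
        change (-1 : ℤ) < n
        omega
      | cyc z =>
        obtain ⟨v, hv, hdv⟩ := hw.exists_dPert_eq hq isMC_zero (show (0 : ℤ) + -1 = -1 by norm_num)
          (show (-1 : ℤ) + -1 = -2 by norm_num) (w := 0) (map_zero _) (x := χ.app 0 (G.cyc z)) (by
            simp only [dPert, map_zero, add_zero]
            rw [← χ.comm]
            exact (congrArg _ (hcyc z)).trans (map_zero _))
        rw [dPert, map_zero, add_zero] at hdv
        refine ⟨v, hv, fun _ _ h' _ _ _ => ?_⟩
        exact (congrArg _ (hcyc z)).trans ((map_zero _).trans hdv.symm)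
      | pth p =>
        by_cases hn : G.below ((n + 1 : ℕ) : ℤ) (.pth p) ∧ ¬ G.below n (.pth p)
        · have h0 : (n : ℤ) = 0 := by
            have := hn.2
            change ¬ ((0 : ℤ) < n) at this
            omega
          obtain ⟨a, b, ha, hb, hls⟩ := hpth p
          rw [← h0] at ha hb
          -- The end points lie in stage `0`, where `h` already commutes with the differential, so
          -- their images are Maurer-Cartan elements.
          obtain ⟨v, hv, hqv⟩ := hw.exists_isPath hq (hmcs a hls.mc_a ha) (hmcs b hls.mc_b hb)
            (x := χ.app 0 (G.pth p)) (by
              rw [hhq, hhq]; exact isPath_map χ hls.path)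
          refine ⟨v, hqv, fun _ _ h' hf' hy' hv' => ?_⟩
          have hv'' : h'.app 0 (G.pth p) = v := hv'
          subst hv''
          refine comm_of_isPath hls.path ?_
          rw [hagree h' hf' hy' ha, hagree h' hf' hy' hb]
          exact hv
        · exact ⟨m (.pth p), hm _, fun h1 h2 => absurd ⟨h2, h1⟩ hn⟩
      | cell j =>
        by_cases hn : G.below ((n + 1 : ℕ) : ℤ) (.cell j) ∧ ¬ G.below n (.cell j)
        · have h0 : (n : ℤ) = G.degN j := by
            have h1 := hn.1
            have h2 := hn.2
            change G.degN j < ((n + 1 : ℕ) : ℤ) at h1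
            change ¬ (G.degN j < n) at h2
            omega
          obtain ⟨a, hamc, ha, hda⟩ := hcell j
          rw [← h0] at ha
          replace hda : G.InStage f n (L.dPert a rfl (G.cell j)) := by rw [h0]; exact hda
          have hA := hmcs a hamc ha
          -- `d_a` of the cell lies in the stage, so its image under `h` is closed for the perturbed
          -- differential at `h a`; over `B` it is bounded by the value of `χ` on the cell.
          obtain ⟨v, hv, hdv⟩ := hw.exists_dPert_eq hq hA
            (show G.degN j + -1 = G.degN j + -1 from rfl) rfl
            (w := h.app _ (L.dPert a rfl (G.cell j))) (by
              rw [dPert, LinearMap.add_apply, ← hcomm _ hda, ← h.map_bracket, ← map_add,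
                ← LinearMap.add_apply]
              exact (congrArg _ (dPert_sq hamc _ _ _)).trans (map_zero _))
            (x := χ.app _ (G.cell j)) (by rw [hhq, hhq, dPert_map])
          refine ⟨v, hv, fun _ _ h' hf' hy' hv' => ?_⟩
          have hv'' : h'.app (G.degN j) (G.cell j) = v := hv'
          subst hv''
          have h1 := hagree h' hf' hy' hda
          rw [← hdv, ← hagree h' hf' hy' ha, dPert, dPert, LinearMap.add_apply,
            LinearMap.add_apply, map_add, h'.map_bracket] at h1
          have h2 := add_right_cancel h1
          exact h2
        · exact ⟨m (.cell j), hm _, fun h1 h2 => absurd ⟨h2, h1⟩ hn⟩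
    choose v hvq hv using hnew
    classical
    refine ⟨fun y => if G.below n y then m y else v y, fun y => ?_, fun h' hf' hy' y hy => ?_,
      fun y hy => if_pos hy⟩
    · dsimp only
      split_ifs
      exacts [hm y, hvq y]
    · have hy'' : ∀ y, G.below n y → h'.app _ (G.elt y) = m y := fun y hyn => by
        rw [hy' y (Gens.below_mono (by omega) hyn)]
        exact if_pos hyn
      by_cases hyn : G.below n y
      · beta_reduce
        rw [if_pos hyn]
        exact hgood h' hf' hy'' y hyn
      · beta_reduce
        rw [if_neg hyn]
        refine hv y hyn hy h' hf' hy'' ?_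
        rw [hy' y hy]
        exact if_neg hyn
  obtain ⟨m₀, hm₀, hg₀⟩ := hstart
  choose! next hnext₁ hnext₂ hnext₃ using hstep
  -- The value on `y` no longer changes once `y` lies below the stage, so `M (N y) y` is its final
  -- value.
  let M : ℕ → ∀ y, A (G.deg y) := fun n => Nat.rec m₀ next n
  have hM : ∀ n : ℕ, Over (M n) ∧ G.Good f φ n (M n) := by
    intro n
    induction n with
    | zero => exact ⟨hm₀, hg₀⟩
    | succ n ih => exact ⟨hnext₁ n _ ih.1 ih.2, hnext₂ n _ ih.1 ih.2⟩
  have hMs : ∀ n k : ℕ, ∀ y, G.below n y → M (n + k) y = M n y := by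
    intro n k y hy
    induction k with
    | zero => rfl
    | succ k ih =>
      rw [← ih]
      exact hnext₃ (n + k) _ (hM _).1 (hM _).2 y (Gens.below_mono (by omega) hy)
  choose N hN using G.exists_below
  have hMN : ∀ n : ℕ, ∀ y, G.below n y → M (N y) y = M n y := fun n y hy => by
    rw [← hMs _ n y (hN y), ← hMs n (N y) y hy, add_comm]
  obtain ⟨h, hhf, hhm⟩ := hlift fun y => M (N y) y
  have hgen : ∀ y, h.app _ (L.diff.app rfl (G.elt y)) = A.diff.app rfl (h.app _ (G.elt y)) :=
    fun y => by
      rw [hhm]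
      exact (hM (N y)).2 h hhf (fun y' hy' => by rw [hhm, hMN _ y' hy']) y (hN y)
  have hf' : ∀ k y, h.app k (f.app k y) = φ.app k y := fun k y => by
    change (h.comp f.toHom).app k y = _
    rw [hhf]
  refine ⟨⟨h, fun {i j} e x => ?_⟩, Hom.ext_app hf', Hom.ext_app (hover h hhf fun y => by
    rw [hhm]; exact (hM _).1 y)⟩
  subst e
  refine hG.mem (commLocus_closed h) (fun k y => ?_) hgen x
  rw [LinearMap.mem_eqLocus, LinearMap.comp_apply, LinearMap.comp_apply, ← f.comm, hf', hf', φ.comm]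

end CDGL

/-! ### The path object of a trivial fibration over the fibre product -/

namespace CDGL

variable {A B : CDGL.{u}} {q : Hom A B}

namespace pathObj

lemma pr₀_ends {k : ℤ} (x : pathObj q k) : fiberProd.pr₀.app k (ends.app k x) = ev₀.app k x := rfl

lemma pr₁_ends {k : ℤ} (x : pathObj q k) : fiberProd.pr₁.app k (ends.app k x) = ev₁.app k x := rfl

lemma ends_fibration : (ends : Hom (pathObj q) (fiberProd q)).IsFibration := fun k w =>
  ⟨line (fiberProd.pr₀.app k w) (fiberProd.pr₁.app k w - fiberProd.pr₀.app k w)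
    (by rw [map_sub, fiberProd.map_pr, sub_self]), fiberProd.ext
      (by rw [pr₀_ends, ev₀_line]) (by rw [pr₁_ends, ev₁_line, add_sub_cancel])⟩

/-- The contraction at `t = 0` bounds `ω` by some `β` with `ev₀ β = 0`. Then `ev₁ β` is a cycle in
the kernel of `q`, bounded there by some `κ`, and subtracting the boundary of `t κ` makes both ends
vanish. -/
lemma ends_acyclicAt (hq : q.IsFibration) (hw : q.IsWeakEquiv) {α : pathObj q (-1)}
    (hα : (pathObj q).IsMC α) : ends.AcyclicAt α := by
  intro i j k h h' ω hω hdω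
  have h₀ : ev₀.app j ω = 0 := by rw [← pr₀_ends, hω, map_zero]
  have h₁ : ev₁.app j ω = 0 := by rw [← pr₁_ends, hω, map_zero]
  obtain ⟨β, hβ, hdβ⟩ := contraction₀.acyclicAt α hα h h' ω h₀ hdω
  have hα₁ := isMC_map ev₁ hα
  obtain ⟨κ, hκ, hdκ⟩ := Hom.IsQuasiIsoAt.acyclicAt hq hα₁ (hw.quasiIso _ hα₁)
    (show i + 1 + -1 = i by omega) h (ev₁.app i β) (by rw [map_ev₁, hβ, map_zero])
    (by rw [← dPert_map, hdβ, h₁])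
  refine ⟨β - (pathObj q).dPert α (show i + 1 + -1 = i by omega) (line 0 κ hκ),
    fiberProd.ext ?_ ?_, ?_⟩
  · rw [pr₀_ends, map_sub, hβ, dPert_map, ev₀_line, map_zero, map_zero, sub_zero]
  · rw [pr₁_ends, map_sub, dPert_map, ev₁_line, zero_add, hdκ, sub_self, map_zero]
  · rw [map_sub, dPert_sq hα, hdβ, sub_zero]

/-- The path object of a trivial fibration maps to the fibre product by a weak equivalence. -/
lemma ends_isWeakEquiv (hq : q.IsFibration) (hw : q.IsWeakEquiv) :
    (ends : Hom (pathObj q) (fiberProd q)).IsWeakEquiv where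
  mc_injective α α' hα hα' := by
    rintro ⟨x, hx⟩
    obtain ⟨y, hy, -⟩ := contraction₀.exists_isPath ev₀_fibration hα hα'
      (isPath_map fiberProd.pr₀ hx)
    exact ⟨y, hy⟩
  mc_surjective w hw' := by
    obtain ⟨h₀, h₁⟩ := fiberProd.isMC_iff.1 hw'
    -- The two components have the same image in `B`; the zero path between these images lifts to a
    -- path `k` that vanishes in `B`. Acting with `t k` on the constant form at the first component
    -- interpolates between the two.
    obtain ⟨k, hk, hqk⟩ := hw.exists_isPath hq h₁ h₀ (x := 0) (by
      rw [isPath_iff, gauge_zero, fiberProd.map_pr])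
    rw [isPath_iff] at hk
    refine ⟨(pathObj q).gauge (line 0 k hqk) (const.app _ (fiberProd.pr₀.app _ w)),
      isMC_gauge _ (isMC_map const h₀), 0, ?_⟩
    rw [isPath_iff, gauge_zero]
    refine fiberProd.ext ?_ ?_
    · rw [pr₀_ends, map_gauge, ev₀_line, gauge_zero, const_app, ev₀_line]
    · rw [pr₁_ends, map_gauge, ev₁_line, zero_add, const_app, ev₁_line, add_zero, hk]
  quasiIso _ hα := Hom.AcyclicAt.isQuasiIsoAt ends_fibration hα (ends_acyclicAt hq hw hα)

lemma hNonneg (hA : A.HNonneg) : (pathObj q).HNonneg :=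
  Hom.IsQuasiIsoAt.hNonneg (contraction₀.isQuasiIsoAt ev₀_fibration 0 isMC_zero) hA

end pathObj

namespace fiberProd

lemma pr₀_fibration : (pr₀ : Hom (fiberProd q) A).IsFibration := fun _ x => ⟨mk x x rfl, rfl⟩

/-- The kernel of the first projection is the kernel of `q`, which is acyclic. -/
lemma hNonneg (hq : q.IsFibration) (hw : q.IsWeakEquiv) (hA : A.HNonneg) :
    (fiberProd q).HNonneg := by
  refine Hom.IsQuasiIsoAt.hNonneg (p := pr₀)
    (Hom.AcyclicAt.isQuasiIsoAt pr₀_fibration isMC_zero ?_) hA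
  intro i j k h h' x hx hdx
  obtain ⟨z, hz, hdz⟩ := Hom.IsQuasiIsoAt.acyclicAt hq isMC_zero (hw.quasiIso 0 isMC_zero) h h'
    (pr₁.app j x) (by rw [← map_pr, hx, map_zero]) (by
      have := congrArg (pr₁.app k) hdx
      rwa [dPert_map, map_zero, map_zero] at this)
  refine ⟨mk 0 z (by rw [hz, map_zero]), rfl, ext ?_ ?_⟩
  · rw [dPert_map, pr₀_mk, map_zero, hx]
  · rw [dPert_map, pr₁_mk, map_zero, hdz]

end fiberProd

/-- A retract of a cofibrant algebra is cofibrant. -/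
lemma fromZero_isCofibration_of_retract {L M : CDGL.{u}} (f : Hom L M) (g : Hom M L)
    (hfg : ∀ k x, f.app k (g.app k x) = x) (hL : L.fromZero.IsCofibration) :
    M.fromZero.IsCofibration := by
  intro A B hA hB q hq hw φ χ h
  obtain ⟨Φ, -, hΦ⟩ := hL A B hA hB q hq hw A.fromZero (χ.comp f)
    (Hom.ext_app fun k x => by
      change q.app k 0 = χ.app k (f.app k 0)
      simp)
  refine ⟨Φ.comp g, Hom.ext_app fun k x => ?_, Hom.ext_app fun k x => ?_⟩
  · obtain rfl : x = 0 := rfl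
    rw [map_zero, map_zero]
  · exact (Hom.congr_app hΦ k (g.app k x)).trans (congrArg _ (hfg k x))

end CDGL

/-! ### Lifting both ends of the cylinder against trivial fibrations -/

namespace Cylinder

variable {X : Type u} {δ : X → ℤ} {d : Differential (free δ)}

open CDGL CDGL.pathObj

/-- The pair `(incl, e^θ ∘ incl)` has the left lifting property with respect to trivial fibrations,
if `𝕃̂(V)` is cofibrant. -/
theorem exists_lift (hd : (baseAlg d).fromZero.IsCofibration) {A B : CDGL.{u}} (hA : A.HNonneg)
    {q : CDGL.Hom A B} (hq : q.IsFibration) (hw : q.IsWeakEquiv)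
    (φ₀ φ₁ : CDGL.Hom (baseAlg d) A) (χ : CDGL.Hom (model d) B)
    (h₀ : ∀ k (z : free δ k), q.app k (φ₀.app k z) = χ.app k (incl.app k z))
    (h₁ : ∀ k (z : free δ k), q.app k (φ₁.app k z) = χ.app k ((expHom d).app k (incl.app k z))) :
    ∃ Φ : CDGL.Hom (model d) A, (∀ k (z : free δ k), Φ.app k (incl.app k z) = φ₀.app k z) ∧
      (∀ k (z : free δ k), Φ.app k ((expHom d).app k (incl.app k z)) = φ₁.app k z) ∧
      ∀ k (z : free (deg δ) k), q.app k (Φ.app k z) = χ.app k z := by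
  choose η hη using fun x => hq (δ x + 1) (χ.app _ (gS x))
  -- `Φ₀` is correct on `𝕃̂(V)` and over `B`; along `e^θ` it agrees with `φ₁` only after applying
  -- `q`.
  set Φ₀ := desc φ₀ η with hΦ₀
  have hqΦ₀ : ∀ k (z : free (deg δ) k), q.app k (Φ₀.app k z) = χ.app k z := fun k z =>
    model_hom_ext (f := q.comp Φ₀) (g := χ)
      (fun x => by
        refine (congrArg (q.app _) (desc_gB φ₀ η x)).trans ((h₀ _ _).trans ?_)
        rw [incl_gen])
      (fun x => (congrArg (q.app _) (desc_gS φ₀ η x)).trans (hη x)) z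
  have hpair : ∀ k (z : free δ k), q.app k ((Φ₀.comp ((expHom d).comp (inclHom d))).app k z) =
      q.app k (φ₁.app k z) := fun k z => (hqΦ₀ k _).trans (h₁ k z).symm
  -- Cofibrancy of `𝕃̂(V)` lifts this pair through the path object to a homotopy `H` that is
  -- constant in `B`.
  obtain ⟨H, -, hH⟩ := hd (pathObj q) (fiberProd q) (pathObj.hNonneg hA)
    (fiberProd.hNonneg hq hw hA) ends ends_fibration (ends_isWeakEquiv hq hw) (fromZero _)
    (fiberProd.pair (Φ₀.comp ((expHom d).comp (inclHom d))) φ₁ hpair)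
    (CDGL.Hom.ext_app fun k x => by
      obtain rfl : x = 0 := rfl
      rw [map_zero, map_zero])
  have hH₀ : ∀ k (z : free δ k), ev₀.app k (H.app k z) =
      Φ₀.app k ((expHom d).app k (incl.app k z)) := fun k z =>
    congrArg (fiberProd.pr₀.app k) (CDGL.Hom.congr_app hH k z)
  have hH₁ : ∀ k (z : free δ k), ev₁.app k (H.app k z) = φ₁.app k z := fun k z =>
    congrArg (fiberProd.pr₁.app k) (CDGL.Hom.congr_app hH k z)
  -- The deformation starts at `Φ₀`, stays constant on `𝕃̂(V)` and follows `H` along `e^θ`; at `t =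
  -- 1` it has the required values.
  obtain ⟨Φ, hΦ₀', hΦ₁, hΦ⟩ := homotopy_extension ev₀_fibration contraction₀ Φ₀ (const.comp φ₀) H
    (fun k z => (desc_incl φ₀ η z).symm) hH₀
  refine ⟨ev₁.comp Φ, fun k z => ?_, fun k z => ?_, fun k z => ?_⟩
  · refine (congrArg (ev₁.app k) (hΦ₀' k z)).trans ?_
    exact (ev₁_line (φ₀.app k z) 0 (map_zero _)).trans (add_zero _)
  · exact (congrArg (ev₁.app k) (hΦ₁ k z)).trans (hH₁ k z)
  · exact (map_ev₁ _).trans ((congrArg (q.app k) (hΦ k z)).trans (hqΦ₀ k z))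

end Cylinder

/-! ### Transport to the cylinder, free maps and the coproduct -/

namespace CDGL

/-- Contractions can be transported along isomorphisms. -/
def Contraction.transport {C C' L L' : CDGL.{u}} {p' : Hom C' L'} (c : Contraction p') {p : Hom C L}
    (a : Hom C C') (b : Hom C' C) (hab : ∀ k x, a.app k (b.app k x) = x)
    (hba : ∀ k x, b.app k (a.app k x) = x)
    (hp : ∀ k x, p.app k x = 0 ↔ p'.app k (a.app k x) = 0) : Contraction p where
  h {i j} e := (b.app j).comp ((c.h e).comp (a.app i))
  map_fil n _ _ e x hx := b.map_fil n _ (c.map_fil n e _ (a.map_fil n x hx))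
  map_ker e x hx := by
    rw [hp] at *
    rw [LinearMap.comp_apply, LinearMap.comp_apply, hab]
    exact c.map_ker e _ hx
  homotopy e e' f f' x hx := by
    rw [LinearMap.comp_apply, LinearMap.comp_apply, LinearMap.comp_apply, LinearMap.comp_apply,
      ← b.comm, a.comm, ← map_add, c.homotopy e e' f f' _ ((hp _ _).1 hx), hba]

end CDGL

namespace Cylinder

variable {X : Type u} {δ : X → ℤ} {d : Differential (free δ)}

/-! ### Free maps -/

/-- The generators `x'` and `sx'` as contractible generators of an algebra isomorphic to
`𝕃̂(V ⊕ V' ⊕ sV')`. -/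
noncomputable def contractibleGens {C : CDGL.{u}} (K : CDGL.Hom (model d) C) : CDGL.Gens C where
  S := X
  A := PEmpty
  Z := PEmpty
  P := PEmpty
  N := PEmpty
  degS := δ
  degN := PEmpty.elim
  one_le n := n.elim
  u x := K.app _ (gH x)
  su x := K.app _ (gS x)
  mc n := n.elim
  cyc n := n.elim
  pth n := n.elim
  cell n := n.elim

/-- `K` and `g` are isomorphisms, so this is freeness of the model on `V`, `V'` and `sV'`. A general
`K` covers both ends of the cylinder: `ψ⁻¹` gives `ι₀` and `ψ⁻¹ ∘ e^θ` gives `ι₁`. -/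
lemma isFreeExtension_incl {L C : CDGL.{u}} (g : CDGL.Hom L (baseAlg d))
    (e : Iso L.lie (free δ)) (he : e.hom = g.toHom) (K : CDGL.Hom (model d) C)
    (κ : Iso (free (deg δ)) C.lie) (hκ : κ.hom = K.toHom) :
    IsFreeExtension (K.comp ((inclHom d).comp g)).toHom (contractibleGens K).deg
      (contractibleGens K).elt := by
  intro M φ m
  have hK : ∀ k x, κ.inv.app k (K.app k x) = x := fun k x => by
    have := κ.inv_hom k x
    rwa [hκ] at this
  have hK' : ∀ k x, K.app k (κ.inv.app k x) = x := fun k x => by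
    have := κ.hom_inv k x
    rwa [hκ] at this
  have hg : ∀ k x, e.inv.app k (g.app k x) = x := fun k x => by
    have := e.inv_hom k x
    rwa [he] at this
  have hg' : ∀ k x, g.app k (e.inv.app k x) = x := fun k x => by
    have := e.hom_inv k x
    rwa [he] at this
  let h : Hom (free (deg δ)) M := glue (fun x => φ.app _ (e.inv.app _ (free.gen x rfl)))
    (fun x => m (.u x)) (fun x => m (.su x))
  have hB : ∀ x, h.app _ (gB x) = φ.app _ (e.inv.app _ (free.gen x rfl)) := glue_gB _ _ _
  have hH : ∀ x, h.app _ (gH x) = m (.u x) := glue_gH _ _ _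
  have hS : ∀ x, h.app _ (gS x) = m (.su x) := glue_gS _ _ _
  have hincl : ∀ k x, h.app k (incl.app k x) = φ.app k (e.inv.app k x) := fun k x =>
    free.hom_ext (h.comp incl) (φ.comp e.inv) (fun x => by
      change h.app _ (incl.app _ (free.gen x rfl)) = _
      rw [incl_gen, hB]; rfl) x
  refine ⟨h.comp κ.inv, ⟨Hom.ext_app fun k x => ?_, fun y => ?_⟩, ?_⟩
  · change h.app k (κ.inv.app k (K.app k (incl.app k (g.app k x)))) = _
    rw [hK, hincl, hg]
  · change h.app _ (κ.inv.app _ ((contractibleGens K).elt y)) = m y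
    cases y with
    | u x => exact (congrArg (h.app _) (hK _ (gH x))).trans (hH x)
    | su x => exact (congrArg (h.app _) (hK _ (gS x))).trans (hS x)
    | mc n => exact n.elim
    | cyc n => exact n.elim
    | pth n => exact n.elim
    | cell n => exact n.elim
  · rintro h' ⟨h₁, h₂⟩
    have key : ∀ k (x : free (deg δ) k), h'.app k (K.app k x) = h.app k x := fun k x =>
      hom_ext (h'.comp K.toHom) h (fun x => by
        change h'.app _ (K.app _ (gB x)) = _
        rw [hB, ← h₁]
        change _ = h'.app _ (K.app _ (incl.app _ (g.app _ (e.inv.app _ (free.gen x rfl)))))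
        rw [hg', incl_gen])
        (fun x => (h₂ (.u x)).trans (hH x).symm) (fun x => (h₂ (.su x)).trans (hS x).symm) x
    refine Hom.ext_app fun k x => ?_
    change _ = h.app k (κ.inv.app k x)
    rw [← key, hK' k x]

/-- The inclusion `𝕃̂(V) → 𝕃̂(V ⊕ V' ⊕ sV')` is a free map, up to isomorphisms. -/
lemma isFreeMap_incl {L C : CDGL.{u}} (g : CDGL.Hom L (baseAlg d))
    (e : Iso L.lie (free δ)) (he : e.hom = g.toHom) (K : CDGL.Hom (model d) C)
    (κ : Iso (free (deg δ)) C.lie) (hκ : κ.hom = K.toHom) :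
    (K.comp ((inclHom d).comp g)).IsFreeMap := by
  refine ⟨contractibleGens K, isFreeExtension_incl g e he K κ hκ, fun x => ?_, fun x => ?_,
    fun n => n.elim, fun n => n.elim, fun n => n.elim, fun n => n.elim⟩
  · have h : δ x + 1 + -1 = δ x := by omega
    exact (K.comm h (gS x)).symm.trans (congrArg (K.app _) (diff_gS_eq d x h))
  · exact (K.comm rfl (gH x)).symm.trans ((congrArg (K.app _) (diff_gH d x rfl)).trans (map_zero _))

/-! ### The coproduct -/

section coproduct

variable (δ) in
/-- The degrees of a basis of `V ⊕ V`. -/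
def doubleDeg : X ⊕ X → ℤ := Sum.elim δ δ

/-- The first inclusion. -/
noncomputable def inlLie : Hom (free δ) (free (doubleDeg δ)) :=
  free.lift fun x => free.gen (Sum.inl x) rfl

/-- The second inclusion. -/
noncomputable def inrLie : Hom (free δ) (free (doubleDeg δ)) :=
  free.lift fun x => free.gen (Sum.inr x) rfl

lemma inlLie_gen (x : X) : (inlLie (δ := δ)).app _ (free.gen x rfl) = free.gen (Sum.inl x) rfl :=
  free.lift_gen _ x

lemma inrLie_gen (x : X) : (inrLie (δ := δ)).app _ (free.gen x rfl) = free.gen (Sum.inr x) rfl :=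
  free.lift_gen _ x

variable (d)

/-- The values of the differential on the generators. -/
noncomputable def doubleGen : ∀ y, free (doubleDeg δ) (doubleDeg δ y + -1)
  | .inl x => inlLie.app _ (d.app rfl (free.gen x rfl))
  | .inr x => inrLie.app _ (d.app rfl (free.gen x rfl))

lemma der_inlLie {i j : ℤ} (h : i + -1 = j) (x : free δ i) :
    inlLie.app j (d.app h x) = (free.der (-1) (doubleGen d)).app h (inlLie.app i x) :=
  free.comm_der inlLie d.toDer (free.der (-1) (doubleGen d)) (fun x => by
    rw [inlLie_gen]; exact (free.der_gen (-1) (doubleGen d) (.inl x)).symm) h x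

lemma der_inrLie {i j : ℤ} (h : i + -1 = j) (x : free δ i) :
    inrLie.app j (d.app h x) = (free.der (-1) (doubleGen d)).app h (inrLie.app i x) :=
  free.comm_der inrLie d.toDer (free.der (-1) (doubleGen d)) (fun x => by
    rw [inrLie_gen]; exact (free.der_gen (-1) (doubleGen d) (.inr x)).symm) h x

/-- The coproduct of two copies of `(𝕃̂(V), d)`. -/
noncomputable def double : CDGL.{u} where
  lie := free (doubleDeg δ)
  diff := free.differential (doubleGen d) fun
    | .inl x => by
      change (free.der (-1) (doubleGen d)).app rfl (inlLie.app _ (d.app rfl (free.gen x rfl))) = 0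
      rw [← der_inlLie, d.sq_zero, map_zero]
    | .inr x => by
      change (free.der (-1) (doubleGen d)).app rfl (inrLie.app _ (d.app rfl (free.gen x rfl))) = 0
      rw [← der_inrLie, d.sq_zero, map_zero]

/-- The first inclusion. -/
noncomputable def inlHom : CDGL.Hom (baseAlg d) (double d) := ⟨inlLie, der_inlLie d⟩

/-- The second inclusion. -/
noncomputable def inrHom : CDGL.Hom (baseAlg d) (double d) := ⟨inrLie, der_inrLie d⟩

variable {d}

lemma double_hom_ext {M : CDGL.{u}} {f g : CDGL.Hom (double d) M}
    (h₀ : ∀ k (x : free δ k), f.app k (inlLie.app k x) = g.app k (inlLie.app k x))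
    (h₁ : ∀ k (x : free δ k), f.app k (inrLie.app k x) = g.app k (inrLie.app k x)) : f = g := by
  refine CDGL.Hom.ext_app fun k x => free.hom_ext f.toHom g.toHom (fun y => ?_) x
  cases y with
  | inl x =>
    have := h₀ _ (free.gen x rfl)
    rw [inlLie_gen] at this
    exact this
  | inr x =>
    have := h₁ _ (free.gen x rfl)
    rw [inrLie_gen] at this
    exact this

/-- The values of `doubleDescLie` on the generators. -/
noncomputable def doubleDescGen {M : CDGL.{u}} (f g : CDGL.Hom (baseAlg d) M) :
    ∀ y, M (doubleDeg δ y)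
  | .inl x => f.app (δ x) (free.gen x rfl)
  | .inr x => g.app (δ x) (free.gen x rfl)

/-- The Lie algebra morphism underlying `doubleDesc`. -/
noncomputable def doubleDescLie {M : CDGL.{u}} (f g : CDGL.Hom (baseAlg d) M) :
    Hom (free (doubleDeg δ)) M.lie := free.lift (doubleDescGen f g)

lemma doubleDescLie_inl {M : CDGL.{u}} (f g : CDGL.Hom (baseAlg d) M) {k : ℤ} (x : free δ k) :
    (doubleDescLie f g).app k (inlLie.app k x) = f.app k x :=
  free.hom_ext ((doubleDescLie f g).comp inlLie) f.toHom (fun x => by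
    change (doubleDescLie f g).app _ (inlLie.app _ (free.gen x rfl)) = _
    rw [inlLie_gen]
    exact free.lift_gen (doubleDescGen f g) (.inl x)) x

lemma doubleDescLie_inr {M : CDGL.{u}} (f g : CDGL.Hom (baseAlg d) M) {k : ℤ} (x : free δ k) :
    (doubleDescLie f g).app k (inrLie.app k x) = g.app k x :=
  free.hom_ext ((doubleDescLie f g).comp inrLie) g.toHom (fun x => by
    change (doubleDescLie f g).app _ (inrLie.app _ (free.gen x rfl)) = _
    rw [inrLie_gen]
    exact free.lift_gen (doubleDescGen f g) (.inr x)) x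

/-- The morphism with given restrictions to both copies. -/
noncomputable def doubleDesc {M : CDGL.{u}} (f g : CDGL.Hom (baseAlg d) M) :
    CDGL.Hom (double d) M where
  toHom := doubleDescLie f g
  comm h x := by
    refine free.comm_der (doubleDescLie f g) (double d).diff.toDer M.diff.toDer (fun y => ?_) h x
    refine (congrArg _ (free.der_gen (-1) (doubleGen d) y)).trans ?_
    cases y with
    | inl x =>
      refine (doubleDescLie_inl f g _).trans ((f.comm rfl _).trans ?_)
      exact congrArg _ (free.lift_gen (doubleDescGen f g) (.inl x)).symm
    | inr x =>
      refine (doubleDescLie_inr f g _).trans ((g.comm rfl _).trans ?_)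
      exact congrArg _ (free.lift_gen (doubleDescGen f g) (.inr x)).symm

/-- Morphisms from the double are prescribed independently on the two blocks of generators, and `g`,
`g'` identify `L` with the free algebra on each block. -/
lemma isCoproduct_double {L : CDGL.{u}} (g : CDGL.Hom L (baseAlg d)) (g' : CDGL.Hom (baseAlg d) L)
    (h : ∀ k x, g.app k (g'.app k x) = x) (h' : ∀ k x, g'.app k (g.app k x) = x) :
    CDGL.IsCoproduct ((inlHom d).comp g) ((inrHom d).comp g) := by
  intro M f₀ f₁
  refine ⟨doubleDesc (f₀.comp g') (f₁.comp g'), ⟨CDGL.Hom.ext_app fun k x => ?_,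
    CDGL.Hom.ext_app fun k x => ?_⟩, ?_⟩
  · refine (doubleDescLie_inl _ _ _).trans ?_
    change f₀.app k (g'.app k (g.app k x)) = _
    rw [h']
  · refine (doubleDescLie_inr _ _ _).trans ?_
    change f₁.app k (g'.app k (g.app k x)) = _
    rw [h']
  · rintro F ⟨hF₀, hF₁⟩
    refine double_hom_ext (fun k x => ?_) fun k x => ?_
    · refine Eq.trans ?_ (doubleDescLie_inl _ _ x).symm
      change _ = f₀.app k (g'.app k x)
      rw [← hF₀]
      change _ = F.app k (inlLie.app k (g.app k (g'.app k x)))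
      rw [h]
    · refine Eq.trans ?_ (doubleDescLie_inr _ _ x).symm
      change _ = f₁.app k (g'.app k x)
      rw [← hF₁]
      change _ = F.app k (inrLie.app k (g.app k (g'.app k x)))
      rw [h]

end coproduct

end Cylinder

/-- An isomorphism is compatible with the transported differential. -/
def CGL.Iso.pullHom {M : CGL.{u}} {L : CDGL.{u}} (e : Iso M L.lie) :
    CDGL.Hom ⟨M, e.pull L.diff⟩ L where
  toHom := e.hom
  comm _ _ := e.hom_inv _ _

/-- The inverse of an isomorphism is compatible with the transported differential. -/
def CGL.Iso.pullInv {M : CGL.{u}} {L : CDGL.{u}} (e : Iso M L.lie) :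
    CDGL.Hom L ⟨M, e.pull L.diff⟩ where
  toHom := e.inv
  comm {_ j} h x := by
    change _ = e.inv.app j (L.diff.app h (e.hom.app _ (e.inv.app _ x)))
    rw [e.hom_inv]

/-- The composition of isomorphisms. -/
def CGL.Iso.trans {L M N : CGL.{u}} (e : Iso L M) (f : Iso M N) : Iso L N where
  hom := f.hom.comp e.hom
  inv := e.inv.comp f.inv
  hom_inv k x := by
    change f.hom.app k (e.hom.app k (e.inv.app k (f.inv.app k x))) = x
    rw [e.hom_inv, f.hom_inv]
  inv_hom k x := by
    change e.inv.app k (f.inv.app k (f.hom.app k (e.hom.app k x))) = x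
    rw [f.inv_hom, e.inv_hom]

/-! ### The cylinder object -/

namespace Cylinder

variable {X : Type u} {δ : X → ℤ} {d : Differential (free δ)}

/-- The inclusion of two copies into the cylinder is a cofibration. -/
lemma isCofibration_ends (hd : (baseAlg d).fromZero.IsCofibration) {C : CDGL.{u}}
    (K : CDGL.Hom (model d) C) (K' : CDGL.Hom C (model d)) (hK : ∀ k x, K.app k (K'.app k x) = x)
    (hK' : ∀ k x, K'.app k (K.app k x) = x) :
    (doubleDesc (K.comp (inclHom d)) (K.comp ((expHom d).comp (inclHom d)))).IsCofibration := by
  intro A B hA hB q hq hw φ χ h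
  obtain ⟨Φ, h₀, h₁, hΦ⟩ := exists_lift hd hA hq hw (φ.comp (inlHom d)) (φ.comp (inrHom d))
    (χ.comp K) (fun k z => by
      refine (CDGL.Hom.congr_app h k (inlLie.app k z)).trans ?_
      exact congrArg (χ.app k) (doubleDescLie_inl _ _ z))
    (fun k z => by
      refine (CDGL.Hom.congr_app h k (inrLie.app k z)).trans ?_
      exact congrArg (χ.app k) (doubleDescLie_inr _ _ z))
  refine ⟨Φ.comp K', double_hom_ext (fun k x => ?_) (fun k x => ?_), CDGL.Hom.ext_app fun k x => ?_⟩
  · refine (congrArg (fun y => Φ.app k (K'.app k y)) (doubleDescLie_inl _ _ x)).trans ?_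
    refine (congrArg (Φ.app k) (hK' k _)).trans ?_
    exact h₀ k x
  · refine (congrArg (fun y => Φ.app k (K'.app k y)) (doubleDescLie_inr _ _ x)).trans ?_
    refine (congrArg (Φ.app k) (hK' k _)).trans ?_
    exact h₁ k x
  · refine (hΦ k (K'.app k x)).trans ?_
    exact congrArg (χ.app k) (hK k x)

end Cylinder

open Cylinder

theorem mainTheorem3 {X : Type u} (δ : X → ℤ) (L : CDGL.{u})
    (e : CGL.Iso L.lie (CGL.free δ)) (hL : L.HNonneg) (hind : L.IsInductive) :
    ∃ ψ : CGL.Iso (CGL.free (Cylinder.deg δ)) (CGL.free (Cylinder.deg δ)),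
      ψ.hom = Cylinder.psi (e.symm.pull L.diff) ∧
      ∃ (ι₀ ι₁ : CDGL.Hom L (Cylinder.cyl (e.symm.pull L.diff) ψ))
        (p : CDGL.Hom (Cylinder.cyl (e.symm.pull L.diff) ψ) L),
        (∀ x, ι₀.app (δ x) (e.inv.app (δ x) (CGL.free.gen x rfl)) =
          CGL.free.gen (Cylinder.Idx.base x) rfl) ∧
        (∀ x, ι₁.app (δ x) (e.inv.app (δ x) (CGL.free.gen x rfl)) =
          CGL.free.gen (Cylinder.Idx.hat x) rfl) ∧
        (∀ x, p.app (δ x) (CGL.free.gen (Cylinder.Idx.base x) rfl) =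
          e.inv.app (δ x) (CGL.free.gen x rfl)) ∧
        (∀ x, p.app (δ x) (CGL.free.gen (Cylinder.Idx.hat x) rfl) =
          e.inv.app (δ x) (CGL.free.gen x rfl)) ∧
        (∀ x, p.app (δ x + 1) (CGL.free.gen (Cylinder.Idx.bar x) rfl) = 0) ∧
        ι₀.IsFreeMap ∧ ι₁.IsFreeMap ∧ ι₀.IsCofibration ∧ ι₁.IsCofibration ∧
        CDGL.IsCylinderObject ι₀ ι₁ p := by
  set d : Differential (free δ) := e.symm.pull L.diff
  obtain ⟨ψ, hψ⟩ := exists_psiIso d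
  obtain ⟨ε, hε⟩ := exists_expIso d
  let g : CDGL.Hom L (baseAlg d) := e.symm.pullInv
  let g' : CDGL.Hom (baseAlg d) L := e.symm.pullHom
  let K : CDGL.Hom (model d) (cyl d ψ) := CGL.Iso.pullInv (L := model d) ψ
  let K' : CDGL.Hom (cyl d ψ) (model d) := CGL.Iso.pullHom (L := model d) ψ
  have hgg' : ∀ k x, g.app k (g'.app k x) = x := e.hom_inv
  have hg'g : ∀ k x, g'.app k (g.app k x) = x := e.inv_hom
  have hKK' : ∀ k x, K.app k (K'.app k x) = x := ψ.inv_hom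
  have hK'K : ∀ k x, K'.app k (K.app k x) = x := ψ.hom_inv
  have hK'ψ : ∀ k (x : free (deg δ) k), K'.app k x = (psi d).app k x := fun k x => by
    rw [← hψ]; rfl
  have hK'B : ∀ x, K'.app _ (gB x) = gB x := fun x => (hK'ψ _ _).trans (psi_gB d x)
  have hK'H : ∀ x, K'.app _ (gH x) = (expHom d).app _ (gB x) := fun x =>
    (hK'ψ _ _).trans (psi_gH d x)
  have hK'S : ∀ x, K'.app _ (gS x) = gS x := fun x => (hK'ψ _ _).trans (psi_gS d x)
  -- Seen through `ψ`, the cylinder is the model, with ends `incl` and `e^θ ∘ incl` and with its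
  -- projection to `𝕃̂(V)`.
  let ι₀ : CDGL.Hom L (cyl d ψ) := K.comp ((inclHom d).comp g)
  let ι₁ : CDGL.Hom L (cyl d ψ) := (K.comp (expHom d)).comp ((inclHom d).comp g)
  let p : CDGL.Hom (cyl d ψ) L := g'.comp ((proj d).comp K')
  have f₀ : ι₀.IsFreeMap := isFreeMap_incl g e rfl K ψ.symm rfl
  -- `e^θ` is an automorphism of the model as a complete DGL, so it can be absorbed into the
  -- identification with the cylinder.
  have f₁ : ι₁.IsFreeMap := isFreeMap_incl g e rfl (K.comp (expHom d)) (ε.trans ψ.symm) (by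
    change ψ.symm.hom.comp ε.hom = _
    rw [hε]; rfl)
  have hp₀ : p.comp ι₀ = CDGL.Hom.id L := CDGL.Hom.ext_app fun k x => by
    change g'.app k ((proj d).app k (K'.app k (K.app k (incl.app k (g.app k x))))) = x
    rw [hK'K, proj_incl, hg'g]
  have hp₁ : p.comp ι₁ = CDGL.Hom.id L := CDGL.Hom.ext_app fun k x => by
    change g'.app k ((proj d).app k (K'.app k (K.app k ((expHom d).app k
      (incl.app k (g.app k x)))))) = x
    rw [hK'K, proj_expHom, proj_incl, hg'g]
  have hw : p.IsWeakEquiv := ((projContraction d).transport K' K hK'K hKK' (p := p) (fun k x =>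
    ⟨fun h => by
      have : g.app k (g'.app k ((proj d).app k (K'.app k x))) = g.app k 0 := congrArg _ h
      rwa [hgg', map_zero] at this, fun h => (congrArg (g'.app k) h).trans (map_zero _)⟩)).isWeakEquiv
    ι₀ hp₀
  refine ⟨ψ, hψ, ι₀, ι₁, p, fun x => ?_, fun x => ?_, fun x => ?_, fun x => ?_, fun x => ?_,
    f₀, f₁, f₀.isCofibration, f₁.isCofibration, ?_⟩
  · change K.app _ (incl.app _ (g.app _ (g'.app _ (free.gen x rfl)))) = gB x
    rw [hgg', incl_gen]
    exact (congrArg (K.app _) (hK'B x)).symm.trans (hKK' _ (gB x))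
  · change K.app _ ((expHom d).app _ (incl.app _ (g.app _ (g'.app _ (free.gen x rfl))))) = gH x
    rw [hgg', incl_gen]
    exact (congrArg (K.app _) (hK'H x)).symm.trans (hKK' _ (gH x))
  · change g'.app _ ((proj d).app _ (K'.app _ (gB x))) = g'.app _ (free.gen x rfl)
    rw [hK'B, proj_gB]
  · change g'.app _ ((proj d).app _ (K'.app _ (gH x))) = g'.app _ (free.gen x rfl)
    rw [hK'H, proj_expHom, proj_gB]
  · change g'.app _ ((proj d).app _ (K'.app _ (gS x))) = 0
    rw [hK'S, proj_gS, map_zero]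
  · refine ⟨CDGL.Hom.IsQuasiIsoAt.hNonneg (hw.quasiIso 0 CDGL.isMC_zero) hL, hp₀, hp₁,
      ⟨double d, (inlHom d).comp g, (inrHom d).comp g, doubleDesc (K.comp (inclHom d)) (K.comp ((expHom d).comp (inclHom d))),
      isCoproduct_double g g' hgg' hg'g, CDGL.Hom.ext_app fun k x => doubleDescLie_inl _ _ _,
      CDGL.Hom.ext_app fun k x => doubleDescLie_inr _ _ _, ?_⟩, hw⟩
    refine isCofibration_ends ?_ K K' hKK' hK'K
    -- Inductivity enters here: `0 → L` is a free map, hence `L` and its isomorphic copy `𝕃̂(V)` are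
    -- cofibrant.
    exact CDGL.fromZero_isCofibration_of_retract g g' hgg' hind.isCofibration
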